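/- Conventions. $\|\cdot\|$ is the Euclidean vector norm and the induced matrix norm. Floating point arithmetic of precision $\epsilon>0$ is the standard model: each of $+,-,\times,/,\sqrt{\ }$ returns the exact result with relative error at most $\epsilon$. Let $T=(t_{|i-j|})_{1\le i,j\le n}$ be a real symmetric positive definite Toeplitz matrix. Bounds are asymptotic as $\epsilon\to0^+$ with $T$ fixed: "$\|\Delta T\|=O(\epsilon t_0n^p)$" means that there is an absolute constant $C$ such that for every $n$ and $T$ there is $\epsilon_0(T)>0$ with $\|\Delta T\|\le C\epsilon t_0n^p$ for all $0<\epsilon<\epsilon_0(T)$ and every arithmetic of precision $\epsilon$. Algorithm FACTOR$(T)$. Start with $u_1=(t_0,t_1,\dots,t_{n-1})^T/\sqrt{t_0}$ and $v_1=(0,t_1,\dots,t_{n-1})^T/\sqrt{t_0}$. For $k=1,\dots,n-1$ put $s=(v_k)_{k+1}/(u_k)_k$, $c=\sqrt{(1-s)(1+s)}$, and, with $Z$ the shift-down matrix, compute $u_{k+1},v_{k+1}$ by one of * hyperbolic downdating: $u_{k+1}=(Zu_k-s\,v_k)/c$, $\ v_{k+1}=(v_k-s\,Zu_k)/c$; *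 mixed downdating, first variant: $v_{k+1}=(v_k-s\,Zu_k)/c$, $\ u_{k+1}=c\,Zu_k-s\,v_{k+1}$; * mixed downdating, second variant: $u_{k+1}=(Zu_k-s\,v_k)/c$ except that $(u_{k+1})_{k+1}=c\,(u_k)_k$, $\ v_{k+1}=c\,v_k-s\,u_{k+1}$; where in all cases the components with index at most $k$ of both vectors and the component $(v_{k+1})_{k+1}$ are set to $0$. Let $\tilde u_k$ be the computed vectors and let $\tilde U$ be the matrix with rows $\tilde u_1^T,\dots,\tilde u_n^T$. The symmetric Bareiss algorithm. Start with $A^{(0)}=T$. For $i=1,\dots,n-1$ compute $$A^{(i)}=A^{(i-1)}-\alpha Z^iA^{(-i+1)},\qquad A^{(-i)}=A^{(-i+1)}-\alpha'(Z^i)^TA^{(i-1)},$$ $$\alpha=A^{(i-1)}_{i+1,1}/A^{(-i+1)}_{1,1},\qquad \alpha'=A^{(-i+1)}_{1,i+1}/A^{(i-1)}_{i+1,i+1},$$ where the first $i$ rows of $A^{(i)}$ and the last $i$ rows of $A^{(-i)}$ are copied from the previous step, and the annihilated entries $A^{(i)}_{j+i,j}$ and $A^{(-i)}_{j,j+i}$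 are set to $0$. Let $\tilde W$ be the computed $A^{(n-1)}$ and $\tilde D$ its diagonal part (in exact arithmetic $T=W^TD^{-1}W$). Corollary 5.1. For all sufficiently small $\epsilon$ (depending only on $T$), FACTOR$(T)$ runs without division by zero or square root of a negative number and produces an upper triangular $\tilde U$ with positive diagonal such that $T=\tilde U^T\tilde U+\Delta T$, where $\|\Delta T\|=O(\epsilon t_0n^2)$ with mixed downdating (either variant) and $\|\Delta T\|=O(\epsilon t_0n^3)$ with hyperbolic downdating. Moreover the Bareiss algorithm is stable. There is a polynomial $c$ such that for every $n$ and $T$ and all sufficiently small $\epsilon$ (depending only on $T$) it runs without division by zero and produces an upper triangular $\tilde W$ with positive diagonal such that $T=\tilde W^T\tilde D^{-1}\tilde W+\Delta T$ with $\|\Delta T\|\le c(n)\,\epsilon\,\|T\|$. Suppose further that $Tx=b$ is solved by forward and back substitution in the same arithmetic, either with the factors $\tilde W^T,\tilde D^{-1},\tilde W$ or with the factors $\tilde U^T,\tilde U$ from FACTOR with any of the above kinds of downdating. Then each of these methods is backward stable: there is a polynomial $c$ such that, for every $n$ and $T$, all sufficiently small $\epsilon$ (depending only on $T$) and every $b$,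 the computed solution satisfies $\|T\tilde x-b\|\le c(n)\,\epsilon\,\|T\|\,\|\tilde x\|$. -/

import Mathlib

open scoped Matrix Matrix.Norms.L2Operator

noncomputable section

/-- Floating point arithmetic with relative precision `ε` (the standard model of rounding error
analysis): every arithmetic operation and every square root returns the exact result up to a
relative error of at most `ε`.  Nothing is required of a division by zero or of the square root
of a negative number. -/
structure FloatArith (ε : ℝ) where
  add : ℝ → ℝ → ℝ
  sub : ℝ → ℝ → ℝ
  mul : ℝ → ℝ → ℝ
  div : ℝ → ℝ → ℝ
  sqrt : ℝ → ℝ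
  add_err : ∀ a b, |add a b - (a + b)| ≤ ε * |a + b|
  sub_err : ∀ a b, |sub a b - (a - b)| ≤ ε * |a - b|
  mul_err : ∀ a b, |mul a b - a * b| ≤ ε * |a * b|
  div_err : ∀ a b, b ≠ 0 → |div a b - a / b| ≤ ε * |a / b|
  sqrt_err : ∀ a, 0 ≤ a → |sqrt a - √a| ≤ ε * √a

/-- The symmetric Toeplitz matrix with entries `t |i - j|`. -/
def toeplitz (n : ℕ) (t : ℕ → ℝ) : Matrix (Fin n) (Fin n) ℝ :=
  Matrix.of fun i j => t (Nat.dist i j)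

/-! Vectors and matrices inside the algorithms are indexed by natural numbers starting at `0`;
only the components with indices below the dimension `n` are used. -/

/-- The ways of realizing an elementary downdating step: hyperbolic downdating, mixed downdating
in which the new `v` is computed first, and mixed downdating in which the new `u` is computed
first. -/
inductive Downdating
  | hyperbolic
  | mixedV
  | mixedU

namespace Downdating

/-- The shift-down matrix `Z` applied to a vector. -/
def shiftDown (u : ℕ → ℝ) : ℕ → ℝ
  | 0 => 0
  | j + 1 => u j

/-- Computed `sin θ = v_{k+1} / u_k`. -/
def sin {ε : ℝ} (F : FloatArith ε) (k : ℕ) (u v : ℕ → ℝ) : ℝ :=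
  F.div (v (k + 1)) (u k)

/-- Computed `1 - sin² θ`, in the factored form `(1 - sin θ) (1 + sin θ)`. -/
def cosSq {ε : ℝ} (F : FloatArith ε) (k : ℕ) (u v : ℕ → ℝ) : ℝ :=
  F.mul (F.sub 1 (sin F k u v)) (F.add 1 (sin F k u v))

/-- Computed `cos θ = √(1 - sin² θ)`. -/
def cos {ε : ℝ} (F : FloatArith ε) (k : ℕ) (u v : ℕ → ℝ) : ℝ :=
  F.sqrt (cosSq F k u v)

/-- The computed new pair of components of `u` and `v`, from the sine `s`, the cosine `c`, the
component `x` of `Z u` and the component `y` of `v`.  In the pivot position the new component of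
`v` is set to zero, and the mixed rule that starts with `u` uses that the new component of `u`
there is `x cos θ`.  Elsewhere:
* hyperbolic: `u' = (x - s y) / c`, `v' = (y - s x) / c`;
* mixed, `v` first: `v' = (y - s x) / c`, `u' = c x - s v'`;
* mixed, `u` first: `u' = (x - s y) / c`, `v' = c y - s u'`. -/
def component {ε : ℝ} (F : FloatArith ε) (rule : Downdating) (pivot : Prop) [Decidable pivot]
    (s c x y : ℝ) : ℝ × ℝ :=
  match rule with
  | hyperbolic =>
      (F.div (F.sub x (F.mul s y)) c,
        if pivot then 0 else F.div (F.sub y (F.mul s x)) c)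
  | mixedV =>
      let v' := if pivot then 0 else F.div (F.sub y (F.mul s x)) c
      (F.sub (F.mul c x) (F.mul s v'), v')
  | mixedU =>
      let u' := if pivot then F.mul c x else F.div (F.sub x (F.mul s y)) c
      (u', if pivot then 0 else F.sub (F.mul c y) (F.mul s u'))

/-- One computed elementary downdating step, from `(u_k, v_k)` to `(u_{k+1}, v_{k+1})`.  The
components before the pivot position `k + 1` are zero and are not computed. -/
def step {ε : ℝ} (F : FloatArith ε) (rule : Downdating) (k : ℕ)
    (p : (ℕ → ℝ) × (ℕ → ℝ)) : (ℕ → ℝ) × (ℕ → ℝ) :=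
  let comp : ℕ → ℝ × ℝ := fun j =>
    if j ≤ k then (0, 0)
    else component F rule (j = k + 1) (sin F k p.1 p.2) (cos F k p.1 p.2)
      (shiftDown p.1 j) (p.2 j)
  (fun j => (comp j).1, fun j => (comp j).2)

end Downdating

/-- The pairs `(u_k, v_k)` computed by algorithm `FACTOR` for the Toeplitz matrix with entries
`t |i - j|`.  It starts from the computed generators `u = (t₀, t₁, t₂, …) / √t₀` and
`v = (0, t₁, t₂, …) / √t₀`. -/
def factorPair {ε : ℝ} (F : FloatArith ε) (rule : Downdating) (t : ℕ → ℝ) :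
    ℕ → (ℕ → ℝ) × (ℕ → ℝ)
  | 0 => (fun j => F.div (t j) (F.sqrt (t 0)),
      fun j => if j = 0 then 0 else F.div (t j) (F.sqrt (t 0)))
  | k + 1 => Downdating.step F rule k (factorPair F rule t k)

/-- The rows `u_k` computed by algorithm `FACTOR`. -/
def factorRows {ε : ℝ} (F : FloatArith ε) (rule : Downdating) (t : ℕ → ℝ) (k j : ℕ) : ℝ :=
  (factorPair F rule t k).1 j

/-- The factor `Ũ = ∑ e_k ũ_kᵀ` computed by algorithm `FACTOR` in dimension `n`. -/
def factor {ε : ℝ} (F : FloatArith ε) (rule : Downdating) (n : ℕ) (t : ℕ → ℝ) :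
    Matrix (Fin n) (Fin n) ℝ :=
  Matrix.of fun k j => factorRows F rule t k j

/-- Algorithm `FACTOR` runs to completion in dimension `n`: it never divides by zero or takes the
square root of a negative number. -/
def FactorRuns {ε : ℝ} (F : FloatArith ε) (rule : Downdating) (n : ℕ) (t : ℕ → ℝ) : Prop :=
  (0 < n → 0 ≤ t 0 ∧ F.sqrt (t 0) ≠ 0) ∧
  ∀ k, k + 1 < n →
    (factorPair F rule t k).1 k ≠ 0 ∧
    0 ≤ Downdating.cosSq F k (factorPair F rule t k).1 (factorPair F rule t k).2 ∧
    Downdating.cos F k (factorPair F rule t k).1 (factorPair F rule t k).2 ≠ 0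

/-! The symmetric Bareiss algorithm. -/

/-- The multiplier `A⁽ⁱ⁻¹⁾[i, 0] / A⁽⁻ⁱ⁺¹⁾[0, 0]` of step `i`, computed from
`p = (A⁽ⁱ⁻¹⁾, A⁽⁻ⁱ⁺¹⁾)`. -/
def bareissMulUpper {ε : ℝ} (F : FloatArith ε) (i : ℕ) (p : (ℕ → ℕ → ℝ) × (ℕ → ℕ → ℝ)) : ℝ :=
  F.div (p.1 i 0) (p.2 0 0)

/-- The multiplier `A⁽⁻ⁱ⁺¹⁾[0, i] / A⁽ⁱ⁻¹⁾[i, i]` of step `i`, computed from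
`p = (A⁽ⁱ⁻¹⁾, A⁽⁻ⁱ⁺¹⁾)`. -/
def bareissMulLower {ε : ℝ} (F : FloatArith ε) (i : ℕ) (p : (ℕ → ℕ → ℝ) × (ℕ → ℕ → ℝ)) : ℝ :=
  F.div (p.2 0 i) (p.1 i i)

/-- Step `i ≥ 1` of the Bareiss algorithm in dimension `n`:
`A⁽ⁱ⁾ = A⁽ⁱ⁻¹⁾ - α Zⁱ A⁽⁻ⁱ⁺¹⁾` and `A⁽⁻ⁱ⁾ = A⁽⁻ⁱ⁺¹⁾ - α' (Zⁱ)ᵀ A⁽ⁱ⁻¹⁾`.  The rows that do not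
change are copied, and the entries that the step annihilates (the `i`-th subdiagonal of `A⁽ⁱ⁾`
and the `i`-th superdiagonal of `A⁽⁻ⁱ⁾`) are set to zero. -/
def bareissStep {ε : ℝ} (F : FloatArith ε) (n i : ℕ) (p : (ℕ → ℕ → ℝ) × (ℕ → ℕ → ℝ)) :
    (ℕ → ℕ → ℝ) × (ℕ → ℕ → ℝ) :=
  (fun r c =>
      if r < i then p.1 r c
      else if c + i = r then 0
      else F.sub (p.1 r c) (F.mul (bareissMulUpper F i p) (p.2 (r - i) c)),
    fun r c =>
      if n ≤ r + i then p.2 r c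
      else if c = r + i then 0
      else F.sub (p.2 r c) (F.mul (bareissMulLower F i p) (p.1 (r + i) c)))

/-- The computed pair `(A⁽ⁱ⁾, A⁽⁻ⁱ⁾)` of the Bareiss algorithm, starting from
`A⁽⁰⁾ = (t |r - c|)`. -/
def bareissPair {ε : ℝ} (F : FloatArith ε) (n : ℕ) (t : ℕ → ℝ) :
    ℕ → (ℕ → ℕ → ℝ) × (ℕ → ℕ → ℝ)
  | 0 => (fun r c => t (Nat.dist r c), fun r c => t (Nat.dist r c))
  | i + 1 => bareissStep F n (i + 1) (bareissPair F n t i)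

/-- The entries of the computed matrix `A⁽ⁿ⁻¹⁾` of the Bareiss algorithm. -/
def bareissRows {ε : ℝ} (F : FloatArith ε) (n : ℕ) (t : ℕ → ℝ) : ℕ → ℕ → ℝ :=
  (bareissPair F n t (n - 1)).1

/-- The triangular matrix `W` computed by the Bareiss algorithm.  In exact arithmetic
`T = Wᵀ D⁻¹ W`, where `D` is the diagonal part of `W`. -/
def bareiss {ε : ℝ} (F : FloatArith ε) (n : ℕ) (t : ℕ → ℝ) : Matrix (Fin n) (Fin n) ℝ :=
  Matrix.of fun r c => bareissRows F n t r c

/-- The Bareiss algorithm runs to completion: it never divides by zero. -/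
def BareissRuns {ε : ℝ} (F : FloatArith ε) (n : ℕ) (t : ℕ → ℝ) : Prop :=
  ∀ i, i + 1 < n →
    (bareissPair F n t i).2 0 0 ≠ 0 ∧ (bareissPair F n t i).1 (i + 1) (i + 1) ≠ 0

/-! Linear systems are solved from the computed factors by substitution. -/

/-- Computed `b - a 0 * y 0 - ⋯ - a (m - 1) * y (m - 1)`, subtracting one product at a time. -/
def subDot {ε : ℝ} (F : FloatArith ε) (b : ℝ) (a y : ℕ → ℝ) : ℕ → ℝ
  | 0 => b
  | m + 1 => F.sub (subDot F b a y m) (F.mul (a m) (y m))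

/-- Forward substitution for `L y = b` with `L` lower triangular: after `m` steps the components
with indices below `m` have been computed. -/
def forwardSub {ε : ℝ} (F : FloatArith ε) (L : ℕ → ℕ → ℝ) (b : ℕ → ℝ) : ℕ → ℕ → ℝ
  | 0 => fun _ => 0
  | m + 1 => Function.update (forwardSub F L b m) m
      (F.div (subDot F (b m) (L m) (forwardSub F L b m) m) (L m m))

/-- Back substitution for `U x = b` with `U` upper triangular of dimension `n`: forward
substitution after reversing the order of the rows and of the columns. -/
def backSub {ε : ℝ} (F : FloatArith ε) (n : ℕ) (U : ℕ → ℕ → ℝ) (b : ℕ → ℝ) (i : ℕ) : ℝ :=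
  forwardSub F (fun r c => U (n - 1 - r) (n - 1 - c)) (fun r => b (n - 1 - r)) n (n - 1 - i)

/-- A vector of dimension `n` as a sequence. -/
def extendZero {n : ℕ} (b : EuclideanSpace ℝ (Fin n)) (i : ℕ) : ℝ :=
  if h : i < n then b ⟨i, h⟩ else 0

/-- Computed solution of `T x = b` from the factor of algorithm `FACTOR`: solve `Ũᵀ y = b`, then
`Ũ x = y`. -/
def factorSolve (rule : Downdating) {ε : ℝ} (F : FloatArith ε) (n : ℕ) (t : ℕ → ℝ)
    (b : EuclideanSpace ℝ (Fin n)) : EuclideanSpace ℝ (Fin n) :=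
  let y := forwardSub F (fun i j => factorRows F rule t j i) (extendZero b) n
  WithLp.toLp 2 fun i : Fin n => backSub F n (factorRows F rule t) y i

/-- Computed solution of `T x = b` by the Bareiss algorithm (`T = Wᵀ D⁻¹ W`): solve `Wᵀ y = b`,
then `W x = D y`. -/
def bareissSolve {ε : ℝ} (F : FloatArith ε) (n : ℕ) (t : ℕ → ℝ)
    (b : EuclideanSpace ℝ (Fin n)) : EuclideanSpace ℝ (Fin n) :=
  let y := forwardSub F (fun i j => bareissRows F n t j i) (extendZero b) n
  WithLp.toLp 2 fun i : Fin n =>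
    backSub F n (bareissRows F n t) (fun k => F.mul (bareissRows F n t k k) (y k)) i

/-- Backward stability, on symmetric positive definite Toeplitz systems `T x = b`, of an algorithm
with computed solution `x̃`: `‖T x̃ - b‖ ≤ c(n) ε ‖T‖ ‖x̃‖` with a polynomial `c`, for every
precision `ε` that is small enough for the matrix `T`. -/
def BackwardStable
    (solve : ∀ {ε : ℝ}, FloatArith ε → (n : ℕ) → (ℕ → ℝ) →
      EuclideanSpace ℝ (Fin n) → EuclideanSpace ℝ (Fin n)) : Prop :=
  ∃ c : Polynomial ℝ, ∀ (n : ℕ) (t : ℕ → ℝ), (toeplitz n t).PosDef →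
    ∃ ε₀ : ℝ, 0 < ε₀ ∧ ∀ ε : ℝ, 0 < ε → ε < ε₀ →
      ∀ (F : FloatArith ε) (b : EuclideanSpace ℝ (Fin n)),
        ‖WithLp.toLp 2 (toeplitz n t *ᵥ (solve F n t b).ofLp) - b‖ ≤
          c.eval (n : ℝ) * ε * ‖toeplitz n t‖ * ‖solve F n t b‖

end

/-! For the exact generators, `T - Z T Zᵀ = u₀u₀ᵀ - v₀v₀ᵀ`, and every downdating step preserves the
signed form: `u'u'ᵀ - v'v'ᵀ = (Zu)(Zu)ᵀ - vvᵀ`. Telescoping gives `T = ∑ u_k u_kᵀ`. If a computed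
step violates this identity by `G_k`, the same telescoping shows that, outside the first row and
column, the displacement of `E = ŨᵀŨ - T` is `∑ G_k`. Undoing the displacement adds up at most `n`
shifted copies. Hence `|G_k| ≤ ε r rᵀ` entrywise, with a weight vector `r = r_{k+1}`, yields `‖E‖ ≤
ε n ∑ ‖r_k‖²` (`norm_toeplitz_sub_le`, which also covers the first row).

It remains to find weights. In mixed downdating one of the maps `(Zu, v') ↦ (u', v)`, `(v, u') ↦
(v', Zu)` is a rotation up to rounding, so the weights are multiples of `|Zu| + |v| + |u'| + |v'|`
(`abs_displacement_rotation`). Since `‖v_k‖ ≤ ‖u_k‖` and `∑ ‖u_k‖²` is the trace `n t₀`, the bound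
is of order `n²`.

In hyperbolic downdating the error has terms `(|u'| + |v'|) / c` (`abs_displacement_hyperbolic`),
and `c` may be tiny. Then the new vectors are small too: one of `u' ± v'` is `O(c)`, and positivity
of the Schur complement makes `(u' + v') / (u' - v')` a Carathéodory function, with coefficients
bounded by 2. So `‖u'‖² + ‖v'‖² ≤ 10 n² c² ‖u‖²` (`sum_schur_succ_sq_le`), and balancing the cross
terms with a factor `√n` gives `n³`.

The Bareiss algorithm works, exactly even in rounded arithmetic, with unnormalized hyperbolic
downdating (`bareissPair_eq`). Its implicit cosine satisfies `c² + s² = 1` only up to an absolute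
error, which costs one more power of `n`.

Size estimates are proved only for the exact vectors. As `ε → 0` the computed quantities tend to
them uniformly over all arithmetics, so any strict estimate passes to the computed ones. The solvers
combine the factorization error with the componentwise residuals of two triangular solves
(`norm_residual_le`); since the squared Frobenius norm of the factor tends to `n t₀`, no condition
number enters. -/

open PowerSeries in
/-- The quadratic form with matrix `∑ₗ Zˡ (u uᵀ - v vᵀ) (Zˡ)ᵀ` in dimension `n`, at the vector
whose components in reverse order are the first coefficients of `Ξ`. -/
noncomputable def energy (n : ℕ) (U V Ξ : ℝ⟦X⟧) : ℝ :=
  ∑ i ∈ Finset.range n, ((coeff i (U * Ξ)) ^ 2 - (coeff i (V * Ξ)) ^ 2)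

open PowerSeries in
/-- The exact generators `(u_k, v_k)`, as power series. -/
noncomputable def schurPair (t : ℕ → ℝ) : ℕ → ℝ⟦X⟧ × ℝ⟦X⟧
  | 0 => (mk fun j => t j / √(t 0), mk fun j => if j = 0 then 0 else t j / √(t 0))
  | k + 1 =>
    let U := (schurPair t k).1
    let V := (schurPair t k).2
    let s := coeff (k + 1) V / coeff k U
    let c := √((1 - s) * (1 + s))
    (c⁻¹ • (X * U - s • V), c⁻¹ • (V - s • (X * U)))

open PowerSeries in
/-- The exact sine of step `k`. -/
noncomputable def schurSin (t : ℕ → ℝ) (k : ℕ) : ℝ :=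
  coeff (k + 1) (schurPair t k).2 / coeff k (schurPair t k).1

/-- The exact cosine of step `k`. -/
noncomputable def schurCos (t : ℕ → ℝ) (k : ℕ) : ℝ :=
  √((1 - schurSin t k) * (1 + schurSin t k))

open PowerSeries in
/-- The components of the exact `u_k`. -/
noncomputable def schurU (t : ℕ → ℝ) (k j : ℕ) : ℝ := coeff j (schurPair t k).1

open PowerSeries in
/-- The components of the exact `v_k`. -/
noncomputable def schurV (t : ℕ → ℝ) (k j : ℕ) : ℝ := coeff j (schurPair t k).2

/-! ### The quadratic form of the generators and its Schur complements. -/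

section Energy

open PowerSeries

theorem schurPair_succ (t : ℕ → ℝ) (k : ℕ) :
    schurPair t (k + 1) =
      ((schurCos t k)⁻¹ • (X * (schurPair t k).1 - schurSin t k • (schurPair t k).2),
        (schurCos t k)⁻¹ • ((schurPair t k).2 - schurSin t k • (X * (schurPair t k).1))) := rfl

theorem coeff_X_mul_eq_shiftDown (U : ℝ⟦X⟧) (j : ℕ) :
    coeff j (X * U) = Downdating.shiftDown (fun i => coeff i U) j := by
  cases j with
  | zero => simp [Downdating.shiftDown]
  | succ j => simp [Downdating.shiftDown, coeff_succ_X_mul]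

theorem schurU_succ (t : ℕ → ℝ) (k j : ℕ) : schurU t (k + 1) j =
    (Downdating.shiftDown (schurU t k) j - schurSin t k * schurV t k j) / schurCos t k := by
  rw [schurU, schurPair_succ]
  simp [coeff_X_mul_eq_shiftDown, schurV, schurU, Downdating.shiftDown, div_eq_inv_mul]

theorem schurV_succ (t : ℕ → ℝ) (k j : ℕ) : schurV t (k + 1) j =
    (schurV t k j - schurSin t k * Downdating.shiftDown (schurU t k) j) / schurCos t k := by
  rw [schurV, schurPair_succ]
  simp [coeff_X_mul_eq_shiftDown, schurV, schurU, Downdating.shiftDown, div_eq_inv_mul]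

/-- A hyperbolic rotation preserves `a² - b²` in every coefficient separately. -/
theorem energy_downdate {s c : ℝ} (hc : c ^ 2 = (1 - s) * (1 + s)) (hc0 : c ≠ 0) (n : ℕ)
    (U V Ξ : ℝ⟦X⟧) :
    energy n (c⁻¹ • (U - s • V)) (c⁻¹ • (V - s • U)) Ξ = energy n U V Ξ := by
  unfold energy
  refine Finset.sum_congr rfl fun i _ => ?_
  simp only [smul_mul_assoc, sub_mul, map_smul, map_sub, smul_eq_mul]
  field_simp
  rw [hc]
  ring

/-- In reversed order the `l`-th shift of `u` is paired with the vector in coefficient `m - l` of `U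
* Ξ`. Shifting `u` therefore drops the top coefficient, which is the unshifted term `u uᵀ`: this is
the passage to the Schur complement. -/
theorem energy_X_mul (m : ℕ) (U V Ξ : ℝ⟦X⟧) :
    energy (m + 1) (X * U) V Ξ = energy (m + 1) U V Ξ - (coeff m (U * Ξ)) ^ 2 := by
  unfold energy
  rw [Finset.sum_sub_distrib, Finset.sum_sub_distrib, Finset.sum_range_succ',
    Finset.sum_range_succ (fun i => (coeff i (U * Ξ)) ^ 2)]
  simp only [mul_assoc, coeff_succ_X_mul, coeff_zero_X_mul]
  ring

theorem coeff_mul_eq_zero_of_dvd {p q i : ℕ} {U Ξ : ℝ⟦X⟧} (hU : (X : ℝ⟦X⟧) ^ p ∣ U)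
    (hΞ : (X : ℝ⟦X⟧) ^ q ∣ Ξ) (hi : i < p + q) : coeff i (U * Ξ) = 0 := by
  have h : (X : ℝ⟦X⟧) ^ (p + q) ∣ U * Ξ := by
    rw [pow_add]; exact mul_dvd_mul hU hΞ
  exact X_pow_dvd_iff.mp h i hi

theorem coeff_mul_X_pow_eq {j m : ℕ} (hj : j ≤ m) (U : ℝ⟦X⟧) :
    coeff m (U * X ^ (m - j)) = coeff j U := by
  rw [coeff_mul_X_pow', if_pos (Nat.sub_le m j), Nat.sub_sub_self hj]

/-- A Schur complement of a positive definite form is positive definite. -/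
theorem energy_X_mul_pos {m k : ℕ} {U V : ℝ⟦X⟧} (hk : k ≤ m) (hU : (X : ℝ⟦X⟧) ^ k ∣ U)
    (hV : (X : ℝ⟦X⟧) ^ (k + 1) ∣ V) (hu : 0 < coeff k U)
    (hpos : ∀ Ξ : ℝ⟦X⟧, (∃ i, i + k < m + 1 ∧ coeff i Ξ ≠ 0) → 0 < energy (m + 1) U V Ξ)
    {Ξ : ℝ⟦X⟧} (hΞ : ∃ i, i + k < m ∧ coeff i Ξ ≠ 0) : 0 < energy (m + 1) (X * U) V Ξ := by
  obtain ⟨i, hi, hi0⟩ := hΞ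
  -- `α` makes the corrected vector orthogonal to `u`. The correction sits in component `k`
  -- (reversed index `m - k`), which `X * U` and `V` do not see because they start at `k + 1`.
  set α : ℝ := -(coeff m (U * Ξ)) / coeff k U
  have hXU : (X : ℝ⟦X⟧) ^ (k + 1) ∣ X * U := by
    rw [pow_succ']; exact mul_dvd_mul_left _ hU
  have hlow : ∀ W : ℝ⟦X⟧, (X : ℝ⟦X⟧) ^ (k + 1) ∣ W → ∀ j < m + 1,
      coeff j (W * (Ξ + α • X ^ (m - k))) = coeff j (W * Ξ) := by
    intro W hW j hj
    rw [mul_add, map_add, mul_smul_comm, map_smul,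
      coeff_mul_eq_zero_of_dvd hW (dvd_refl (X ^ (m - k))) (by omega)]
    simp
  have h1 : energy (m + 1) (X * U) V (Ξ + α • X ^ (m - k)) = energy (m + 1) (X * U) V Ξ := by
    unfold energy
    refine Finset.sum_congr rfl fun j hj => ?_
    rw [hlow _ hXU j (Finset.mem_range.mp hj), hlow _ hV j (Finset.mem_range.mp hj)]
  have h2 : coeff m (U * (Ξ + α • X ^ (m - k))) = 0 := by
    rw [mul_add, map_add, mul_smul_comm, map_smul, coeff_mul_X_pow_eq hk, smul_eq_mul]
    simp only [α]
    field_simp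
    ring
  have h3 := hpos (Ξ + α • X ^ (m - k)) ⟨i, by omega, by
    rw [map_add, map_smul, coeff_X_pow, if_neg (by omega)]
    simpa using hi0⟩
  rw [← h1, energy_X_mul, h2]
  simpa using h3

/-- The test vector is the unit vector `e_{k+1}`, at which the form is the diagonal entry `u_k² -
v_{k+1}²` of the Schur complement. -/
theorem abs_coeff_lt_of_energy_pos {m k : ℕ} {U V : ℝ⟦X⟧} (hk : k < m)
    (hU : (X : ℝ⟦X⟧) ^ k ∣ U) (hV : (X : ℝ⟦X⟧) ^ (k + 1) ∣ V)
    (hpos : 0 < energy (m + 1) (X * U) V (X ^ (m - (k + 1)))) :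
    (coeff (k + 1) V) ^ 2 < (coeff k U) ^ 2 := by
  have hXU : (X : ℝ⟦X⟧) ^ (k + 1) ∣ X * U := by
    rw [pow_succ']; exact mul_dvd_mul_left _ hU
  rw [energy, Finset.sum_range_succ, Finset.sum_eq_zero, coeff_mul_X_pow_eq (by omega),
    coeff_mul_X_pow_eq (by omega), coeff_succ_X_mul] at hpos
  · linarith
  · intro i hi
    have hi := Finset.mem_range.mp hi
    rw [coeff_mul_eq_zero_of_dvd hXU (dvd_refl _) (by omega),
      coeff_mul_eq_zero_of_dvd hV (dvd_refl _) (by omega)]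
    ring

/-- The form at the start is the one of the Toeplitz matrix. -/
theorem energy_schurPair_zero {t : ℕ → ℝ} (ht : 0 < t 0) (n : ℕ) (Ξ : ℝ⟦X⟧) :
    energy n (schurPair t 0).1 (schurPair t 0).2 Ξ =
      ∑ i ∈ Finset.range n, ∑ j ∈ Finset.range n,
        t (Nat.dist i j) * coeff i Ξ * coeff j Ξ := by
  -- The generators differ only by `√t₀ e₀`, so each difference of squares is `t₀ ξ_i²` plus a cross
  -- term linear in `V * Ξ`: exactly the new row and column of `T` as `n` grows by one.
  have hU : (schurPair t 0).1 = (schurPair t 0).2 + √(t 0) • (1 : ℝ⟦X⟧) := by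
    ext j
    simp only [schurPair, coeff_mk, map_add, map_smul, smul_eq_mul, coeff_one]
    split_ifs with h
    · subst h; simp
    · simp
  have hV : ∀ i, √(t 0) * coeff i ((schurPair t 0).2 * Ξ) =
      ∑ j ∈ Finset.range i, t (i - j) * coeff j Ξ := by
    intro i
    rw [mul_comm (schurPair t 0).2, coeff_mul,
      Finset.Nat.sum_antidiagonal_eq_sum_range_succ_mk, Finset.sum_range_succ, mul_add,
      Finset.mul_sum]
    simp only [schurPair, coeff_mk, Nat.sub_self, if_true, mul_zero, add_zero]
    refine Finset.sum_congr rfl fun j hj => ?_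
    have hj := Finset.mem_range.mp hj
    rw [if_neg (by omega)]
    field_simp
  have hsq : √(t 0) ^ 2 = t 0 := Real.sq_sqrt ht.le
  induction n with
  | zero => simp [energy]
  | succ n ih =>
    rw [energy, Finset.sum_range_succ, ← energy, ih, Finset.sum_range_succ]
    simp only [Finset.sum_range_succ _ n, Finset.sum_add_distrib]
    have h1 : ∑ i ∈ Finset.range n, t (Nat.dist i n) * coeff i Ξ * coeff n Ξ =
        coeff n Ξ * ∑ j ∈ Finset.range n, t (n - j) * coeff j Ξ := by
      rw [Finset.mul_sum]
      refine Finset.sum_congr rfl fun j hj => ?_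
      rw [Nat.dist_eq_sub_of_le (Finset.mem_range.mp hj).le]
      ring
    have h2 : ∑ j ∈ Finset.range n, t (Nat.dist n j) * coeff n Ξ * coeff j Ξ =
        coeff n Ξ * ∑ j ∈ Finset.range n, t (n - j) * coeff j Ξ := by
      rw [← h1]
      refine Finset.sum_congr rfl fun j hj => ?_
      rw [Nat.dist_comm]
      ring
    rw [h1, h2, Nat.dist_self, ← hV, hU, add_mul, map_add, smul_mul_assoc, map_smul, one_mul,
      smul_eq_mul]
    linear_combination (coeff n Ξ) ^ 2 * hsq

theorem toeplitz_zero_pos {n : ℕ} {t : ℕ → ℝ} (hT : (toeplitz n t).PosDef) (hn : 0 < n) :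
    0 < t 0 := by
  have := hT.diag_pos (i := (⟨0, hn⟩ : Fin n))
  simpa [toeplitz] using this

theorem toeplitz_form_pos {n : ℕ} {t : ℕ → ℝ} (hT : (toeplitz n t).PosDef) (x : ℕ → ℝ)
    (hx : ∃ i < n, x i ≠ 0) :
    0 < ∑ i ∈ Finset.range n, ∑ j ∈ Finset.range n, t (Nat.dist i j) * x i * x j := by
  obtain ⟨i, hi, hxi⟩ := hx
  have h := hT.dotProduct_mulVec_pos (x := fun i : Fin n => x i)
    (fun h => hxi (congrFun h ⟨i, hi⟩))
  simp only [dotProduct, Matrix.mulVec, toeplitz, Matrix.of_apply, Pi.star_apply, star_trivial,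
    Finset.mul_sum] at h
  simp only [Finset.sum_range]
  refine h.trans_eq (Finset.sum_congr rfl fun i _ => Finset.sum_congr rfl fun j _ => ?_)
  ring

end Energy

/-! ### The exact algorithm: existence, trace identity, and size of the vectors. -/

section SchurBounds

open PowerSeries

/-- Positivity of the form forces `|s| < 1` in step `k`, hence a positive cosine; the rotation then
transports positivity of the Schur complement to the next generators. -/
theorem schur_invariant {n : ℕ} {t : ℕ → ℝ} (hT : (toeplitz n t).PosDef) (k : ℕ) (hk : k < n) :
    (X : ℝ⟦X⟧) ^ k ∣ (schurPair t k).1 ∧ (X : ℝ⟦X⟧) ^ (k + 1) ∣ (schurPair t k).2 ∧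
    0 < coeff k (schurPair t k).1 ∧
    (∀ Ξ : ℝ⟦X⟧, (∃ i, i + k < n ∧ coeff i Ξ ≠ 0) →
      0 < energy n (schurPair t k).1 (schurPair t k).2 Ξ) ∧
    (k + 1 < n → (schurSin t k) ^ 2 < 1) := by
  obtain ⟨m, rfl⟩ : ∃ m, n = m + 1 := ⟨n - 1, by omega⟩
  have ht := toeplitz_zero_pos hT (Nat.succ_pos m)
  have hsin : ∀ k, (X : ℝ⟦X⟧) ^ k ∣ (schurPair t k).1 →
      (X : ℝ⟦X⟧) ^ (k + 1) ∣ (schurPair t k).2 → 0 < coeff k (schurPair t k).1 →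
      (∀ Ξ : ℝ⟦X⟧, (∃ i, i + k < m + 1 ∧ coeff i Ξ ≠ 0) →
        0 < energy (m + 1) (schurPair t k).1 (schurPair t k).2 Ξ) →
      k + 1 < m + 1 → (schurSin t k) ^ 2 < 1 := by
    intro k hU hV hu hpos hk
    have h := abs_coeff_lt_of_energy_pos (by omega) hU hV
      (energy_X_mul_pos (by omega) hU hV hu hpos (Ξ := X ^ (m - (k + 1)))
        ⟨m - (k + 1), by omega, by simp [coeff_X_pow]⟩)
    rw [schurSin, div_pow, div_lt_one (by positivity)]
    exact h
  induction k with
  | zero =>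
    have h1 : (X : ℝ⟦X⟧) ^ 0 ∣ (schurPair t 0).1 := by simp
    have h2 : (X : ℝ⟦X⟧) ^ (0 + 1) ∣ (schurPair t 0).2 := by
      rw [X_pow_dvd_iff]
      intro m hm
      obtain rfl : m = 0 := by omega
      simp [schurPair]
    have h3 : 0 < coeff 0 (schurPair t 0).1 := by
      simp only [schurPair, coeff_mk]
      positivity
    have h4 : ∀ Ξ : ℝ⟦X⟧, (∃ i, i + 0 < m + 1 ∧ coeff i Ξ ≠ 0) →
        0 < energy (m + 1) (schurPair t 0).1 (schurPair t 0).2 Ξ := by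
      intro Ξ hΞ
      rw [energy_schurPair_zero ht]
      exact toeplitz_form_pos hT (fun i => coeff i Ξ) hΞ
    exact ⟨h1, h2, h3, h4, hsin 0 h1 h2 h3 h4⟩
  | succ k ih =>
    obtain ⟨hU, hV, hu, hpos, hs⟩ := ih (by omega)
    have hs := hs hk
    have hs1 : 0 < (1 - schurSin t k) * (1 + schurSin t k) := by nlinarith
    have hc : 0 < schurCos t k := Real.sqrt_pos.mpr hs1
    have hcs : schurCos t k ^ 2 = (1 - schurSin t k) * (1 + schurSin t k) := Real.sq_sqrt hs1.le
    have hXU : (X : ℝ⟦X⟧) ^ (k + 1) ∣ X * (schurPair t k).1 := by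
      rw [pow_succ']; exact mul_dvd_mul_left _ hU
    -- The sine is chosen to annihilate this coefficient, which gives `v` one more order of
    -- vanishing than `u`.
    have hpiv : coeff (k + 1) (schurPair t k).2 =
        schurSin t k * coeff k (schurPair t k).1 := by
      rw [schurSin]; field_simp
    have h1 : (X : ℝ⟦X⟧) ^ (k + 1) ∣ (schurPair t (k + 1)).1 := by
      rw [schurPair_succ]
      exact dvd_smul_of_dvd _ (dvd_sub hXU (dvd_smul_of_dvd _ hV))
    have h2 : (X : ℝ⟦X⟧) ^ (k + 1 + 1) ∣ (schurPair t (k + 1)).2 := by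
      have h0 : (X : ℝ⟦X⟧) ^ (k + 1) ∣ (schurPair t (k + 1)).2 := by
        rw [schurPair_succ]
        exact dvd_smul_of_dvd _ (dvd_sub hV (dvd_smul_of_dvd _ hXU))
      rw [X_pow_dvd_iff] at h0 ⊢
      intro j hj
      rcases Nat.lt_succ_iff_lt_or_eq.mp hj with hj | rfl
      · exact h0 j hj
      · rw [schurPair_succ]
        simp [coeff_succ_X_mul, hpiv]
    have h3 : 0 < coeff (k + 1) (schurPair t (k + 1)).1 := by
      rw [schurPair_succ]
      simp only [map_smul, map_sub, coeff_succ_X_mul, smul_eq_mul, hpiv]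
      have : coeff k (schurPair t k).1 - schurSin t k * (schurSin t k * coeff k (schurPair t k).1)
          = (1 - schurSin t k) * (1 + schurSin t k) * coeff k (schurPair t k).1 := by ring
      rw [this]
      positivity
    have h4 : ∀ Ξ : ℝ⟦X⟧, (∃ i, i + (k + 1) < m + 1 ∧ coeff i Ξ ≠ 0) →
        0 < energy (m + 1) (schurPair t (k + 1)).1 (schurPair t (k + 1)).2 Ξ := by
      intro Ξ ⟨i, hi, hi0⟩
      rw [schurPair_succ, energy_downdate hcs hc.ne']
      exact energy_X_mul_pos (by omega) hU hV hu hpos ⟨i, by omega, hi0⟩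
    exact ⟨h1, h2, h3, h4, hsin _ h1 h2 h3 h4⟩

theorem schurU_eq_zero {n : ℕ} {t : ℕ → ℝ} (hT : (toeplitz n t).PosDef) {k j : ℕ} (hk : k < n)
    (hj : j < k) : schurU t k j = 0 :=
  X_pow_dvd_iff.mp (schur_invariant hT k hk).1 j hj

theorem schurV_eq_zero {n : ℕ} {t : ℕ → ℝ} (hT : (toeplitz n t).PosDef) {k j : ℕ} (hk : k < n)
    (hj : j ≤ k) : schurV t k j = 0 :=
  X_pow_dvd_iff.mp (schur_invariant hT k hk).2.1 j (Nat.lt_succ_of_le hj)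

theorem schurU_diag_pos {n : ℕ} {t : ℕ → ℝ} (hT : (toeplitz n t).PosDef) {k : ℕ} (hk : k < n) :
    0 < schurU t k k :=
  (schur_invariant hT k hk).2.2.1

theorem schurSin_sq_lt {n : ℕ} {t : ℕ → ℝ} (hT : (toeplitz n t).PosDef) {k : ℕ}
    (hk : k + 1 < n) : schurSin t k ^ 2 < 1 :=
  (schur_invariant hT k (by omega)).2.2.2.2 hk

theorem schurCosSq_pos {n : ℕ} {t : ℕ → ℝ} (hT : (toeplitz n t).PosDef) {k : ℕ}
    (hk : k + 1 < n) : 0 < (1 - schurSin t k) * (1 + schurSin t k) := by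
  have := schurSin_sq_lt hT hk
  nlinarith

theorem schurCos_pos {n : ℕ} {t : ℕ → ℝ} (hT : (toeplitz n t).PosDef) {k : ℕ}
    (hk : k + 1 < n) : 0 < schurCos t k :=
  Real.sqrt_pos.mpr (schurCosSq_pos hT hk)

theorem schurCos_sq {n : ℕ} {t : ℕ → ℝ} (hT : (toeplitz n t).PosDef) {k : ℕ}
    (hk : k + 1 < n) : schurCos t k ^ 2 = (1 - schurSin t k) * (1 + schurSin t k) :=
  Real.sq_sqrt (schurCosSq_pos hT hk).le

theorem schurV_pivot {n : ℕ} {t : ℕ → ℝ} (hT : (toeplitz n t).PosDef) {k : ℕ} (hk : k < n) :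
    schurV t k (k + 1) = schurSin t k * schurU t k k := by
  have := schurU_diag_pos hT hk
  unfold schurU at this
  rw [schurSin, schurV, schurU]
  field_simp

theorem energy_schurPair_succ {n : ℕ} {t : ℕ → ℝ} (hT : (toeplitz n t).PosDef) {k : ℕ}
    (hk : k + 1 < n) (Ξ : ℝ⟦X⟧) :
    energy n (schurPair t (k + 1)).1 (schurPair t (k + 1)).2 Ξ =
      energy n (schurPair t k).1 (schurPair t k).2 Ξ -
        (coeff (n - 1) ((schurPair t k).1 * Ξ)) ^ 2 := by
  obtain ⟨m, rfl⟩ : ∃ m, n = m + 1 := ⟨n - 1, by omega⟩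
  rw [schurPair_succ, energy_downdate (schurCos_sq hT hk) (schurCos_pos hT hk).ne', energy_X_mul]
  rfl

/-- The diagonal of `T = ∑ u_k u_kᵀ`. -/
theorem sum_schurU_sq {n : ℕ} {t : ℕ → ℝ} (hT : (toeplitz n t).PosDef) {j : ℕ} (hj : j < n) :
    ∑ k ∈ Finset.range n, schurU t k j ^ 2 = t 0 := by
  obtain ⟨m, rfl⟩ : ∃ m, n = m + 1 := ⟨n - 1, by omega⟩
  have ht := toeplitz_zero_pos hT (Nat.succ_pos m)
  have hsum : ∀ (Ξ : ℝ⟦X⟧) k, k < m + 1 →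
      ∑ l ∈ Finset.range k, (coeff m ((schurPair t l).1 * Ξ)) ^ 2 =
        energy (m + 1) (schurPair t 0).1 (schurPair t 0).2 Ξ -
          energy (m + 1) (schurPair t k).1 (schurPair t k).2 Ξ := by
    intro Ξ k hk
    induction k with
    | zero => simp
    | succ k ih =>
      rw [Finset.sum_range_succ, ih (by omega), energy_schurPair_succ hT hk]
      simp only [Nat.add_sub_cancel]
      ring
  -- At the last index nothing of `v` is left below the dimension and only one component of `u`, so
  -- the form is a single square.
  have hlast : ∀ Ξ : ℝ⟦X⟧, energy (m + 1) (schurPair t m).1 (schurPair t m).2 Ξ =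
      (coeff m ((schurPair t m).1 * Ξ)) ^ 2 := by
    intro Ξ
    obtain ⟨hU, hV, -⟩ := schur_invariant hT m (Nat.lt_succ_self m)
    rw [energy, Finset.sum_range_succ, Finset.sum_eq_zero,
      coeff_mul_eq_zero_of_dvd hV (q := 0) (by simp) (by omega)]
    · ring
    · intro i hi
      have hi := Finset.mem_range.mp hi
      rw [coeff_mul_eq_zero_of_dvd hU (q := 0) (by simp) (by omega),
        coeff_mul_eq_zero_of_dvd hV (q := 0) (by simp) (by omega)]
      ring
  -- In reversed order this monomial is the unit vector `e_j`.
  have h := hsum (X ^ (m - j)) m (Nat.lt_succ_self m)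
  rw [hlast, energy_schurPair_zero ht] at h
  rw [Finset.sum_range_succ]
  have hj' : j ≤ m := by omega
  simp only [coeff_mul_X_pow_eq hj'] at h
  unfold schurU
  rw [h, sub_add_cancel, Finset.sum_eq_single (m - j), Finset.sum_eq_single (m - j)]
  · simp [coeff_X_pow]
  · intro i _ hi
    simp [coeff_X_pow, hi]
  · intro h
    exact absurd (Finset.mem_range.mpr (by omega)) h
  · intro i _ hi
    simp [coeff_X_pow, hi]
  · intro h
    exact absurd (Finset.mem_range.mpr (by omega)) h

theorem sum_sum_schurU_sq {n : ℕ} {t : ℕ → ℝ} (hT : (toeplitz n t).PosDef) :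
    ∑ k ∈ Finset.range n, ∑ j ∈ Finset.range n, schurU t k j ^ 2 = n * t 0 := by
  rw [Finset.sum_comm, Finset.sum_congr rfl fun j hj =>
    sum_schurU_sq hT (Finset.mem_range.mp hj)]
  simp

/-- At `Ξ = 1`, the last unit vector, the positive form equals `‖u_k‖² - ‖v_k‖²`. -/
theorem sum_schurV_sq_le {n : ℕ} {t : ℕ → ℝ} (hT : (toeplitz n t).PosDef) {k : ℕ} (hk : k < n) :
    ∑ j ∈ Finset.range n, schurV t k j ^ 2 ≤ ∑ j ∈ Finset.range n, schurU t k j ^ 2 := by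
  have h := (schur_invariant hT k hk).2.2.2.1 1 ⟨0, by omega, by simp⟩
  rw [energy, Finset.sum_sub_distrib] at h
  simp only [mul_one] at h
  exact (sub_pos.mp h).le

theorem sum_shiftDown_sq_le (n : ℕ) (u : ℕ → ℝ) :
    ∑ j ∈ Finset.range n, Downdating.shiftDown u j ^ 2 ≤ ∑ j ∈ Finset.range n, u j ^ 2 := by
  cases n with
  | zero => simp
  | succ n =>
    rw [Finset.sum_range_succ', Finset.sum_range_succ]
    simp only [Downdating.shiftDown]
    nlinarith [sq_nonneg (u n)]

/-- Carathéodory's bound, for a quotient `B / A` with nonnegative real part. -/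
theorem abs_coeff_quotient_le {N : ℕ} {A B : ℝ⟦X⟧} (h0 : coeff 0 B = coeff 0 A)
    (hA : coeff 0 A ≠ 0)
    (hpos : ∀ Ξ : ℝ⟦X⟧,
      0 ≤ ∑ i ∈ Finset.range N, coeff i (A * Ξ) * coeff i (B * Ξ)) {j : ℕ} (hj : j < N) :
    |coeff j (B * A⁻¹)| ≤ 2 := by
  have hA' : constantCoeff A ≠ 0 := by simpa using hA
  set H := B * A⁻¹
  have hAA : A * A⁻¹ = 1 := PowerSeries.mul_inv_cancel A hA'
  have hH0 : coeff 0 H = 1 := by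
    have h1 : A * H = B := by
      simp only [H]
      rw [mul_left_comm, hAA, mul_one]
    have h2 := congrArg (coeff 0) h1
    rw [coeff_zero_eq_constantCoeff_apply, map_mul, ← coeff_zero_eq_constantCoeff_apply,
      ← coeff_zero_eq_constantCoeff_apply, h0] at h2
    exact mul_left_cancel₀ hA (by rw [mul_one]; exact h2)
  rcases Nat.eq_zero_or_pos j with rfl | hj0
  · rw [hH0]; norm_num
  -- With the test series `A⁻¹ (1 + σ X^j)` only coefficients `0` and `j` survive, contributing `1`
  -- and `σ (h_j + σ)`.
  have key : ∀ σ : ℝ, σ ^ 2 = 1 → 0 ≤ 2 + σ * coeff j H := by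
    intro σ hσ
    have h := hpos (A⁻¹ * (1 + σ • X ^ j))
    rw [← mul_assoc, ← mul_assoc, hAA, one_mul, Finset.sum_eq_add_of_mem 0 j
      (Finset.mem_range.mpr (by omega)) (Finset.mem_range.mpr hj) hj0.ne] at h
    · have e1 : coeff j ((1 : ℝ⟦X⟧) + σ • X ^ j) = σ := by
        simp [coeff_one, coeff_X_pow, hj0.ne']
      have e2 : coeff 0 ((1 : ℝ⟦X⟧) + σ • X ^ j) = 1 := by
        simp [hj0.ne']
      have e3 : coeff j (H * (1 + σ • X ^ j)) = coeff j H + σ := by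
        rw [mul_add, mul_one, map_add, mul_smul_comm, map_smul, coeff_mul_X_pow', if_pos le_rfl,
          Nat.sub_self, hH0]
        simp
      have e4 : coeff 0 (H * (1 + σ • X ^ j)) = 1 := by
        rw [mul_add, mul_one, map_add, mul_smul_comm, map_smul, coeff_mul_X_pow',
          if_neg (by omega), hH0]
        simp
      change 0 ≤ coeff 0 _ * coeff 0 (H * _) + coeff j _ * coeff j (H * _) at h
      rw [e1, e2, e3, e4] at h
      linarith
    · intro i _ hi
      have : coeff i ((1 : ℝ⟦X⟧) + σ • X ^ j) = 0 := by
        simp [coeff_one, coeff_X_pow, hi.1, hi.2]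
      rw [this, zero_mul]
  have h1 := key 1 (by norm_num)
  have h2 := key (-1) (by norm_num)
  rw [abs_le]
  constructor <;> linarith

/-- After division by `X^p`, `B = H A` with coefficients of `H` bounded by 2, so `|b_i| ≤ 2 ∑
|a_j|`. Cauchy–Schwarz gives one factor `n` and summation over `i` the other. -/
theorem sum_coeff_sq_le_of_form_nonneg {n p : ℕ} {A B : ℝ⟦X⟧} (hA : (X : ℝ⟦X⟧) ^ p ∣ A)
    (hB : (X : ℝ⟦X⟧) ^ p ∣ B) (h0 : coeff p B = coeff p A) (hp : coeff p A ≠ 0)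
    (hpos : ∀ Ξ : ℝ⟦X⟧,
      0 ≤ ∑ i ∈ Finset.range n, coeff i (A * Ξ) * coeff i (B * Ξ)) :
    ∑ i ∈ Finset.range n, coeff i B ^ 2 ≤
      4 * (n : ℝ) ^ 2 * ∑ i ∈ Finset.range n, coeff i A ^ 2 := by
  obtain ⟨A, rfl⟩ := hA
  obtain ⟨B, rfl⟩ := hB
  rcases le_total n p with hn | hn
  · rw [Finset.sum_eq_zero]
    · exact mul_nonneg (by positivity) (Finset.sum_nonneg fun i _ => sq_nonneg _)
    · intro i hi
      have hi := Finset.mem_range.mp hi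
      rw [coeff_X_pow_mul', if_neg (by omega)]
      simp
  obtain ⟨N, rfl⟩ := Nat.exists_eq_add_of_le hn
  have hzero : ∀ f : ℕ → ℝ, (∀ i < p, f i = 0) →
      ∑ i ∈ Finset.range (p + N), f i = ∑ i ∈ Finset.range N, f (i + p) := by
    intro f hf
    rw [Finset.sum_range_add, Finset.sum_eq_zero fun i hi => hf i (Finset.mem_range.mp hi),
      zero_add]
    simp only [add_comm p]
  have hlow : ∀ (W : ℝ⟦X⟧), ∀ i < p, coeff i (X ^ p * W) = 0 := by
    intro W i hi
    rw [coeff_X_pow_mul', if_neg (by omega)]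
  rw [hzero _ fun i hi => by rw [hlow _ i hi]; ring,
    hzero _ fun i hi => by rw [hlow _ i hi]; ring]
  have hpos' : ∀ Ξ : ℝ⟦X⟧,
      0 ≤ ∑ i ∈ Finset.range N, coeff i (A * Ξ) * coeff i (B * Ξ) := by
    intro Ξ
    have h := hpos Ξ
    rw [hzero _ fun i hi => by rw [mul_assoc, hlow _ i hi, zero_mul]] at h
    simpa only [mul_assoc, coeff_X_pow_mul] using h
  have h0' : coeff 0 B = coeff 0 A := by
    simpa [coeff_X_pow_mul'] using h0
  have hp' : coeff 0 A ≠ 0 := by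
    simpa [coeff_X_pow_mul'] using hp
  simp only [coeff_X_pow_mul]
  have hH := fun j (hj : j < N) => abs_coeff_quotient_le h0' hp' hpos' hj
  have hBH : B * A⁻¹ * A = B := by
    rw [mul_assoc, PowerSeries.inv_mul_cancel A (by simpa using hp'), mul_one]
  have hb : ∀ i ∈ Finset.range N,
      coeff i B ^ 2 ≤ 4 * N * ∑ j ∈ Finset.range N, coeff j A ^ 2 := by
    intro i hi
    have hi := Finset.mem_range.mp hi
    have h1 : |coeff i B| ≤ 2 * ∑ j ∈ Finset.range N, |coeff j A| := by
      rw [← hBH, mul_comm, coeff_mul, Finset.Nat.sum_antidiagonal_eq_sum_range_succ_mk,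
        Finset.mul_sum]
      refine (Finset.abs_sum_le_sum_abs _ _).trans
        ((Finset.sum_le_sum fun j _ => ?_).trans (Finset.sum_le_sum_of_subset_of_nonneg
          (Finset.range_subset_range.mpr (by omega)) fun j _ _ => by positivity))
      rw [abs_mul, mul_comm]
      exact mul_le_mul_of_nonneg_right (hH _ (by omega)) (abs_nonneg _)
    have h2 := sq_sum_le_card_mul_sum_sq (s := Finset.range N) (f := fun j => |coeff j A|)
    simp only [sq_abs, Finset.card_range] at h2
    have h3 : coeff i B ^ 2 ≤ (2 * ∑ j ∈ Finset.range N, |coeff j A|) ^ 2 := by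
      rw [← sq_abs]
      exact pow_le_pow_left₀ (abs_nonneg _) h1 2
    nlinarith
  refine (Finset.sum_le_sum hb).trans ?_
  rw [Finset.sum_const, Finset.card_range, nsmul_eq_mul]
  have hS : 0 ≤ ∑ j ∈ Finset.range N, coeff j A ^ 2 :=
    Finset.sum_nonneg fun i _ => sq_nonneg _
  have hN : (N : ℝ) ^ 2 ≤ ((p + N : ℕ) : ℝ) ^ 2 := by
    gcongr
    omega
  nlinarith

/-- A downdating step with small cosine produces vectors that are correspondingly small. -/
theorem sum_schur_succ_sq_le {n : ℕ} {t : ℕ → ℝ} (hT : (toeplitz n t).PosDef) {k : ℕ}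
    (hk : k + 1 < n) :
    ∑ j ∈ Finset.range n, (schurU t (k + 1) j ^ 2 + schurV t (k + 1) j ^ 2) ≤
      10 * (n : ℝ) ^ 2 * schurCos t k ^ 2 * ∑ j ∈ Finset.range n, schurU t k j ^ 2 := by
  obtain ⟨hU, hV, hu, hpos, -⟩ := schur_invariant hT (k + 1) hk
  have hc := schurCos_pos hT hk
  have hcs := schurCos_sq hT hk
  have hs := schurSin_sq_lt hT hk
  have hV' : (X : ℝ⟦X⟧) ^ (k + 1) ∣ (schurPair t (k + 1)).2 :=
    (pow_dvd_pow X (Nat.le_succ _)).trans hV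
  have hv0 : coeff (k + 1) (schurPair t (k + 1)).2 = 0 :=
    X_pow_dvd_iff.mp hV _ (Nat.lt_succ_self _)
  -- The form factors as `(u - v)(u + v)`, so the Carathéodory estimate applies to these two series
  -- in either order.
  have hform : ∀ Ξ : ℝ⟦X⟧, 0 ≤ ∑ i ∈ Finset.range n,
      coeff i (((schurPair t (k + 1)).1 - (schurPair t (k + 1)).2) * Ξ) *
        coeff i (((schurPair t (k + 1)).1 + (schurPair t (k + 1)).2) * Ξ) := by
    intro Ξ
    have hen : 0 ≤ energy n (schurPair t (k + 1)).1 (schurPair t (k + 1)).2 Ξ := by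
      by_cases h : ∃ i, i + (k + 1) < n ∧ coeff i Ξ ≠ 0
      · exact (hpos Ξ h).le
      · push Not at h
        have hΞ : (X : ℝ⟦X⟧) ^ (n - (k + 1)) ∣ Ξ :=
          X_pow_dvd_iff.mpr fun i hi => h i (by omega)
        rw [energy, Finset.sum_eq_zero]
        intro i hi
        have hi := Finset.mem_range.mp hi
        rw [coeff_mul_eq_zero_of_dvd hU hΞ (by omega),
          coeff_mul_eq_zero_of_dvd hV' hΞ (by omega)]
        ring
    refine hen.trans_eq (Finset.sum_congr rfl fun i _ => ?_)
    rw [sub_mul, add_mul, map_sub, map_add]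
    ring
  have hab := sum_coeff_sq_le_of_form_nonneg (dvd_sub hU hV') (dvd_add hU hV')
    (by rw [map_add, map_sub, hv0]; ring) (by rw [map_sub, hv0, sub_zero]; exact hu.ne') hform
  have hba := sum_coeff_sq_le_of_form_nonneg (dvd_add hU hV') (dvd_sub hU hV')
    (by rw [map_add, map_sub, hv0]; ring) (by rw [map_add, hv0, add_zero]; exact hu.ne')
    (fun Ξ => (hform Ξ).trans_eq (Finset.sum_congr rfl fun i _ => mul_comm _ _))
  simp only [map_sub, map_add] at hab hba
  change ∑ i ∈ Finset.range n, (schurU t (k + 1) i + schurV t (k + 1) i) ^ 2 ≤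
    4 * (n : ℝ) ^ 2 * ∑ i ∈ Finset.range n, (schurU t (k + 1) i - schurV t (k + 1) i) ^ 2 at hab
  change ∑ i ∈ Finset.range n, (schurU t (k + 1) i - schurV t (k + 1) i) ^ 2 ≤
    4 * (n : ℝ) ^ 2 * ∑ i ∈ Finset.range n, (schurU t (k + 1) i + schurV t (k + 1) i) ^ 2 at hba
  have hsum : ∑ j ∈ Finset.range n, (schurU t (k + 1) j ^ 2 + schurV t (k + 1) j ^ 2) =
      (∑ i ∈ Finset.range n, (schurU t (k + 1) i + schurV t (k + 1) i) ^ 2 +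
        ∑ i ∈ Finset.range n, (schurU t (k + 1) i - schurV t (k + 1) i) ^ 2) / 2 := by
    rw [← Finset.sum_add_distrib, Finset.sum_div]
    exact Finset.sum_congr rfl fun i _ => by ring
  have hx := sum_shiftDown_sq_le n (schurU t k)
  have hy := sum_schurV_sq_le hT (k := k) (by omega)
  have hn : (1 : ℝ) ≤ (n : ℝ) ^ 2 := by
    have : (1 : ℝ) ≤ n := by exact_mod_cast (by omega : 1 ≤ n)
    nlinarith
  set M := ∑ j ∈ Finset.range n, schurU t k j ^ 2
  have hM : 0 ≤ M := Finset.sum_nonneg fun i _ => sq_nonneg _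
  have hsmall : ∀ w : ℕ → ℝ, (∀ i, w i ^ 2 ≤ schurCos t k ^ 2 *
      (2 * Downdating.shiftDown (schurU t k) i ^ 2 + 2 * schurV t k i ^ 2)) →
      ∑ i ∈ Finset.range n, w i ^ 2 ≤ schurCos t k ^ 2 * (4 * M) := by
    intro w hw
    refine (Finset.sum_le_sum fun i _ => hw i).trans ?_
    rw [← Finset.mul_sum, Finset.sum_add_distrib, ← Finset.mul_sum, ← Finset.mul_sum]
    gcongr
    linarith
  rw [hsum]
  have hcM : 0 ≤ schurCos t k ^ 2 * M := by positivity
  -- If `s ≥ 0`, then `u' + v' = c / (1 + s) · (Zu + v)` has size `O(c)`, and `u' - v'` is at most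
  -- `2n` times as long; for `s ≤ 0` the roles are exchanged. The constant is `4 (1 + 4n²) / 2 ≤ 10
  -- n²`.
  rcases le_total 0 (schurSin t k) with h | h
  · have h1 : 0 < 1 + schurSin t k := by linarith
    have := hsmall (fun i => schurU t (k + 1) i + schurV t (k + 1) i) fun i => by
      have e : schurU t (k + 1) i + schurV t (k + 1) i =
          schurCos t k / (1 + schurSin t k) *
            (Downdating.shiftDown (schurU t k) i + schurV t k i) := by
        rw [schurU_succ, schurV_succ]
        field_simp
        rw [hcs]
        ring
      have hle : schurCos t k / (1 + schurSin t k) ≤ schurCos t k :=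
        div_le_self hc.le (by linarith)
      have hle2 := pow_le_pow_left₀ (by positivity) hle 2
      rw [e, mul_pow]
      refine (mul_le_mul_of_nonneg_right hle2 (sq_nonneg _)).trans
        (mul_le_mul_of_nonneg_left ?_ (sq_nonneg _))
      nlinarith [sq_nonneg (Downdating.shiftDown (schurU t k) i - schurV t k i)]
    nlinarith [mul_nonneg (sub_nonneg.mpr hn) hcM]
  · have h1 : 0 < 1 - schurSin t k := by linarith
    have := hsmall (fun i => schurU t (k + 1) i - schurV t (k + 1) i) fun i => by
      have e : schurU t (k + 1) i - schurV t (k + 1) i =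
          schurCos t k / (1 - schurSin t k) *
            (Downdating.shiftDown (schurU t k) i - schurV t k i) := by
        rw [schurU_succ, schurV_succ]
        field_simp
        rw [hcs]
        ring
      have hle : schurCos t k / (1 - schurSin t k) ≤ schurCos t k :=
        div_le_self hc.le (by linarith)
      have hle2 := pow_le_pow_left₀ (by positivity) hle 2
      rw [e, mul_pow]
      refine (mul_le_mul_of_nonneg_right hle2 (sq_nonneg _)).trans
        (mul_le_mul_of_nonneg_left ?_ (sq_nonneg _))
      nlinarith [sq_nonneg (Downdating.shiftDown (schurU t k) i + schurV t k i)]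
    nlinarith [mul_nonneg (sub_nonneg.mpr hn) hcM]

end SchurBounds

/-! ### Convergence of the computed generators as the precision tends to zero. -/

section Limits

open Filter Topology

/-- Arithmetics whose precision tends to zero. -/
def highPrecision : Filter (Σ ε : ℝ, FloatArith ε) := comap Sigma.fst (𝓝[>] 0)

theorem tendsto_precision : Tendsto Sigma.fst highPrecision (𝓝[>] 0) := tendsto_comap

theorem tendsto_precision_zero : Tendsto Sigma.fst highPrecision (𝓝 0) :=
  tendsto_precision.mono_right nhdsWithin_le_nhds

theorem eventually_precision_pos : ∀ᶠ p in highPrecision, 0 < p.1 :=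
  tendsto_precision.eventually self_mem_nhdsWithin

theorem eventually_precision_lt {δ : ℝ} (hδ : 0 < δ) : ∀ᶠ p in highPrecision, p.1 < δ :=
  tendsto_precision_zero.eventually_lt_const hδ

/-- The filter is pulled back from `ε` alone, so "eventually" means one threshold for all
arithmetics at once. -/
theorem exists_precision_of_eventually {P : ∀ ε : ℝ, FloatArith ε → Prop}
    (h : ∀ᶠ p in highPrecision, P p.1 p.2) :
    ∃ ε₀ : ℝ, 0 < ε₀ ∧ ∀ ε : ℝ, 0 < ε → ε < ε₀ → ∀ F : FloatArith ε, P ε F := by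
  rw [highPrecision, eventually_comap] at h
  obtain ⟨ε₀, h0, hε⟩ := mem_nhdsGT_iff_exists_Ioo_subset.mp h
  exact ⟨ε₀, h0, fun ε h1 h2 F => hε ⟨h1, h2⟩ ⟨ε, F⟩ rfl⟩

variable {f g h : (Σ ε : ℝ, FloatArith ε) → ℝ} {a b : ℝ}

theorem tendsto_of_relative_error (hg : Tendsto g highPrecision (𝓝 a))
    (hh : ∀ᶠ p in highPrecision, |h p - g p| ≤ p.1 * |g p|) :
    Tendsto h highPrecision (𝓝 a) := by
  have h1 : Tendsto (fun p => h p - g p) highPrecision (𝓝 0) := by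
    refine squeeze_zero_norm' (a := fun p => p.1 * |g p|) ?_ ?_
    · filter_upwards [hh] with p hp using by rwa [Real.norm_eq_abs]
    · simpa using tendsto_precision_zero.mul hg.abs
  simpa using h1.add hg

theorem tendsto_floatSub (hf : Tendsto f highPrecision (𝓝 a))
    (hg : Tendsto g highPrecision (𝓝 b)) :
    Tendsto (fun p => p.2.sub (f p) (g p)) highPrecision (𝓝 (a - b)) :=
  tendsto_of_relative_error (hf.sub hg) (Eventually.of_forall fun p => p.2.sub_err _ _)

theorem tendsto_floatAdd (hf : Tendsto f highPrecision (𝓝 a))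
    (hg : Tendsto g highPrecision (𝓝 b)) :
    Tendsto (fun p => p.2.add (f p) (g p)) highPrecision (𝓝 (a + b)) :=
  tendsto_of_relative_error (hf.add hg) (Eventually.of_forall fun p => p.2.add_err _ _)

theorem tendsto_floatMul (hf : Tendsto f highPrecision (𝓝 a))
    (hg : Tendsto g highPrecision (𝓝 b)) :
    Tendsto (fun p => p.2.mul (f p) (g p)) highPrecision (𝓝 (a * b)) :=
  tendsto_of_relative_error (hf.mul hg) (Eventually.of_forall fun p => p.2.mul_err _ _)

theorem tendsto_floatDiv (hf : Tendsto f highPrecision (𝓝 a))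
    (hg : Tendsto g highPrecision (𝓝 b)) (hb : b ≠ 0) :
    Tendsto (fun p => p.2.div (f p) (g p)) highPrecision (𝓝 (a / b)) := by
  refine tendsto_of_relative_error (hf.div hg hb) ?_
  filter_upwards [hg.eventually_ne hb] with p hp using p.2.div_err _ _ hp

theorem tendsto_floatSqrt (hf : Tendsto f highPrecision (𝓝 a)) (ha : 0 < a) :
    Tendsto (fun p => p.2.sqrt (f p)) highPrecision (𝓝 √a) := by
  refine tendsto_of_relative_error hf.sqrt ?_
  filter_upwards [hf.eventually_const_lt ha] with p hp
  rw [abs_of_nonneg (Real.sqrt_nonneg _)]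
  exact p.2.sqrt_err _ hp.le

theorem tendsto_shiftDown {u : (Σ ε : ℝ, FloatArith ε) → ℕ → ℝ} {u₀ : ℕ → ℝ}
    (hu : ∀ j, Tendsto (fun p => u p j) highPrecision (𝓝 (u₀ j))) (j : ℕ) :
    Tendsto (fun p => Downdating.shiftDown (u p) j) highPrecision
      (𝓝 (Downdating.shiftDown u₀ j)) := by
  cases j with
  | zero => exact tendsto_const_nhds
  | succ j => exact hu j

/-- The three rules are algebraically equivalent when `c² = 1 - s²`, so they share one limit; `hpiv`
makes the zero written at the pivot the correct value. -/
theorem tendsto_component {s c x y : (Σ ε : ℝ, FloatArith ε) → ℝ} {s₀ c₀ x₀ y₀ : ℝ}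
    (hs : Tendsto s highPrecision (𝓝 s₀)) (hc : Tendsto c highPrecision (𝓝 c₀))
    (hx : Tendsto x highPrecision (𝓝 x₀)) (hy : Tendsto y highPrecision (𝓝 y₀))
    (hc₀ : c₀ ≠ 0) (hcs : c₀ ^ 2 = (1 - s₀) * (1 + s₀)) (rule : Downdating)
    (pivot : Prop) [Decidable pivot] (hpiv : pivot → y₀ = s₀ * x₀) :
    Tendsto (fun p => (Downdating.component p.2 rule pivot (s p) (c p) (x p) (y p)).1)
      highPrecision (𝓝 ((x₀ - s₀ * y₀) / c₀)) ∧
    Tendsto (fun p => (Downdating.component p.2 rule pivot (s p) (c p) (x p) (y p)).2)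
      highPrecision (𝓝 ((y₀ - s₀ * x₀) / c₀)) := by
  have hu := tendsto_floatDiv (tendsto_floatSub hx (tendsto_floatMul hs hy)) hc hc₀
  have hv := tendsto_floatDiv (tendsto_floatSub hy (tendsto_floatMul hs hx)) hc hc₀
  have hv' : Tendsto (fun p => if pivot then 0 else
      p.2.div (p.2.sub (y p) (p.2.mul (s p) (x p))) (c p)) highPrecision
      (𝓝 ((y₀ - s₀ * x₀) / c₀)) := by
    by_cases h : pivot
    · simp only [if_pos h]
      rw [hpiv h, sub_self, zero_div]
      exact tendsto_const_nhds
    · simpa only [if_neg h] using hv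
  cases rule with
  | hyperbolic => exact ⟨hu, hv'⟩
  | mixedV =>
    refine ⟨?_, hv'⟩
    have h := tendsto_floatSub (tendsto_floatMul hc hx) (tendsto_floatMul hs hv')
    have e : c₀ * x₀ - s₀ * ((y₀ - s₀ * x₀) / c₀) = (x₀ - s₀ * y₀) / c₀ := by
      field_simp
      rw [hcs]
      ring
    rw [e] at h
    exact h
  | mixedU =>
    have hu' : Tendsto (fun p => if pivot then p.2.mul (c p) (x p) else
        p.2.div (p.2.sub (x p) (p.2.mul (s p) (y p))) (c p)) highPrecision
        (𝓝 ((x₀ - s₀ * y₀) / c₀)) := by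
      by_cases h : pivot
      · simp only [if_pos h]
        have e : (x₀ - s₀ * y₀) / c₀ = c₀ * x₀ := by
          rw [hpiv h]
          field_simp
          rw [hcs]
          ring
        rw [e]
        exact tendsto_floatMul hc hx
      · simpa only [if_neg h] using hu
    refine ⟨hu', ?_⟩
    by_cases h : pivot
    · simp only [Downdating.component, if_pos h]
      rw [hpiv h, sub_self, zero_div]
      exact tendsto_const_nhds
    · have h' := tendsto_floatSub (tendsto_floatMul hc hy) (tendsto_floatMul hs hu')
      have e : c₀ * y₀ - s₀ * ((x₀ - s₀ * y₀) / c₀) = (y₀ - s₀ * x₀) / c₀ := by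
        field_simp
        rw [hcs]
        ring
      rw [e] at h'
      simpa only [Downdating.component, if_neg h] using h'

section Factor

variable {n : ℕ} {t : ℕ → ℝ} (rule : Downdating)

theorem tendsto_sin {k : ℕ} {q : (Σ ε : ℝ, FloatArith ε) → (ℕ → ℝ) × (ℕ → ℝ)}
    (hT : (toeplitz n t).PosDef) (hk : k < n)
    (hu : ∀ j, Tendsto (fun p => (q p).1 j) highPrecision (𝓝 (schurU t k j)))
    (hv : ∀ j, Tendsto (fun p => (q p).2 j) highPrecision (𝓝 (schurV t k j))) :
    Tendsto (fun p => Downdating.sin p.2 k (q p).1 (q p).2) highPrecision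
      (𝓝 (schurSin t k)) :=
  tendsto_floatDiv (hv _) (hu _) (schurU_diag_pos hT hk).ne'

theorem tendsto_cosSq {k : ℕ} {q : (Σ ε : ℝ, FloatArith ε) → (ℕ → ℝ) × (ℕ → ℝ)}
    (hT : (toeplitz n t).PosDef) (hk : k < n)
    (hu : ∀ j, Tendsto (fun p => (q p).1 j) highPrecision (𝓝 (schurU t k j)))
    (hv : ∀ j, Tendsto (fun p => (q p).2 j) highPrecision (𝓝 (schurV t k j))) :
    Tendsto (fun p => Downdating.cosSq p.2 k (q p).1 (q p).2) highPrecision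
      (𝓝 ((1 - schurSin t k) * (1 + schurSin t k))) := by
  have h := tendsto_sin hT hk hu hv
  exact tendsto_floatMul (tendsto_floatSub tendsto_const_nhds h)
    (tendsto_floatAdd tendsto_const_nhds h)

theorem tendsto_cos {k : ℕ} {q : (Σ ε : ℝ, FloatArith ε) → (ℕ → ℝ) × (ℕ → ℝ)}
    (hT : (toeplitz n t).PosDef) (hk : k + 1 < n)
    (hu : ∀ j, Tendsto (fun p => (q p).1 j) highPrecision (𝓝 (schurU t k j)))
    (hv : ∀ j, Tendsto (fun p => (q p).2 j) highPrecision (𝓝 (schurV t k j))) :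
    Tendsto (fun p => Downdating.cos p.2 k (q p).1 (q p).2) highPrecision
      (𝓝 (schurCos t k)) :=
  tendsto_floatSqrt (tendsto_cosSq hT (by omega) hu hv) (schurCosSq_pos hT hk)

/-- The computed generators tend to the exact ones. -/
theorem tendsto_factorPair (hT : (toeplitz n t).PosDef) (k : ℕ) (hk : k < n) :
    (∀ j, Tendsto (fun p => (factorPair p.2 rule t k).1 j) highPrecision
      (𝓝 (schurU t k j))) ∧
    (∀ j, Tendsto (fun p => (factorPair p.2 rule t k).2 j) highPrecision
      (𝓝 (schurV t k j))) := by
  induction k with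
  | zero =>
    have ht := toeplitz_zero_pos hT hk
    have hd : ∀ j, Tendsto (fun p => p.2.div (t j) (p.2.sqrt (t 0))) highPrecision
        (𝓝 (t j / √(t 0))) := fun j =>
      tendsto_floatDiv tendsto_const_nhds (tendsto_floatSqrt tendsto_const_nhds ht)
        (by positivity)
    constructor
    · intro j
      simpa [factorPair, schurU, schurPair] using hd j
    · intro j
      by_cases hj : j = 0
      · simp [factorPair, schurV, schurPair, hj, tendsto_const_nhds]
      · simpa [factorPair, schurV, schurPair, hj] using hd j
  | succ k ih =>
    obtain ⟨hu, hv⟩ := ih (by omega)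
    have h : ∀ j, k < j → _ := fun j (_ : k < j) =>
      tendsto_component (tendsto_sin hT (by omega) hu hv) (tendsto_cos hT hk hu hv)
        (tendsto_shiftDown hu j) (hv j) (schurCos_pos hT hk).ne' (schurCos_sq hT hk) rule
        (j = k + 1) (by rintro rfl; exact schurV_pivot hT (by omega))
    constructor
    · intro j
      by_cases hj : j ≤ k
      · rw [schurU_eq_zero hT hk (by omega)]
        simp [factorPair, Downdating.step, hj, tendsto_const_nhds]
      · rw [schurU_succ]
        simpa [factorPair, Downdating.step, hj] using (h j (by omega)).1
    · intro j
      by_cases hj : j ≤ k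
      · rw [schurV_eq_zero hT hk (by omega)]
        simp [factorPair, Downdating.step, hj, tendsto_const_nhds]
      · rw [schurV_succ]
        simpa [factorPair, Downdating.step, hj] using (h j (by omega)).2

theorem eventually_factorRuns (hT : (toeplitz n t).PosDef) :
    ∀ᶠ p in highPrecision, FactorRuns p.2 rule n t := by
  have h1 : ∀ᶠ p in highPrecision, 0 < n → 0 ≤ t 0 ∧ p.2.sqrt (t 0) ≠ 0 := by
    by_cases hn : 0 < n
    · have ht := toeplitz_zero_pos hT hn
      have hs : Tendsto (fun p : Σ ε : ℝ, FloatArith ε => p.2.sqrt (t 0)) highPrecision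
        (𝓝 √(t 0)) := tendsto_floatSqrt tendsto_const_nhds ht
      filter_upwards [hs.eventually_ne (by positivity)] with p hp _ using ⟨ht.le, hp⟩
    · exact Eventually.of_forall fun p h => absurd h hn
  have h2 : ∀ᶠ p in highPrecision, ∀ k ∈ Finset.range (n - 1),
      (factorPair p.2 rule t k).1 k ≠ 0 ∧
      0 ≤ Downdating.cosSq p.2 k (factorPair p.2 rule t k).1 (factorPair p.2 rule t k).2 ∧
      Downdating.cos p.2 k (factorPair p.2 rule t k).1 (factorPair p.2 rule t k).2 ≠ 0 := by
    rw [eventually_all_finset]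
    intro k hk
    have hk : k + 1 < n := by have := Finset.mem_range.mp hk; omega
    obtain ⟨hu, hv⟩ := tendsto_factorPair rule hT k (by omega)
    filter_upwards [(hu k).eventually_ne (schurU_diag_pos hT (by omega)).ne',
      (tendsto_cosSq hT (by omega) hu hv).eventually_const_lt (schurCosSq_pos hT hk),
      (tendsto_cos hT hk hu hv).eventually_ne (schurCos_pos hT hk).ne'] with p a b c
    exact ⟨a, b.le, c⟩
  filter_upwards [h1, h2] with p a b
  exact ⟨a, fun k hk => b k (Finset.mem_range.mpr (by omega))⟩

end Factor

end Limits

/-! ### The Bareiss algorithm as unnormalized downdating. -/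

section BareissStructure

/-- A relative error allows no rounding of an exact zero; this keeps annihilated Bareiss entries
zero in later steps. -/
theorem FloatArith.mul_zero {ε : ℝ} (F : FloatArith ε) (a : ℝ) : F.mul a 0 = 0 := by
  simpa using F.mul_err a 0

theorem FloatArith.sub_zero_zero {ε : ℝ} (F : FloatArith ε) : F.sub 0 0 = 0 := by
  simpa using F.sub_err 0 0

/-- The generators on which the Bareiss algorithm works implicitly: hyperbolic downdating without
normalization. -/
noncomputable def bareissGen {ε : ℝ} (F : FloatArith ε) (t : ℕ → ℝ) :
    ℕ → (ℕ → ℝ) × (ℕ → ℝ)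
  | 0 => (t, fun j => if j = 0 then 0 else t j)
  | k + 1 =>
    let u := (bareissGen F t k).1
    let v := (bareissGen F t k).2
    let s := F.div (v (k + 1)) (u k)
    (fun j => if j ≤ k then 0 else F.sub (Downdating.shiftDown u j) (F.mul s (v j)),
      fun j => if j ≤ k + 1 then 0 else F.sub (v j) (F.mul s (Downdating.shiftDown u j)))

variable {ε : ℝ} (F : FloatArith ε) (t : ℕ → ℝ)

theorem bareissGen_fst_eq_zero {k j : ℕ} (hj : j < k) : (bareissGen F t k).1 j = 0 := by
  cases k with
  | zero => omega
  | succ k => simp [bareissGen, Nat.le_of_lt_succ hj]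

theorem bareissGen_snd_eq_zero {k j : ℕ} (hj : j ≤ k) : (bareissGen F t k).2 j = 0 := by
  cases k with
  | zero => simp [bareissGen, Nat.le_zero.mp hj]
  | succ k => simp [bareissGen, hj]

/-- The computed matrices of the Bareiss algorithm are Toeplitz where they have not been frozen,
and each is the transpose of the other there. -/
theorem bareissPair_eq (n i : ℕ) (hi : i < n) :
    (∀ r c, i ≤ r → r < n → c < n → (bareissPair F n t i).1 r c =
      if r ≤ c then (bareissGen F t i).1 (i + c - r) else (bareissGen F t i).2 (r - c)) ∧
    (∀ r c, r + i < n → c < n → (bareissPair F n t i).2 r c =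
      if c ≤ r then (bareissGen F t i).1 (i + r - c) else (bareissGen F t i).2 (c - r)) := by
  induction i with
  | zero =>
    constructor
    · intro r c _ _ _
      by_cases h : r ≤ c
      · simp [bareissPair, bareissGen, h, Nat.dist_eq_sub_of_le h]
      · simp [bareissPair, bareissGen, h, Nat.dist_eq_sub_of_le_right (le_of_not_ge h)]
        intro h'; omega
    · intro r c _ _
      by_cases h : c ≤ r
      · simp [bareissPair, bareissGen, h, Nat.dist_eq_sub_of_le_right h]
      · simp [bareissPair, bareissGen, h, Nat.dist_eq_sub_of_le (le_of_not_ge h)]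
        intro h'; omega
  | succ i ih =>
    obtain ⟨hA, hB⟩ := ih (by omega)
    -- Both multipliers are quotients of the same two numbers, so they agree even after rounding;
    -- this preserves the transpose symmetry.
    have hα : bareissMulUpper F (i + 1) (bareissPair F n t i) =
        F.div ((bareissGen F t i).2 (i + 1)) ((bareissGen F t i).1 i) := by
      rw [bareissMulUpper, hA _ _ (by omega) (by omega) (by omega), hB _ _ (by omega) (by omega)]
      simp
    have hβ : bareissMulLower F (i + 1) (bareissPair F n t i) =
        F.div ((bareissGen F t i).2 (i + 1)) ((bareissGen F t i).1 i) := by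
      rw [bareissMulLower, hA _ _ (by omega) (by omega) (by omega), hB _ _ (by omega) (by omega)]
      simp
    set s := F.div ((bareissGen F t i).2 (i + 1)) ((bareissGen F t i).1 i) with hs
    have hu : ∀ j, i < j → (bareissGen F t (i + 1)).1 j =
        F.sub ((bareissGen F t i).1 (j - 1)) (F.mul s ((bareissGen F t i).2 j)) := by
      intro j hj
      obtain ⟨j, rfl⟩ : ∃ l, j = l + 1 := ⟨j - 1, by omega⟩
      simp [bareissGen, Downdating.shiftDown, show ¬ j + 1 ≤ i by omega, hs]
    have hv : ∀ j, i + 1 < j → (bareissGen F t (i + 1)).2 j =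
        F.sub ((bareissGen F t i).2 j) (F.mul s ((bareissGen F t i).1 (j - 1))) := by
      intro j hj
      obtain ⟨j, rfl⟩ : ∃ l, j = l + 1 := ⟨j - 1, by omega⟩
      simp [bareissGen, Downdating.shiftDown, show ¬ j ≤ i by omega, hs]
    constructor
    · intro r c hr hrn hc
      have e : (bareissPair F n t (i + 1)).1 r c = if c + (i + 1) = r then 0 else
          F.sub ((bareissPair F n t i).1 r c)
            (F.mul s ((bareissPair F n t i).2 (r - (i + 1)) c)) := by
        simp only [bareissPair, bareissStep, hα, if_neg (show ¬ r < i + 1 by omega)]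
      rw [e, hA r c (by omega) hrn hc, hB (r - (i + 1)) c (by omega) hc]
      by_cases h1 : r ≤ c
      · rw [if_neg (by omega), if_pos h1, if_neg (by omega), if_pos h1, hu _ (by omega)]
        exact congrArg₂ F.sub (congrArg _ (by omega)) (congrArg _ (congrArg _ (by omega)))
      · rw [if_neg h1, if_neg h1]
        rcases lt_trichotomy (c + (i + 1)) r with h2 | h2 | h2
        · rw [if_neg (by omega), if_pos (by omega), hv _ (by omega)]
          exact congrArg₂ F.sub (congrArg _ (by omega)) (congrArg _ (congrArg _ (by omega)))
        · rw [if_pos h2, bareissGen_snd_eq_zero F t (by omega)]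
        -- Diagonals annihilated in earlier steps: `0 - s · 0` is evaluated exactly.
        · rw [if_neg (by omega), if_neg (by omega), bareissGen_snd_eq_zero F t (by omega),
            bareissGen_snd_eq_zero F t (by omega), bareissGen_snd_eq_zero F t (by omega),
            F.mul_zero, F.sub_zero_zero]
    · intro r c hr hc
      have e : (bareissPair F n t (i + 1)).2 r c = if c = r + (i + 1) then 0 else
          F.sub ((bareissPair F n t i).2 r c)
            (F.mul s ((bareissPair F n t i).1 (r + (i + 1)) c)) := by
        simp only [bareissPair, bareissStep, hβ, if_neg (show ¬ n ≤ r + (i + 1) by omega)]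
      rw [e, hB r c (by omega) hc, hA (r + (i + 1)) c (by omega) (by omega) hc]
      by_cases h1 : c ≤ r
      · rw [if_neg (by omega), if_pos h1, if_neg (by omega), if_pos h1, hu _ (by omega)]
        exact congrArg₂ F.sub (congrArg _ (by omega)) (congrArg _ (congrArg _ (by omega)))
      · rw [if_neg h1, if_neg h1]
        rcases lt_trichotomy (r + (i + 1)) c with h2 | h2 | h2
        · rw [if_neg (by omega), if_pos (by omega), hv _ (by omega)]
          exact congrArg₂ F.sub (congrArg _ (by omega)) (congrArg _ (congrArg _ (by omega)))
        · rw [if_pos h2.symm, bareissGen_snd_eq_zero F t (by omega)]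
        · rw [if_neg (by omega), if_neg (by omega), bareissGen_snd_eq_zero F t (by omega),
            bareissGen_snd_eq_zero F t (by omega), bareissGen_snd_eq_zero F t (by omega),
            F.mul_zero, F.sub_zero_zero]

/-- Row `r` is frozen from stage `r` on, and there its generator index `i + c - r` is `c`. -/
theorem bareissRows_eq {n r c : ℕ} (hr : r < n) (hc : c < n) :
    bareissRows F n t r c = (bareissGen F t r).1 c := by
  have hfrozen : ∀ d, (bareissPair F n t (r + d)).1 r c = (bareissPair F n t r).1 r c := by
    intro d
    induction d with
    | zero => rfl
    | succ d ih =>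
      rw [← ih, ← Nat.add_assoc]
      simp only [bareissPair, bareissStep, if_pos (show r < r + d + 1 by omega)]
  have h := hfrozen (n - 1 - r)
  rw [show r + (n - 1 - r) = n - 1 by omega] at h
  rw [bareissRows, h, (bareissPair_eq F t n r hr).1 r c le_rfl hr hc]
  split_ifs with h'
  · rw [Nat.add_sub_cancel_left]
  · rw [bareissGen_snd_eq_zero F t (by omega), bareissGen_fst_eq_zero F t (by omega)]

theorem bareissRuns_of_diag_ne_zero {n : ℕ} (h : ∀ i, i < n → (bareissGen F t i).1 i ≠ 0) :
    BareissRuns F n t := by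
  intro i hi
  obtain ⟨hA, hB⟩ := bareissPair_eq F t n i (by omega)
  rw [hA _ _ (by omega) hi hi, hB _ _ (by omega) (by omega)]
  simpa using h i (by omega)

end BareissStructure

/-! ### Limits of the Bareiss generators. -/

section BareissLimit

open Filter Topology

/-- The factor `u_kk` is the missing normalization: exactly, `W = D^{1/2} U` with `D = diag(u_kk²)`.
-/
theorem tendsto_bareissGen {n : ℕ} {t : ℕ → ℝ} (hT : (toeplitz n t).PosDef) (k : ℕ)
    (hk : k < n) :
    (∀ j, Tendsto (fun p => (bareissGen p.2 t k).1 j) highPrecision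
      (𝓝 (schurU t k k * schurU t k j))) ∧
    (∀ j, Tendsto (fun p => (bareissGen p.2 t k).2 j) highPrecision
      (𝓝 (schurU t k k * schurV t k j))) := by
  induction k with
  | zero =>
    have ht := toeplitz_zero_pos hT hk
    have h0 : ∀ j, √(t 0) * (t j / √(t 0)) = t j := fun j => by field_simp
    have h1 : t 0 / √(t 0) = √(t 0) := by simp
    constructor
    · intro j
      simp only [bareissGen, schurU, schurPair, PowerSeries.coeff_mk, h1, h0]
      exact tendsto_const_nhds
    · intro j
      by_cases hj : j = 0
      · simp [bareissGen, schurV, schurPair, hj, tendsto_const_nhds]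
      · simp only [bareissGen, schurU, schurV, schurPair, PowerSeries.coeff_mk, if_neg hj, h1, h0]
        exact tendsto_const_nhds
  | succ k ih =>
    obtain ⟨hu, hv⟩ := ih (by omega)
    have hc := schurCos_pos hT hk
    have hσ := schurU_diag_pos hT (k := k) (by omega)
    have hs : Tendsto (fun p => p.2.div ((bareissGen p.2 t k).2 (k + 1))
        ((bareissGen p.2 t k).1 k)) highPrecision (𝓝 (schurSin t k)) := by
      have h := tendsto_floatDiv (hv (k + 1)) (hu k) (by positivity)
      rwa [mul_div_mul_left _ _ hσ.ne', schurV_pivot hT (by omega),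
        mul_div_assoc, div_self hσ.ne', mul_one] at h
    have hdiag : schurU t (k + 1) (k + 1) = schurCos t k * schurU t k k := by
      rw [schurU_succ, schurV_pivot hT (by omega), Downdating.shiftDown]
      field_simp
      rw [schurCos_sq hT hk]
      ring
    have hx : ∀ j, Tendsto (fun p => Downdating.shiftDown (bareissGen p.2 t k).1 j) highPrecision
        (𝓝 (schurU t k k * Downdating.shiftDown (schurU t k) j)) := by
      intro j
      cases j with
      | zero => simp [Downdating.shiftDown, tendsto_const_nhds]
      | succ j => exact hu j
    constructor
    · intro j
      by_cases hj : j ≤ k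
      · rw [schurU_eq_zero hT hk (Nat.lt_succ_of_le hj)]
        simp [bareissGen, hj, tendsto_const_nhds]
      · have h := tendsto_floatSub (hx j) (tendsto_floatMul hs (hv j))
        have e : schurU t (k + 1) (k + 1) * schurU t (k + 1) j =
            schurU t k k * Downdating.shiftDown (schurU t k) j -
              schurSin t k * (schurU t k k * schurV t k j) := by
          rw [hdiag, schurU_succ]
          field_simp
        rw [e]
        simpa [bareissGen, hj] using h
    · intro j
      rcases lt_trichotomy j (k + 1) with hj | hj | hj
      · rw [schurV_eq_zero hT hk (by omega)]
        simp [bareissGen, hj.le, tendsto_const_nhds]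
      · rw [schurV_eq_zero hT hk (by omega)]
        simp [bareissGen, hj.le, tendsto_const_nhds]
      · have h := tendsto_floatSub (hv j) (tendsto_floatMul hs (hx j))
        have e : schurU t (k + 1) (k + 1) * schurV t (k + 1) j =
            schurU t k k * schurV t k j -
              schurSin t k * (schurU t k k * Downdating.shiftDown (schurU t k) j) := by
          rw [hdiag, schurV_succ]
          field_simp
        rw [e]
        simpa [bareissGen, show ¬ j ≤ k + 1 by omega] using h

end BareissLimit

/-! ### Rounding errors in the elementary formulas. -/

section LocalErrors

variable {ε : ℝ} (F : FloatArith ε)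

theorem abs_sub_mul_err {s x y : ℝ} (h0 : 0 ≤ ε) (h1 : ε ≤ 1 / 100) (hs : |s| ≤ 1) :
    |F.sub x (F.mul s y) - (x - s * y)| ≤ 3 * ε * (|x| + |y|) := by
  have e1 : |F.mul s y - s * y| ≤ ε * |y| := by
    refine (F.mul_err s y).trans (mul_le_mul_of_nonneg_left ?_ h0)
    rw [abs_mul]
    exact mul_le_of_le_one_left (abs_nonneg y) hs
  have hsy : |s * y| ≤ |y| := by
    rw [abs_mul]
    exact mul_le_of_le_one_left (abs_nonneg y) hs
  have e2 := F.sub_err x (F.mul s y)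
  have e3 : |x - F.mul s y| ≤ |x| + 2 * |y| := by
    have h2 : |x - F.mul s y| ≤ |x| + |s * y| + |F.mul s y - s * y| := by
      calc |x - F.mul s y| = |x - s * y - (F.mul s y - s * y)| := by ring_nf
        _ ≤ |x - s * y| + |F.mul s y - s * y| := abs_sub _ _
        _ ≤ _ := by gcongr; exact abs_sub _ _
    have : ε * |y| ≤ 1 * |y| := by gcongr; linarith
    linarith
  calc |F.sub x (F.mul s y) - (x - s * y)|
      = |(F.sub x (F.mul s y) - (x - F.mul s y)) - (F.mul s y - s * y)| := by ring_nf
    _ ≤ ε * |x - F.mul s y| + ε * |y| := (abs_sub _ _).trans (add_le_add e2 e1)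
    _ ≤ ε * (|x| + 2 * |y|) + ε * |y| := by gcongr
    _ ≤ 3 * ε * (|x| + |y|) := by linarith [mul_nonneg h0 (abs_nonneg x)]

/-- Multiplying the quotient back by `c` keeps `1 / c` out of the error bound. -/
theorem abs_div_sub_mul_err {s c x y : ℝ} (h0 : 0 ≤ ε) (h1 : ε ≤ 1 / 100) (hs : |s| ≤ 1)
    (hc : 0 < c) :
    |c * F.div (F.sub x (F.mul s y)) c - (x - s * y)| ≤ 5 * ε * (|x| + |y|) := by
  have e1 := abs_sub_mul_err F (x := x) (y := y) h0 h1 hs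
  set w := F.sub x (F.mul s y)
  have e2 := F.div_err w c hc.ne'
  have e3 : |c * F.div w c - w| ≤ ε * |w| := by
    have : c * F.div w c - w = c * (F.div w c - w / c) := by field_simp
    rw [this, abs_mul, abs_of_pos hc]
    calc c * |F.div w c - w / c| ≤ c * (ε * |w / c|) := by gcongr
      _ = ε * |w| := by rw [abs_div, abs_of_pos hc]; field_simp
  have hsy : |s * y| ≤ |y| := by
    rw [abs_mul]
    exact mul_le_of_le_one_left (abs_nonneg y) hs
  have e4 : |w| ≤ 2 * (|x| + |y|) := by
    have h2 : |w| ≤ |x - s * y| + |w - (x - s * y)| := by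
      calc |w| = |(x - s * y) + (w - (x - s * y))| := by ring_nf
        _ ≤ _ := abs_add_le _ _
    have h3 : |x - s * y| ≤ |x| + |s * y| := abs_sub _ _
    have h4 : 3 * ε * (|x| + |y|) ≤ 1 * (|x| + |y|) := by gcongr; linarith
    linarith
  calc |c * F.div w c - (x - s * y)| = |(c * F.div w c - w) + (w - (x - s * y))| := by ring_nf
    _ ≤ ε * |w| + 3 * ε * (|x| + |y|) := (abs_add_le _ _).trans (add_le_add e3 e1)
    _ ≤ ε * (2 * (|x| + |y|)) + 3 * ε * (|x| + |y|) := by gcongr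
    _ = 5 * ε * (|x| + |y|) := by ring

theorem abs_mul_sub_mul_err {s c x y : ℝ} (h0 : 0 ≤ ε) (h1 : ε ≤ 1 / 100) (hs : |s| ≤ 1)
    (hc0 : 0 ≤ c) (hc : c ≤ 3 / 2) :
    |F.sub (F.mul c x) (F.mul s y) - (c * x - s * y)| ≤ 7 * ε * (|x| + |y|) := by
  have e1 := abs_sub_mul_err F (x := F.mul c x) (y := y) h0 h1 hs
  have e2 : |F.mul c x - c * x| ≤ ε * (3 / 2 * |x|) := by
    refine (F.mul_err c x).trans (mul_le_mul_of_nonneg_left ?_ h0)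
    rw [abs_mul, abs_of_nonneg hc0]
    gcongr
  have e3 : |F.mul c x| ≤ 8 / 5 * |x| := by
    have h2 : |F.mul c x| ≤ |c * x| + |F.mul c x - c * x| := by
      calc |F.mul c x| = |c * x + (F.mul c x - c * x)| := by ring_nf
        _ ≤ _ := abs_add_le _ _
    have h3 : |c * x| ≤ 3 / 2 * |x| := by
      rw [abs_mul, abs_of_nonneg hc0]
      gcongr
    have h4 : ε * (3 / 2 * |x|) ≤ 1 / 100 * (3 / 2 * |x|) := by gcongr
    have := abs_nonneg x
    linarith
  calc |F.sub (F.mul c x) (F.mul s y) - (c * x - s * y)|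
      = |(F.sub (F.mul c x) (F.mul s y) - (F.mul c x - s * y)) + (F.mul c x - c * x)| := by
        ring_nf
    _ ≤ 3 * ε * (|F.mul c x| + |y|) + ε * (3 / 2 * |x|) :=
        (abs_add_le _ _).trans (add_le_add e1 e2)
    _ ≤ 3 * ε * (8 / 5 * |x| + |y|) + ε * (3 / 2 * |x|) := by gcongr
    _ ≤ 7 * ε * (|x| + |y|) := by
      linarith [mul_nonneg h0 (abs_nonneg x), mul_nonneg h0 (abs_nonneg y)]

theorem abs_pivot_err {x y : ℝ} (hx : x ≠ 0) : |y - F.div y x * x| ≤ ε * |y| := by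
  have h := F.div_err y x hx
  have : y - F.div y x * x = -(F.div y x - y / x) * x := by field_simp; ring
  rw [this, abs_mul, abs_neg]
  calc |F.div y x - y / x| * |x| ≤ ε * |y / x| * |x| := by gcongr
    _ = ε * |y| := by rw [abs_div, mul_assoc, div_mul_cancel₀ _ (abs_ne_zero.mpr hx)]

/-- The computed cosine has a small relative error. -/
theorem abs_cos_sq_err {s : ℝ} (h0 : 0 ≤ ε) (h1 : ε ≤ 1 / 100) (hs : s ^ 2 < 1) :
    |F.sqrt (F.mul (F.sub 1 s) (F.add 1 s)) ^ 2 + s ^ 2 - 1| ≤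
      12 * ε * F.sqrt (F.mul (F.sub 1 s) (F.add 1 s)) ^ 2 := by
  obtain ⟨hs1, hs2⟩ := abs_lt.mp ((sq_lt_one_iff_abs_lt_one s).mp hs)
  have hα : 0 < 1 - s := by linarith
  have hβ : 0 < 1 + s := by linarith
  have eA := F.sub_err 1 s
  have eB := F.add_err 1 s
  set A := F.sub 1 s
  set B := F.add 1 s
  rw [abs_of_pos hα] at eA
  rw [abs_of_pos hβ] at eB
  obtain ⟨hA1, hA2⟩ := abs_le.mp eA
  obtain ⟨hB1, hB2⟩ := abs_le.mp eB
  have lA : (1 - ε) * (1 - s) ≤ A := by linarith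
  have uA : A ≤ (1 + ε) * (1 - s) := by linarith
  have lB : (1 - ε) * (1 + s) ≤ B := by linarith
  have uB : B ≤ (1 + ε) * (1 + s) := by linarith
  have hm : 0 < 1 - ε := by linarith
  have hp : 0 < 1 + ε := by linarith
  have A0 : 0 < A := lt_of_lt_of_le (by positivity) lA
  have B0 : 0 < B := lt_of_lt_of_le (by positivity) lB
  have eg := F.mul_err A B
  set g := F.mul A B
  rw [abs_of_pos (mul_pos A0 B0)] at eg
  obtain ⟨hg1, hg2⟩ := abs_le.mp eg
  have lg : (1 - ε) * (A * B) ≤ g := by linarith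
  have ug : g ≤ (1 + ε) * (A * B) := by linarith
  have g0 : 0 < g := lt_of_lt_of_le (by positivity) lg
  have ec := F.sqrt_err g g0.le
  set c := F.sqrt g
  obtain ⟨hc1, hc2⟩ := abs_le.mp ec
  have lc : (1 - ε) * √g ≤ c := by linarith
  have uc : c ≤ (1 + ε) * √g := by linarith
  have hsg : √g ^ 2 = g := Real.sq_sqrt g0.le
  have lc2 : (1 - ε) ^ 2 * g ≤ c ^ 2 := by
    rw [← hsg, ← mul_pow]
    exact pow_le_pow_left₀ (by positivity) lc 2
  have c0 : 0 ≤ c := le_trans (by positivity) lc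
  have uc2 : c ^ 2 ≤ (1 + ε) ^ 2 * g := by
    rw [← hsg, ← mul_pow]
    exact pow_le_pow_left₀ c0 uc 2
  set P := (1 - s) * (1 + s) with hPdef
  have e : c ^ 2 + s ^ 2 - 1 = c ^ 2 - P := by rw [hPdef]; ring
  have hP : 0 < P := by positivity
  -- Five relative errors enter `c²`: the difference, the sum, the product, and the square root
  -- twice. The factored form avoids cancellation in `1 - s²`, so accuracy is relative to `c²` even
  -- for `|s|` near 1.
  have L : (1 - ε) ^ 5 * P ≤ c ^ 2 := by
    calc (1 - ε) ^ 5 * P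
        = (1 - ε) ^ 2 * ((1 - ε) * (((1 - ε) * (1 - s)) * ((1 - ε) * (1 + s)))) := by
          simp only [P]; ring
      _ ≤ (1 - ε) ^ 2 * ((1 - ε) * (A * B)) := by gcongr
      _ ≤ (1 - ε) ^ 2 * g := by gcongr
      _ ≤ c ^ 2 := lc2
  have U : c ^ 2 ≤ (1 + ε) ^ 5 * P := by
    calc c ^ 2 ≤ (1 + ε) ^ 2 * g := uc2
      _ ≤ (1 + ε) ^ 2 * ((1 + ε) * (A * B)) := by gcongr
      _ ≤ (1 + ε) ^ 2 * ((1 + ε) * (((1 + ε) * (1 - s)) * ((1 + ε) * (1 + s)))) := by gcongr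
      _ = (1 + ε) ^ 5 * P := by simp only [P]; ring
  have l5 : 1 - 5 * ε ≤ (1 - ε) ^ 5 := by
    have := one_add_mul_le_pow (a := -ε) (by linarith) 5
    push_cast at this
    rw [← sub_eq_add_neg] at this
    linarith
  have u5 : (1 + ε) ^ 5 ≤ 1 + 6 * ε := by
    have hq : ε * ε ≤ 1 / 100 * ε := mul_le_mul_of_nonneg_right h1 h0
    have h2 : (1 + ε) ^ 2 ≤ 1 + 201 / 100 * ε := by linarith
    have h4 : (1 + 201 / 100 * ε) ^ 2 ≤ 1 + 41 / 10 * ε := by linarith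
    calc (1 + ε) ^ 5 = ((1 + ε) ^ 2) ^ 2 * (1 + ε) := by ring
      _ ≤ (1 + 201 / 100 * ε) ^ 2 * (1 + ε) := by gcongr
      _ ≤ (1 + 41 / 10 * ε) * (1 + ε) := by gcongr
      _ ≤ 1 + 6 * ε := by linarith
  have L' : (1 - 5 * ε) * P ≤ c ^ 2 := (mul_le_mul_of_nonneg_right l5 hP.le).trans L
  have U' : c ^ 2 ≤ (1 + 6 * ε) * P := U.trans (mul_le_mul_of_nonneg_right u5 hP.le)
  clear_value P A B g c
  clear hA1 hA2 hB1 hB2 lA uA lB uB eA eB eg hg1 hg2 lg ug ec hc1 hc2 lc uc hsg lc2 uc2 l5 u5 L U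
  have hεP := mul_nonneg h0 hP.le
  have hεP' := mul_le_mul_of_nonneg_right h1 hP.le
  have hPc : P ≤ 2 * c ^ 2 := by linarith
  have hεc := mul_le_mul_of_nonneg_left hPc h0
  rw [e, abs_le]
  constructor <;> linarith

end LocalErrors

/-! ### Displacement error of one perturbed step. -/

section StepDisplacement

theorem abs_mul_le_of_abs_le {a b A B : ℝ} (ha : |a| ≤ A) (hb : |b| ≤ B) : |a * b| ≤ A * B := by
  rw [abs_mul]
  exact mul_le_mul ha hb (abs_nonneg _) ((abs_nonneg _).trans ha)

/-- The change of displacement in a perturbed hyperbolic rotation. -/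
theorem abs_displacement_hyperbolic {s c η ε x y u v x' y' u' v' : ℝ} (hc : 0 < c)
    (h0 : 0 ≤ ε) (hcs : |c ^ 2 + s ^ 2 - 1| ≤ η * c ^ 2) (hη : η ≤ 1 / 2)
    (hε : 50 * ε ≤ c ^ 2)
    (h1 : |c * u - (x - s * y)| ≤ 5 * ε * (|x| + |y|))
    (h2 : |c * v - (y - s * x)| ≤ 5 * ε * (|x| + |y|))
    (h1' : |c * u' - (x' - s * y')| ≤ 5 * ε * (|x'| + |y'|))
    (h2' : |c * v' - (y' - s * x')| ≤ 5 * ε * (|x'| + |y'|)) :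
    |u * u' - v * v' - x * x' + y * y'| ≤ 2 * η * ((|u| + |v|) * (|u'| + |v'|)) +
      10 * ε * ((|u| + |v|) / c * (|x'| + |y'|) + (|x| + |y|) * ((|u'| + |v'|) / c)) +
      2 * ε * ((|x| + |y|) * (|x'| + |y'|)) := by
  set e1 := c * u - (x - s * y) with he1
  set e2 := c * v - (y - s * x) with he2
  set f1 := c * u' - (x' - s * y') with hf1
  set f2 := c * v' - (y' - s * x') with hf2
  set p := |x| + |y|
  set p' := |x'| + |y'|
  have hp : 0 ≤ p := by positivity
  have hp' : 0 ≤ p' := by positivity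
  set G := u * u' - v * v' - x * x' + y * y'
  -- This is `(x - s y)(x' - s y') - (y - s x)(y' - s x') = (1 - s²)(x x' - y y')` with the
  -- left-hand factors expressed through `u, v` and the errors.
  have key : (1 - s ^ 2) * G = -(c ^ 2 + s ^ 2 - 1) * (u * u' - v * v') +
      c * (u * f1 + e1 * u' - v * f2 - e2 * v') - (e1 * f1 - e2 * f2) := by
    simp only [G, he1, he2, hf1, hf2]
    ring
  have hlow : c ^ 2 / 2 ≤ 1 - s ^ 2 := by
    have := (abs_le.mp hcs).2
    linarith [mul_le_mul_of_nonneg_right hη (sq_nonneg c)]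
  have hY : |u * u' - v * v'| ≤ (|u| + |v|) * (|u'| + |v'|) := by
    refine (abs_sub _ _).trans ?_
    rw [abs_mul, abs_mul]
    linarith [mul_nonneg (abs_nonneg u) (abs_nonneg v'),
      mul_nonneg (abs_nonneg v) (abs_nonneg u')]
  have hE1 : |u * f1 + e1 * u' - v * f2 - e2 * v'| ≤
      5 * ε * ((|u| + |v|) * p' + p * (|u'| + |v'|)) := by
    have a1 := abs_mul_le_of_abs_le (le_refl |u|) h1'
    have a2 := abs_mul_le_of_abs_le h1 (le_refl |u'|)
    have a3 := abs_mul_le_of_abs_le (le_refl |v|) h2'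
    have a4 := abs_mul_le_of_abs_le h2 (le_refl |v'|)
    calc |u * f1 + e1 * u' - v * f2 - e2 * v'|
        ≤ |u * f1| + |e1 * u'| + |v * f2| + |e2 * v'| :=
          (abs_sub _ _).trans (add_le_add ((abs_sub _ _).trans
            (add_le_add (abs_add_le _ _) le_rfl)) le_rfl)
      _ ≤ _ := by linarith
  -- The two products are of size `25 ε²` each; `50 ε ≤ c²` turns one `ε` into `c²`, which cancels
  -- on division by `1 - s² ≥ c² / 2`.
  have hE2 : |e1 * f1 - e2 * f2| ≤ c ^ 2 * (ε * (p * p')) := by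
    have a1 := abs_mul_le_of_abs_le h1 h1'
    have a2 := abs_mul_le_of_abs_le h2 h2'
    have a3 : 50 * ε * (ε * (p * p')) ≤ c ^ 2 * (ε * (p * p')) := by gcongr
    calc |e1 * f1 - e2 * f2| ≤ |e1 * f1| + |e2 * f2| := abs_sub _ _
      _ ≤ _ := by linarith
  have hG : c ^ 2 / 2 * |G| ≤ η * c ^ 2 * ((|u| + |v|) * (|u'| + |v'|)) +
      c * (5 * ε * ((|u| + |v|) * p' + p * (|u'| + |v'|))) + c ^ 2 * (ε * (p * p')) := by
    calc c ^ 2 / 2 * |G| ≤ (1 - s ^ 2) * |G| := by gcongr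
      _ = |(1 - s ^ 2) * G| := by
        rw [abs_mul, abs_of_nonneg (le_trans (by positivity) hlow)]
      _ ≤ |-(c ^ 2 + s ^ 2 - 1) * (u * u' - v * v')| +
          |c * (u * f1 + e1 * u' - v * f2 - e2 * v')| + |e1 * f1 - e2 * f2| := by
        rw [key]
        exact (abs_sub _ _).trans (add_le_add (abs_add_le _ _) le_rfl)
      _ ≤ _ := by
        refine add_le_add (add_le_add ?_ ?_) hE2
        · exact abs_mul_le_of_abs_le (by rwa [abs_neg]) hY
        · rw [abs_mul, abs_of_pos hc]
          gcongr
  refine le_of_mul_le_mul_left (hG.trans_eq ?_) (show 0 < c ^ 2 / 2 by positivity)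
  field_simp
  ring

/-- The change of displacement in a perturbed rotation from `(x, v)` to `(u, y)`. -/
theorem abs_displacement_rotation {s c ε x y u v x' y' u' v' : ℝ}
    (h0 : 0 ≤ ε) (hε : ε ≤ 1 / 100)
    (hcs : |c ^ 2 + s ^ 2 - 1| ≤ 27 * ε)
    (h1 : |c * v - (y - s * x)| ≤ 40 * ε * (|x| + |y| + |u| + |v|))
    (h2 : |u - (c * x - s * v)| ≤ 40 * ε * (|x| + |y| + |u| + |v|))
    (h1' : |c * v' - (y' - s * x')| ≤ 40 * ε * (|x'| + |y'| + |u'| + |v'|))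
    (h2' : |u' - (c * x' - s * v')| ≤ 40 * ε * (|x'| + |y'| + |u'| + |v'|)) :
    |u * u' - v * v' - x * x' + y * y'| ≤
      ε * ((16 * (|x| + |y| + |u| + |v|)) * (16 * (|x'| + |y'| + |u'| + |v'|))) := by
  set e1 := c * v - (y - s * x) with he1
  set e2 := u - (c * x - s * v) with he2
  set f1 := c * v' - (y' - s * x') with hf1
  set f2 := u' - (c * x' - s * v') with hf2
  set r := |x| + |y| + |u| + |v|
  set r' := |x'| + |y'| + |u'| + |v'|
  have hy : |y| ≤ r := by simp only [r]; linarith [abs_nonneg x, abs_nonneg u, abs_nonneg v]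
  have hu : |u| ≤ r := by simp only [r]; linarith [abs_nonneg x, abs_nonneg y, abs_nonneg v]
  have hy' : |y'| ≤ r' := by
    simp only [r']; linarith [abs_nonneg x', abs_nonneg u', abs_nonneg v']
  have hu' : |u'| ≤ r' := by
    simp only [r']; linarith [abs_nonneg x', abs_nonneg y', abs_nonneg v']
  have hr : 0 ≤ r := by positivity
  have hr' : 0 ≤ r' := by positivity
  -- Up to the errors, `u = c x - s v` and `y = s x + c v`. The displacement is the defect of
  -- orthogonality of this rotation, so nothing is divided by `1 - s²`.
  have key : u * u' - v * v' - x * x' + y * y' = (c ^ 2 + s ^ 2 - 1) * (x * x' + v * v') +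
      (u * f2 + e2 * u') - (y * f1 + e1 * y') - (e2 * f2 + e1 * f1) := by
    simp only [he1, he2, hf1, hf2]
    ring
  have hxv : |x * x' + v * v'| ≤ r * r' := by
    refine (abs_add_le _ _).trans ?_
    rw [abs_mul, abs_mul]
    have : |x| + |v| ≤ r := by simp only [r]; linarith [abs_nonneg y, abs_nonneg u]
    have h' : |x'| + |v'| ≤ r' := by simp only [r']; linarith [abs_nonneg y', abs_nonneg u']
    have := mul_le_mul this h' (by positivity) hr
    linarith [mul_nonneg (abs_nonneg x) (abs_nonneg v'),
      mul_nonneg (abs_nonneg v) (abs_nonneg x')]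
  have b0 := abs_mul_le_of_abs_le hcs hxv
  have b1 := abs_mul_le_of_abs_le hu h2'
  have b2 := abs_mul_le_of_abs_le h2 hu'
  have b3 := abs_mul_le_of_abs_le hy h1'
  have b4 := abs_mul_le_of_abs_le h1 hy'
  have b5 := abs_mul_le_of_abs_le h2 h2'
  have b6 := abs_mul_le_of_abs_le h1 h1'
  rw [key]
  have htri : |(c ^ 2 + s ^ 2 - 1) * (x * x' + v * v') + (u * f2 + e2 * u') -
      (y * f1 + e1 * y') - (e2 * f2 + e1 * f1)| ≤
      |(c ^ 2 + s ^ 2 - 1) * (x * x' + v * v')| + (|u * f2| + |e2 * u'|) +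
      (|y * f1| + |e1 * y'|) + (|e2 * f2| + |e1 * f1|) :=
    (abs_sub _ _).trans (add_le_add ((abs_sub _ _).trans (add_le_add ((abs_add_le _ _).trans
      (add_le_add le_rfl (abs_add_le _ _))) (abs_add_le _ _))) (abs_add_le _ _))
  have hq : ε * (ε * (r * r')) ≤ 1 / 100 * (ε * (r * r')) := by gcongr
  have hq0 : 0 ≤ ε * (r * r') := by positivity
  linarith

end StepDisplacement

/-! ### From displacement errors to the norm of the backward error. -/

section NormBounds

/-- A matrix that is dominated by `∑ wₐ wₐᵀ` has norm at most `∑ ‖wₐ‖²`. -/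
theorem norm_le_of_abs_le_sum_mul {n : ℕ} {ι : Type*} (S : Finset ι)
    (M : Matrix (Fin n) (Fin n) ℝ) (w : ι → Fin n → ℝ)
    (hM : ∀ i j, |M i j| ≤ ∑ a ∈ S, w a i * w a j) :
    ‖M‖ ≤ ∑ a ∈ S, ∑ i, w a i ^ 2 := by
  have hK : 0 ≤ ∑ a ∈ S, ∑ i, w a i ^ 2 :=
    Finset.sum_nonneg fun a _ => Finset.sum_nonneg fun i _ => sq_nonneg _
  rw [Matrix.l2_opNorm_def]
  refine ContinuousLinearMap.opNorm_le_bound _ hK fun x => ?_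
  set y : EuclideanSpace ℝ (Fin n) := WithLp.toLp 2 (M *ᵥ x.ofLp)
  change ‖y‖ ≤ _
  have hCS : ∀ (a : ι) (z : EuclideanSpace ℝ (Fin n)),
      |∑ i, w a i * (|z i|)| ≤ √(∑ i, w a i ^ 2) * ‖z‖ := by
    intro a z
    rw [EuclideanSpace.norm_eq, ← Real.sqrt_mul (Finset.sum_nonneg fun i _ => sq_nonneg _)]
    refine Real.abs_le_sqrt ?_
    have := Finset.sum_mul_sq_le_sq_mul_sq Finset.univ (w a) (fun i => |z i|)
    simpa [Real.norm_eq_abs] using this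
  have hyy : ‖y‖ ^ 2 ≤ (∑ a ∈ S, ∑ i, w a i ^ 2) * ‖x‖ * ‖y‖ := by
    have e1 : ‖y‖ ^ 2 = ∑ i, ∑ j, y i * (M i j * x j) := by
      rw [EuclideanSpace.norm_sq_eq]
      refine Finset.sum_congr rfl fun i _ => ?_
      rw [Real.norm_eq_abs, sq_abs, sq, ← Finset.mul_sum]
      rfl
    rw [e1]
    calc ∑ i, ∑ j, y i * (M i j * x j)
        ≤ ∑ i, ∑ j, ∑ a ∈ S, (w a i * |y i|) * (w a j * |x j|) := by
          refine Finset.sum_le_sum fun i _ => Finset.sum_le_sum fun j _ => ?_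
          calc y i * (M i j * x j) ≤ |y i * (M i j * x j)| := le_abs_self _
            _ = |M i j| * (|y i| * |x j|) := by rw [abs_mul, abs_mul]; ring
            _ ≤ (∑ a ∈ S, w a i * w a j) * (|y i| * |x j|) := by gcongr; exact hM i j
            _ = _ := by
              rw [Finset.sum_mul]
              exact Finset.sum_congr rfl fun a _ => by ring
      _ = ∑ a ∈ S, (∑ i, w a i * |y i|) * (∑ j, w a j * |x j|) := by
          simp only [Finset.sum_mul_sum]
          rw [Finset.sum_comm' (t' := Finset.univ) (s' := fun _ => Finset.univ) (by simp)]
          simp only [Finset.sum_comm (s := Finset.univ) (t := S)]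
          refine Finset.sum_congr rfl fun a _ => ?_
          rw [Finset.sum_comm]
      _ ≤ ∑ a ∈ S, (∑ i, w a i ^ 2) * (‖x‖ * ‖y‖) := by
          refine Finset.sum_le_sum fun a _ => ?_
          refine (le_abs_self _).trans ((abs_mul_le_of_abs_le (hCS a y) (hCS a x)).trans_eq ?_)
          have := Real.mul_self_sqrt (show 0 ≤ ∑ i, w a i ^ 2 from
            Finset.sum_nonneg fun i _ => sq_nonneg _)
          linear_combination (‖x‖ * ‖y‖) * this
      _ = _ := by rw [← Finset.sum_mul]; ring
  rcases (norm_nonneg y).eq_or_lt with h | h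
  · rw [← h]; positivity
  · exact le_of_mul_le_mul_right (by rwa [← sq]) h

/-- A matrix with small displacement is small. -/
theorem norm_toeplitz_sub_le {n : ℕ} {t : ℕ → ℝ} {ε : ℝ} (h0 : 0 ≤ ε) (u v r : ℕ → ℕ → ℝ)
    (hu : ∀ k j, k < n → j < k → u k j = 0) (hv : ∀ k j, k < n → j ≤ k → v k j = 0)
    (hr : ∀ k j, 0 ≤ r k j)
    (hinit : ∀ j, j < n → |u 0 0 * u 0 j - t j| ≤ ε * (r 0 0 * r 0 j))
    (hinit' : ∀ j, 0 < j → u 0 j = v 0 j)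
    (hstep : ∀ k i j, k + 1 < n → i < n → j < n →
      |u (k + 1) i * u (k + 1) j - v (k + 1) i * v (k + 1) j -
        Downdating.shiftDown (u k) i * Downdating.shiftDown (u k) j + v k i * v k j| ≤
      ε * (r (k + 1) i * r (k + 1) j)) :
    ‖toeplitz n t - (Matrix.of fun k j : Fin n => u k j)ᵀ *
        (Matrix.of fun k j : Fin n => u k j)‖ ≤
      ε * (n * ∑ k ∈ Finset.range n, ∑ j ∈ Finset.range n, r k j ^ 2) := by
  set E : ℕ → ℕ → ℝ := fun i j =>
    ∑ k ∈ Finset.range n, u k i * u k j - t (Nat.dist i j) with hE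
  set ρ : ℕ → ℕ → ℝ := fun i j => ∑ k ∈ Finset.range n, r k i * r k j with hρ
  have hρ0 : ∀ i j, 0 ≤ ρ i j := fun i j =>
    Finset.sum_nonneg fun k _ => mul_nonneg (hr k i) (hr k j)
  have hE0 : ∀ j, j < n → |E 0 j| ≤ ε * ρ 0 j := by
    intro j hj
    have e : E 0 j = u 0 0 * u 0 j - t j := by
      simp only [hE]
      rw [Finset.sum_eq_single_of_mem 0 (Finset.mem_range.mpr (by omega))]
      · simp [Nat.dist]
      · intro k hk hk0
        rw [hu k 0 (Finset.mem_range.mp hk) (by omega), zero_mul]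
    rw [e]
    refine (hinit j hj).trans (mul_le_mul_of_nonneg_left ?_ h0)
    exact Finset.single_le_sum (f := fun k => r k 0 * r k j)
      (fun k _ => mul_nonneg (hr k 0) (hr k j)) (Finset.mem_range.mpr (by omega))
  have hsymm : ∀ i j, E i j = E j i := by
    intro i j
    simp only [hE, Nat.dist_comm i j, mul_comm]
  -- `T` is constant along diagonals, so it drops out of the difference of `E` along a diagonal.
  have hEs : ∀ i j, i + 1 < n → j + 1 < n →
      |E (i + 1) (j + 1)| ≤ |E i j| + ε * ρ (i + 1) (j + 1) := by
    intro i j hi hj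
    obtain ⟨m, rfl⟩ : ∃ m, n = m + 1 := ⟨n - 1, by omega⟩
    have hd : Nat.dist (i + 1) (j + 1) = Nat.dist i j := by simp [Nat.dist]
    -- Summing the steps cancels the intermediate `v v`-terms. The first is matched by `u 0`, which
    -- equals `v 0` beyond index `0`; the last vanishes because `v m` is zero up to index `m`.
    have hG : ∀ k, k ≤ m → |∑ l ∈ Finset.range k,
        (u (l + 1) (i + 1) * u (l + 1) (j + 1) - u l i * u l j) +
          u 0 (i + 1) * u 0 (j + 1) - v k (i + 1) * v k (j + 1)| ≤
        ε * ∑ l ∈ Finset.range (k + 1), r l (i + 1) * r l (j + 1) := by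
      intro k hk
      induction k with
      | zero =>
        rw [hinit' (i + 1) (by omega), hinit' (j + 1) (by omega)]
        simpa using mul_nonneg h0 (mul_nonneg (hr 0 (i + 1)) (hr 0 (j + 1)))
      | succ k ih =>
        have h1 := ih (by omega)
        have h2 := hstep k (i + 1) (j + 1) (by omega) hi hj
        simp only [Downdating.shiftDown] at h2
        rw [Finset.sum_range_succ, Finset.sum_range_succ _ (k + 1), mul_add]
        refine le_trans (le_of_eq ?_) ((abs_add_le _ _).trans (add_le_add h1 h2))
        congr 1
        ring
    have h := hG m le_rfl
    rw [hv m (i + 1) (by omega) (by omega), zero_mul, sub_zero] at h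
    have e : E (i + 1) (j + 1) = E i j + (∑ l ∈ Finset.range m,
        (u (l + 1) (i + 1) * u (l + 1) (j + 1) - u l i * u l j) +
          u 0 (i + 1) * u 0 (j + 1)) := by
      simp only [hE, hd, Finset.sum_sub_distrib]
      rw [Finset.sum_range_succ', Finset.sum_range_succ (fun k => u k i * u k j),
        hu m i (by omega) (by omega)]
      ring
    rw [e]
    exact (abs_add_le _ _).trans (add_le_add le_rfl h)
  -- `R (l, k)` is `r k` shifted down `l` places: errors accumulate along diagonals, so every shift
  -- of every weight vector contributes.
  set R : ℕ × ℕ → ℕ → ℝ := fun a i => if a.1 ≤ i then r a.2 (i - a.1) else 0 with hR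
  have hRs : ∀ l k i, R (l + 1, k) (i + 1) = R (l, k) i := by
    intro l k i
    simp [hR]
  have hbound : ∀ i j, i < n → j < n → ∀ N, i < N → j < N → |E i j| ≤
      ε * ∑ l ∈ Finset.range N, ∑ k ∈ Finset.range n, R (l, k) i * R (l, k) j := by
    have hR0 : ∀ a i, 0 ≤ R a i := by
      intro a i
      simp only [hR]
      split_ifs
      exacts [hr _ _, le_rfl]
    have hbase : ∀ j N, j < n → j < N → |E 0 j| ≤
        ε * ∑ l ∈ Finset.range N, ∑ k ∈ Finset.range n, R (l, k) 0 * R (l, k) j := by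
      intro j N hj hN
      refine (hE0 j hj).trans (mul_le_mul_of_nonneg_left ?_ h0)
      have := Finset.single_le_sum
        (f := fun l => ∑ k ∈ Finset.range n, R (l, k) 0 * R (l, k) j)
        (fun l _ => Finset.sum_nonneg fun k _ => mul_nonneg (hR0 _ _) (hR0 _ _))
        (Finset.mem_range.mpr (show 0 < N by omega))
      refine le_trans (le_of_eq ?_) this
      simp [hR, hρ]
    intro i
    induction i with
    | zero => exact fun j _ hj N _ hN => hbase j N hj hN
    | succ i ih =>
      intro j hi hj N hiN hjN
      cases j with
      | zero =>
        rw [hsymm]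
        refine (hbase (i + 1) N hi hiN).trans_eq ?_
        simp only [mul_comm]
      | succ j =>
        obtain ⟨N, rfl⟩ : ∃ M, N = M + 1 := ⟨N - 1, by omega⟩
        refine (hEs i j hi hj).trans ?_
        rw [Finset.sum_range_succ', mul_add]
        simp only [hRs]
        refine add_le_add (ih j (by omega) (by omega) N (by omega) (by omega)) (le_of_eq ?_)
        simp [hR, hρ]
  have hnorm := norm_le_of_abs_le_sum_mul (Finset.range n ×ˢ Finset.range n)
    (toeplitz n t - (Matrix.of fun k j : Fin n => u k j)ᵀ *
        (Matrix.of fun k j : Fin n => u k j)) (fun a i => √ε * R a i) (by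
      intro i j
      have e : (toeplitz n t - (Matrix.of fun k j : Fin n => u k j)ᵀ *
          (Matrix.of fun k j : Fin n => u k j)) i j = -E i j := by
        simp [toeplitz, Matrix.mul_apply, hE, Finset.sum_range]
      rw [e, abs_neg]
      refine (hbound i j i.2 j.2 n i.2 j.2).trans_eq ?_
      rw [Finset.sum_product, Finset.mul_sum]
      refine Finset.sum_congr rfl fun l _ => ?_
      rw [Finset.mul_sum]
      refine Finset.sum_congr rfl fun k _ => ?_
      linear_combination -(R (l, k) i * R (l, k) j) * Real.mul_self_sqrt h0)
  refine hnorm.trans ?_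
  -- Shifting does not increase the norm, so the `n` shifts cost just a factor `n`.
  have hRle : ∀ l k, ∑ i : Fin n, (√ε * R (l, k) i) ^ 2 ≤
      ε * ∑ i ∈ Finset.range n, r k i ^ 2 := by
    intro l k
    simp only [mul_pow, Real.sq_sqrt h0]
    rw [← Finset.mul_sum, ← Finset.sum_range (fun i => R (l, k) i ^ 2)]
    refine mul_le_mul_of_nonneg_left ?_ h0
    induction l with
    | zero => simp [hR]
    | succ l ih =>
      refine le_trans ?_ ih
      cases n with
      | zero => simp
      | succ m =>
        rw [Finset.sum_range_succ', Finset.sum_range_succ]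
        simp only [hRs]
        have : R (l + 1, k) 0 = 0 := by simp [hR]
        rw [this]
        nlinarith [sq_nonneg (R (l, k) m)]
  rw [Finset.sum_product]
  refine (Finset.sum_le_sum fun l _ => Finset.sum_le_sum fun k _ => hRle l k).trans_eq ?_
  rw [Finset.sum_const, Finset.card_range, ← Finset.mul_sum, nsmul_eq_mul]
  ring

end NormBounds

/-! ### Error relations of the three downdating rules. -/

section ComputedStep

open Downdating

variable {ε : ℝ} (F : FloatArith ε) (rule : Downdating) (t : ℕ → ℝ)

theorem factorPair_fst_eq_zero {k j : ℕ} (hj : j < k) : (factorPair F rule t k).1 j = 0 := by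
  cases k with
  | zero => omega
  | succ k => simp [factorPair, step, Nat.le_of_lt_succ hj]

theorem factorPair_snd_eq_zero {k j : ℕ} (hj : j ≤ k) : (factorPair F rule t k).2 j = 0 := by
  cases k with
  | zero => simp [factorPair, Nat.le_zero.mp hj]
  | succ k =>
    by_cases h : j ≤ k
    · simp [factorPair, step, h]
    · obtain rfl : j = k + 1 := by omega
      cases rule <;> simp [factorPair, step, component]

theorem factor_blockTriangular (n : ℕ) : (factor F rule n t).BlockTriangular id :=
  fun i j hij => factorPair_fst_eq_zero F rule t (k := i) (j := j) hij

/-- Requirements for the error analysis of a downdating step. -/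
structure RegularStep (k : ℕ) (u v : ℕ → ℝ) : Prop where
  nonneg : 0 ≤ ε
  small : ε ≤ 1 / 100
  fst_eq_zero : ∀ j < k, u j = 0
  snd_eq_zero : ∀ j ≤ k, v j = 0
  pivot_ne_zero : u k ≠ 0
  sin_sq_lt : Downdating.sin F k u v ^ 2 < 1
  cos_pos : 0 < Downdating.cos F k u v
  cos_le : Downdating.cos F k u v ≤ 3 / 2

namespace RegularStep

variable {F} {k : ℕ} {u v : ℕ → ℝ}

theorem abs_sin_le (h : RegularStep F k u v) : |Downdating.sin F k u v| ≤ 1 :=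
  ((sq_lt_one_iff_abs_lt_one _).mp h.sin_sq_lt).le

theorem abs_cos_sq_err (h : RegularStep F k u v) :
    |Downdating.cos F k u v ^ 2 + Downdating.sin F k u v ^ 2 - 1| ≤
      12 * ε * Downdating.cos F k u v ^ 2 :=
  _root_.abs_cos_sq_err F h.nonneg h.small h.sin_sq_lt

theorem abs_cos_sq_err' (h : RegularStep F k u v) :
    |Downdating.cos F k u v ^ 2 + Downdating.sin F k u v ^ 2 - 1| ≤ 27 * ε := by
  have h1 : Downdating.cos F k u v ^ 2 ≤ (3 / 2) ^ 2 := pow_le_pow_left₀ h.cos_pos.le h.cos_le 2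
  have h2 := mul_le_mul_of_nonneg_left h1 h.nonneg
  linarith [h.abs_cos_sq_err]

theorem abs_pivot_le (h : RegularStep F k u v) :
    |v (k + 1) - Downdating.sin F k u v * u k| ≤ ε * |v (k + 1)| :=
  abs_pivot_err F h.pivot_ne_zero

theorem shiftDown_eq_zero (h : RegularStep F k u v) {j : ℕ} (hj : j ≤ k) :
    shiftDown u j = 0 := by
  cases j with
  | zero => rfl
  | succ j => exact h.fst_eq_zero j hj

theorem hyperbolic_err (h : RegularStep F k u v) (j : ℕ) :
    |cos F k u v * (step F .hyperbolic k (u, v)).1 j - (shiftDown u j - sin F k u v * v j)| ≤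
        5 * ε * (|shiftDown u j| + |v j|) ∧
    |cos F k u v * (step F .hyperbolic k (u, v)).2 j - (v j - sin F k u v * shiftDown u j)| ≤
        5 * ε * (|shiftDown u j| + |v j|) := by
  have h0 := h.nonneg
  by_cases hj : j ≤ k
  · simp [step, hj, h.shiftDown_eq_zero hj, h.snd_eq_zero j hj]
  · have e1 := abs_div_sub_mul_err F (x := shiftDown u j) (y := v j) h0 h.small h.abs_sin_le
      h.cos_pos
    have e2 := abs_div_sub_mul_err F (x := v j) (y := shiftDown u j) h0 h.small h.abs_sin_le
      h.cos_pos
    rw [add_comm] at e2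
    refine ⟨by simpa [step, hj, component] using e1, ?_⟩
    by_cases hp : j = k + 1
    · subst hp
      have e3 := h.abs_pivot_le
      simp only [step, hj, component, if_true, if_false, shiftDown, mul_zero, zero_sub, abs_neg]
      nlinarith [mul_nonneg h0 (abs_nonneg (u k)), mul_nonneg h0 (abs_nonneg (v (k + 1)))]
    · simpa [step, hj, component, hp] using e2

theorem mixedV_err (h : RegularStep F k u v) (j : ℕ) :
    |cos F k u v * (step F .mixedV k (u, v)).2 j - (v j - sin F k u v * shiftDown u j)| ≤
        5 * ε * (|shiftDown u j| + |v j|) ∧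
    |(step F .mixedV k (u, v)).1 j -
        (cos F k u v * shiftDown u j - sin F k u v * (step F .mixedV k (u, v)).2 j)| ≤
        7 * ε * (|shiftDown u j| + |(step F .mixedV k (u, v)).2 j|) := by
  have h0 := h.nonneg
  by_cases hj : j ≤ k
  · simp [step, hj, h.shiftDown_eq_zero hj, h.snd_eq_zero j hj]
  · constructor
    · have e2 := (h.hyperbolic_err j).2
      simpa [step, hj, component] using e2
    · have e := abs_mul_sub_mul_err F (x := shiftDown u j) (y := (step F .mixedV k (u, v)).2 j)
        h0 h.small h.abs_sin_le h.cos_pos.le h.cos_le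
      have e' : (step F .mixedV k (u, v)).1 j = F.sub (F.mul (cos F k u v) (shiftDown u j))
          (F.mul (sin F k u v) ((step F .mixedV k (u, v)).2 j)) := by
        simp [step, hj, component]
      rw [e']
      exact e

theorem mixedU_err (h : RegularStep F k u v) (j : ℕ) :
    |cos F k u v * (step F .mixedU k (u, v)).1 j - (shiftDown u j - sin F k u v * v j)| ≤
        40 * ε * (|shiftDown u j| + |v j|) ∧
    |(step F .mixedU k (u, v)).2 j -
        (cos F k u v * v j - sin F k u v * (step F .mixedU k (u, v)).1 j)| ≤
        7 * ε * (|shiftDown u j| + |v j| + |(step F .mixedU k (u, v)).1 j|) := by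
  have h0 := h.nonneg
  by_cases hj : j ≤ k
  · simp [step, hj, h.shiftDown_eq_zero hj, h.snd_eq_zero j hj]
  by_cases hp : j = k + 1
  -- At the pivot `u' = c x` replaces `(x - s y) / c` and `v' = 0`. The discrepancy is governed by
  -- `c² + s² - 1` and by the error `y - s x` of the computed sine.
  · subst hp
    have e3 := h.abs_pivot_le
    have hc := h.cos_pos
    have hc' := h.cos_le
    have hs := h.abs_sin_le
    have hcs := h.abs_cos_sq_err'
    have e4 := F.mul_err (cos F k u v) (u k)
    simp only [step, hj, component, if_true, if_false, shiftDown]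
    set s := sin F k u v
    set c := cos F k u v
    set w := F.mul c (u k)
    have hx := mul_nonneg h0 (abs_nonneg (u k))
    have hy := mul_nonneg h0 (abs_nonneg (v (k + 1)))
    have e5 : |w - c * u k| ≤ 3 / 2 * (ε * |u k|) := by
      rw [abs_mul, abs_of_pos hc] at e4
      have := mul_le_mul_of_nonneg_right hc' hx
      linarith
    have hsv : |s * (v (k + 1) - s * u k)| ≤ 1 * (ε * |v (k + 1)|) :=
      abs_mul_le_of_abs_le hs e3
    have hcw : |c * (w - c * u k)| ≤ 3 / 2 * (3 / 2 * (ε * |u k|)) :=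
      abs_mul_le_of_abs_le (by rwa [abs_of_pos hc]) e5
    have hcu : |(c ^ 2 + s ^ 2 - 1) * u k| ≤ 27 * ε * |u k| := by
      rw [abs_mul]
      exact mul_le_mul_of_nonneg_right hcs (abs_nonneg _)
    constructor
    · have e6 : c * w - (u k - s * v (k + 1)) = c * (w - c * u k) +
          (c ^ 2 + s ^ 2 - 1) * u k + s * (v (k + 1) - s * u k) := by ring
      rw [e6]
      refine (abs_add_le _ _).trans ((add_le_add (abs_add_le _ _) le_rfl).trans ?_)
      linarith
    · have e7 : 0 - (c * v (k + 1) - s * w) =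
          s * (w - c * u k) - c * (v (k + 1) - s * u k) := by ring
      have h7 : |s * (w - c * u k)| ≤ 1 * (3 / 2 * (ε * |u k|)) := abs_mul_le_of_abs_le hs e5
      have h8 : |c * (v (k + 1) - s * u k)| ≤ 3 / 2 * (ε * |v (k + 1)|) :=
        abs_mul_le_of_abs_le (by rwa [abs_of_pos hc]) e3
      rw [e7]
      refine (abs_sub _ _).trans ?_
      linarith [mul_nonneg h0 (abs_nonneg w)]
  · constructor
    · have e := (h.hyperbolic_err j).1
      have e' : (step F .mixedU k (u, v)).1 j = (step F .hyperbolic k (u, v)).1 j := by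
        simp [step, hj, component, hp]
      rw [e']
      refine e.trans ?_
      gcongr
      norm_num
    · have e := abs_mul_sub_mul_err F (x := v j) (y := (step F .mixedU k (u, v)).1 j)
        h0 h.small h.abs_sin_le h.cos_pos.le h.cos_le
      have e' : (step F .mixedU k (u, v)).2 j = F.sub (F.mul (cos F k u v) (v j))
          (F.mul (sin F k u v) ((step F .mixedU k (u, v)).1 j)) := by
        simp [step, hj, component, hp]
      rw [e']
      refine e.trans ?_
      nlinarith [mul_nonneg h0 (abs_nonneg (shiftDown u j))]

end RegularStep

/-- Weights that dominate the error of mixed downdating. -/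
noncomputable def mixedWeight (x y u v : ℝ) : ℝ := 16 * (|x| + |y| + |u| + |v|)

/-- Weights that dominate the error of hyperbolic downdating with cosine `c`. -/
noncomputable def hyperbolicWeight (l c x y u v : ℝ) : ℝ :=
  5 * (|u| + |v|) + 5 * (l * (|x| + |y|) + (|u| + |v|) / (l * c))

namespace RegularStep

variable {F rule} {k : ℕ} {u v : ℕ → ℝ}

theorem mixed_displacement (h : RegularStep F k u v)
    (hrule : rule = .mixedV ∨ rule = .mixedU) {u' v' : ℕ → ℝ}
    (hu' : u' = (step F rule k (u, v)).1) (hv' : v' = (step F rule k (u, v)).2) (i j : ℕ) :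
    |u' i * u' j - v' i * v' j - shiftDown u i * shiftDown u j + v i * v j| ≤
      ε * (mixedWeight (shiftDown u i) (v i) (u' i) (v' i) *
        mixedWeight (shiftDown u j) (v j) (u' j) (v' j)) := by
  have h0 := h.nonneg
  have hn : ∀ a : ℝ, 0 ≤ ε * |a| := fun a => mul_nonneg h0 (abs_nonneg a)
  rcases hrule with rfl | rfl
  · have e : ∀ j, |cos F k u v * v' j - (v j - sin F k u v * shiftDown u j)| ≤
          40 * ε * (|shiftDown u j| + |v j| + |u' j| + |v' j|) ∧
        |u' j - (cos F k u v * shiftDown u j - sin F k u v * v' j)| ≤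
          40 * ε * (|shiftDown u j| + |v j| + |u' j| + |v' j|) := by
      intro j
      obtain ⟨e1, e2⟩ := h.mixedV_err j
      rw [← hv'] at e1 e2
      rw [← hu'] at e2
      constructor <;> linarith [hn (shiftDown u j), hn (v j), hn (u' j), hn (v' j)]
    exact abs_displacement_rotation h0 h.small h.abs_cos_sq_err' (e i).1 (e i).2 (e j).1 (e j).2
  -- Computing `u'` first exchanges the roles of `(x, u')` and `(y, v')`; the rotation estimate then
  -- bounds the negated displacement.
  · have e : ∀ j, |cos F k u v * u' j - (shiftDown u j - sin F k u v * v j)| ≤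
          40 * ε * (|v j| + |shiftDown u j| + |v' j| + |u' j|) ∧
        |v' j - (cos F k u v * v j - sin F k u v * u' j)| ≤
          40 * ε * (|v j| + |shiftDown u j| + |v' j| + |u' j|) := by
      intro j
      obtain ⟨e1, e2⟩ := h.mixedU_err j
      rw [← hu'] at e1 e2
      rw [← hv'] at e2
      constructor <;> linarith [hn (shiftDown u j), hn (v j), hn (u' j), hn (v' j)]
    have key := abs_displacement_rotation h0 h.small h.abs_cos_sq_err' (e i).1 (e i).2 (e j).1
      (e j).2
    rw [← abs_neg] at key
    unfold mixedWeight
    refine le_trans (le_of_eq ?_) (key.trans_eq ?_)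
    · congr 1; ring
    · ring

theorem hyperbolic_displacement (h : RegularStep F k u v) {l : ℝ} (hl : 1 ≤ l)
    (hε : 50 * ε ≤ cos F k u v ^ 2) {u' v' : ℕ → ℝ}
    (hu' : u' = (step F .hyperbolic k (u, v)).1) (hv' : v' = (step F .hyperbolic k (u, v)).2)
    (i j : ℕ) :
    |u' i * u' j - v' i * v' j - shiftDown u i * shiftDown u j + v i * v j| ≤
      ε * (hyperbolicWeight l (cos F k u v) (shiftDown u i) (v i) (u' i) (v' i) *
        hyperbolicWeight l (cos F k u v) (shiftDown u j) (v j) (u' j) (v' j)) := by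
  have h0 := h.nonneg
  have e := h.hyperbolic_err
  rw [← hu', ← hv'] at e
  have hc := h.cos_pos
  have hsmall := h.small
  refine (abs_displacement_hyperbolic hc h0 h.abs_cos_sq_err (by linarith) hε
    (e i).1 (e i).2 (e j).1 (e j).2).trans ?_
  unfold hyperbolicWeight
  set c := cos F k u v
  set p := |shiftDown u i| + |v i|
  set p' := |shiftDown u j| + |v j|
  set q := |u' i| + |v' i|
  set q' := |u' j| + |v' j|
  have hp : 0 ≤ p := by positivity
  have hp' : 0 ≤ p' := by positivity
  have hq : 0 ≤ q := by positivity
  have hq' : 0 ≤ q' := by positivity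
  have hl0 : 0 < l := by linarith
  -- The cross terms of this product, which must dominate those of the error, do not depend on `l`;
  -- the scale is thus free for balancing the two parts of the weight.
  have hexp : (l * p + q / (l * c)) * (l * p' + q' / (l * c)) =
      l ^ 2 * (p * p') + (q / c * p' + p * (q' / c)) + q / (l * c) * (q' / (l * c)) := by
    field_simp
    ring
  have h1 : 0 ≤ q / (l * c) * (q' / (l * c)) := by positivity
  have h2 : p * p' ≤ l ^ 2 * (p * p') := le_mul_of_one_le_left (by positivity) (one_le_pow₀ hl)
  have h3 : 0 ≤ q * (l * p' + q' / (l * c)) := by positivity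
  have h4 : 0 ≤ (l * p + q / (l * c)) * q' := by positivity
  have h5 : 0 ≤ q / c * p' + p * (q' / c) := by positivity
  have h6 : 0 ≤ p * p' := by positivity
  calc 2 * (12 * ε) * (q * q') + 10 * ε * (q / c * p' + p * (q' / c)) + 2 * ε * (p * p')
      = ε * (24 * (q * q') + 10 * (q / c * p' + p * (q' / c)) + 2 * (p * p')) := by ring
    _ ≤ ε * (25 * (q * q') + 25 * (q * (l * p' + q' / (l * c)))
        + 25 * ((l * p + q / (l * c)) * q') +
        25 * ((l * p + q / (l * c)) * (l * p' + q' / (l * c)))) := by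
      rw [hexp]
      gcongr ε * ?_
      linarith [mul_nonneg hq hq']
    _ = _ := by ring

end RegularStep

theorem factorPair_init_err {j : ℕ} (h0 : 0 ≤ ε) (h1 : ε ≤ 1 / 100) (ht : 0 < t 0)
    (htj : |t j| ≤ t 0) :
    |F.div (t 0) (F.sqrt (t 0)) * F.div (t j) (F.sqrt (t 0)) - t j| ≤
      ε * (3 * √(t 0) * (3 * √(t 0))) := by
  have hs : 0 < √(t 0) := Real.sqrt_pos.mpr ht
  have hsq : √(t 0) * √(t 0) = t 0 := Real.mul_self_sqrt ht.le
  have eq := F.sqrt_err (t 0) ht.le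
  set q := F.sqrt (t 0)
  obtain ⟨q1, q2⟩ := abs_le.mp eq
  set w := √(t 0)
  have hlow : 99 / 100 * w ≤ q := by nlinarith
  have hup : q ≤ 101 / 100 * w := by nlinarith
  have hq : 0 < q := lt_of_lt_of_le (by positivity) hlow
  have ea := F.div_err (t 0) q hq.ne'
  have eb := F.div_err (t j) q hq.ne'
  set a := F.div (t 0) q
  set b := F.div (t j) q
  have eb' : |b - t j / q| ≤ ε * (102 / 100 * w) := by
    refine eb.trans ?_
    gcongr
    rw [abs_div, abs_of_pos hq, div_le_iff₀ hq]
    nlinarith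
  have ht0q : t 0 / q ≤ 102 / 100 * w := by
    rw [div_le_iff₀ hq]
    nlinarith
  have ea' : |a - t 0 / q| ≤ ε * (102 / 100 * w) := by
    refine ea.trans ?_
    gcongr
    rwa [abs_of_pos (by positivity)]
  have htq : |t j / q| ≤ 102 / 100 * w := by
    rw [abs_div, abs_of_pos hq, div_le_iff₀ hq]
    nlinarith
  -- Both entries of the product are divided by the rounded root `q`; its deviation enters through
  -- `q² - t₀ = (q - √t₀)(q + √t₀)`.
  have hqt : |q - t 0 / q| ≤ ε * (3 * w) := by
    have e : q - t 0 / q = (q - w) * ((q + w) / q) := by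
      rw [← hsq]
      field_simp
      ring
    have h2 : (q + w) / q ≤ 3 := by
      rw [div_le_iff₀ hq]
      linarith
    have h2' : |(q + w) / q| ≤ 3 := by rwa [abs_of_pos (by positivity)]
    rw [e]
    exact (abs_mul_le_of_abs_le eq h2').trans_eq (by ring)
  have ha : |a| ≤ 105 / 100 * w := by
    have h3 : |a| ≤ |t 0 / q| + |a - t 0 / q| := by
      calc |a| = |t 0 / q + (a - t 0 / q)| := by ring_nf
        _ ≤ _ := abs_add_le _ _
    rw [abs_of_pos (by positivity : 0 < t 0 / q)] at h3
    nlinarith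
  have key : a * b - t j = a * (b - t j / q) + (a - t 0 / q) * (t j / q) -
      (q - t 0 / q) * (t j / q) := by
    field_simp
    ring
  rw [key]
  have b1 := abs_mul_le_of_abs_le ha eb'
  have b2 := abs_mul_le_of_abs_le ea' htq
  have b3 := abs_mul_le_of_abs_le hqt htq
  refine (abs_sub _ _).trans ((add_le_add (abs_add_le _ _) le_rfl).trans ?_)
  have : 0 ≤ ε * (w * w) := by positivity
  linarith

end ComputedStep

/-! ### Backward error of `FACTOR`. -/

section FactorError

open Filter Topology Downdating

variable {n : ℕ} {t : ℕ → ℝ}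

/-- The first row contributes `t_j² / t₀` to a sum of squares equal to `t₀`. -/
theorem abs_toeplitz_le (hT : (toeplitz n t).PosDef) {j : ℕ} (hj : j < n) : |t j| ≤ t 0 := by
  have ht := toeplitz_zero_pos hT (by omega)
  have h1 : schurU t 0 j ^ 2 ≤ t 0 := by
    rw [← sum_schurU_sq hT hj]
    exact Finset.single_le_sum (f := fun k => schurU t k j ^ 2) (fun k _ => sq_nonneg _)
      (Finset.mem_range.mpr (by omega))
  have h2 : schurU t 0 j = t j / √(t 0) := by simp [schurU, schurPair]
  rw [h2, div_pow, Real.sq_sqrt ht.le, div_le_iff₀ ht] at h1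
  exact abs_le_of_sq_le_sq (by linarith) ht.le

/-- A family of weights with the constant `a` in front. -/
def weightCons (a : ℝ) (f : ℕ → ℕ → ℝ) : ℕ → ℕ → ℝ
  | 0 => fun _ => a
  | k + 1 => f k

/-- Each `‖u_k‖²` is counted at most twice, in the step that produces `u_k` and in the one that
consumes it, and together they give `n t₀`. The `9` comes from the constant weight of the initial
row. -/
theorem sum_weightCons_sq_le (hT : (toeplitz n t).PosDef) (hn : 0 < n) {B : ℝ} (hB : 0 ≤ B)
    {f : ℕ → ℕ → ℝ}
    (hf : ∀ k, k + 1 < n → ∑ j ∈ Finset.range n, f k j ^ 2 ≤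
      B * (∑ j ∈ Finset.range n, schurU t k j ^ 2 +
        ∑ j ∈ Finset.range n, schurU t (k + 1) j ^ 2)) :
    ∑ k ∈ Finset.range n, ∑ j ∈ Finset.range n, weightCons (3 * √(t 0)) f k j ^ 2 ≤
      (9 + 2 * B) * (n * t 0) := by
  have ht := toeplitz_zero_pos hT hn
  obtain ⟨m, rfl⟩ : ∃ m, n = m + 1 := ⟨n - 1, by omega⟩
  have hS := sum_sum_schurU_sq hT
  set S : ℕ → ℝ := fun k => ∑ j ∈ Finset.range (m + 1), schurU t k j ^ 2
  have hS0 : ∀ k, 0 ≤ S k := fun k => Finset.sum_nonneg fun _ _ => sq_nonneg _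
  change ∑ k ∈ Finset.range (m + 1), S k = _ at hS
  have h1 : ∑ k ∈ Finset.range m, S k ≤ ((m + 1 : ℕ) : ℝ) * t 0 := by
    rw [← hS, Finset.sum_range_succ]
    linarith [hS0 m]
  have h2 : ∑ k ∈ Finset.range m, S (k + 1) ≤ ((m + 1 : ℕ) : ℝ) * t 0 := by
    rw [← hS, Finset.sum_range_succ']
    linarith [hS0 0]
  have h3 : ∑ k ∈ Finset.range m, ∑ j ∈ Finset.range (m + 1), f k j ^ 2 ≤
      ∑ k ∈ Finset.range m, B * (S k + S (k + 1)) :=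
    Finset.sum_le_sum fun k hk => hf k (by have := Finset.mem_range.mp hk; omega)
  rw [← Finset.mul_sum, Finset.sum_add_distrib] at h3
  have h4 : ∑ j ∈ Finset.range (m + 1), (3 * √(t 0)) ^ 2 = 9 * (((m + 1 : ℕ) : ℝ) * t 0) := by
    rw [Finset.sum_const, Finset.card_range, nsmul_eq_mul, mul_pow, Real.sq_sqrt ht.le]
    ring
  rw [Finset.sum_range_succ']
  simp only [weightCons]
  rw [h4]
  have h5 := mul_le_mul_of_nonneg_left (add_le_add h1 h2) hB
  linarith

theorem sum_schur_step_sq_le (hT : (toeplitz n t).PosDef) {k : ℕ} (hk : k + 1 < n) :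
    ∑ j ∈ Finset.range n, (shiftDown (schurU t k) j ^ 2 + schurV t k j ^ 2) ≤
      2 * ∑ j ∈ Finset.range n, schurU t k j ^ 2 ∧
    ∑ j ∈ Finset.range n, (schurU t (k + 1) j ^ 2 + schurV t (k + 1) j ^ 2) ≤
      2 * ∑ j ∈ Finset.range n, schurU t (k + 1) j ^ 2 := by
  have h1 := sum_shiftDown_sq_le n (schurU t k)
  have h2 := sum_schurV_sq_le hT (k := k) (by omega)
  have h3 := sum_schurV_sq_le hT (k := k + 1) hk
  rw [Finset.sum_add_distrib, Finset.sum_add_distrib]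
  constructor <;> linarith

theorem mixedWeight_sq_le (x y u v : ℝ) :
    mixedWeight x y u v ^ 2 ≤ 1024 * ((x ^ 2 + y ^ 2) + (u ^ 2 + v ^ 2)) := by
  unfold mixedWeight
  rw [← sq_abs x, ← sq_abs y, ← sq_abs u, ← sq_abs v]
  linarith [sq_nonneg (|x| - |y|), sq_nonneg (|x| - |u|), sq_nonneg (|x| - |v|),
    sq_nonneg (|y| - |u|), sq_nonneg (|y| - |v|), sq_nonneg (|u| - |v|)]

theorem hyperbolicWeight_sq_le {l c : ℝ} (x y u v : ℝ) :
    hyperbolicWeight l c x y u v ^ 2 ≤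
      150 * (u ^ 2 + v ^ 2) + 150 * (l ^ 2 * (x ^ 2 + y ^ 2)) +
        150 * ((u ^ 2 + v ^ 2) / (l * c) ^ 2) := by
  unfold hyperbolicWeight
  have hq : (|u| + |v|) ^ 2 ≤ 2 * (u ^ 2 + v ^ 2) := by
    rw [← sq_abs u, ← sq_abs v]
    linarith [sq_nonneg (|u| - |v|)]
  have hp : (|x| + |y|) ^ 2 ≤ 2 * (x ^ 2 + y ^ 2) := by
    rw [← sq_abs x, ← sq_abs y]
    linarith [sq_nonneg (|x| - |y|)]
  set q := |u| + |v|
  set p := |x| + |y|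
  have hlp : (l * p) ^ 2 ≤ 2 * (l ^ 2 * (x ^ 2 + y ^ 2)) := by
    rw [mul_pow]
    linarith [mul_le_mul_of_nonneg_left hp (sq_nonneg l)]
  have hqlc : (q / (l * c)) ^ 2 ≤ 2 * ((u ^ 2 + v ^ 2) / (l * c) ^ 2) := by
    rw [div_pow, ← mul_div_assoc]
    gcongr
  set a := l * p
  set b := q / (l * c)
  linarith [sq_nonneg (q - a), sq_nonneg (q - b), sq_nonneg (a - b)]

theorem sum_mixedWeight_le (hT : (toeplitz n t).PosDef) {k : ℕ} (hk : k + 1 < n) :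
    ∑ j ∈ Finset.range n, mixedWeight (shiftDown (schurU t k) j) (schurV t k j)
        (schurU t (k + 1) j) (schurV t (k + 1) j) ^ 2 ≤
      2048 * (∑ j ∈ Finset.range n, schurU t k j ^ 2 +
        ∑ j ∈ Finset.range n, schurU t (k + 1) j ^ 2) := by
  obtain ⟨h1, h2⟩ := sum_schur_step_sq_le hT hk
  refine (Finset.sum_le_sum fun j _ => mixedWeight_sq_le _ _ _ _).trans ?_
  rw [← Finset.mul_sum, Finset.sum_add_distrib]
  linarith

theorem sum_hyperbolicWeight_le (hT : (toeplitz n t).PosDef) {k : ℕ} (hk : k + 1 < n) {l : ℝ}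
    (hl : l = 1 ∨ l = √n) :
    ∑ j ∈ Finset.range n, hyperbolicWeight l (schurCos t k) (shiftDown (schurU t k) j)
        (schurV t k j) (schurU t (k + 1) j) (schurV t (k + 1) j) ^ 2 ≤
      1800 * (n ^ 2 / l ^ 2) * (∑ j ∈ Finset.range n, schurU t k j ^ 2 +
        ∑ j ∈ Finset.range n, schurU t (k + 1) j ^ 2) := by
  obtain ⟨h1, h2⟩ := sum_schur_step_sq_le hT hk
  have h3 := sum_schur_succ_sq_le hT hk
  have hc := schurCos_pos hT hk
  have hn : (1 : ℝ) ≤ n := by exact_mod_cast (by omega : 1 ≤ n)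
  -- The old vectors are weighted by `l²` and the new ones by `n² / l²`; `l = √n` makes both equal
  -- to `n`.
  have hl2 : 1 ≤ l ^ 2 ∧ l ^ 2 ≤ n ^ 2 / l ^ 2 := by
    rcases hl with rfl | rfl
    · constructor
      · norm_num
      · rw [one_pow, div_one]
        exact one_le_pow₀ hn
    · rw [Real.sq_sqrt (by linarith)]
      refine ⟨hn, le_of_eq ?_⟩
      field_simp
  obtain ⟨hl1, hln⟩ := hl2
  have hl0 : 0 < l ^ 2 := by linarith
  set S := ∑ j ∈ Finset.range n, schurU t k j ^ 2
  set S' := ∑ j ∈ Finset.range n, schurU t (k + 1) j ^ 2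
  have hS : 0 ≤ S := Finset.sum_nonneg fun _ _ => sq_nonneg _
  have hS' : 0 ≤ S' := Finset.sum_nonneg fun _ _ => sq_nonneg _
  refine (Finset.sum_le_sum fun j _ => hyperbolicWeight_sq_le _ _ _ _).trans ?_
  rw [Finset.sum_add_distrib, Finset.sum_add_distrib, ← Finset.mul_sum, ← Finset.mul_sum,
    ← Finset.mul_sum, ← Finset.mul_sum, ← Finset.sum_div]
  -- Here smallness of the new vectors cancels the division by the cosine.
  have h4 : (∑ j ∈ Finset.range n, (schurU t (k + 1) j ^ 2 + schurV t (k + 1) j ^ 2)) /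
      (l * schurCos t k) ^ 2 ≤ 10 * (n ^ 2 / l ^ 2 * S) := by
    have hl' : l ≠ 0 := by
      rintro rfl
      simp at hl0
    rw [div_le_iff₀ (by positivity)]
    refine h3.trans_eq ?_
    field_simp
  have hN : 1 ≤ (n : ℝ) ^ 2 / l ^ 2 := hl1.trans hln
  set N := (n : ℝ) ^ 2 / l ^ 2
  have h5 : l ^ 2 * ∑ j ∈ Finset.range n, (shiftDown (schurU t k) j ^ 2 + schurV t k j ^ 2) ≤
      N * (2 * S) := by gcongr
  have h6 : 1 * S' ≤ N * S' := by gcongr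
  have h7 : 0 ≤ N * S := by positivity
  linarith

/-- Eventual smallness of the backward error, from weights that dominate the local errors. -/
theorem eventually_norm_toeplitz_sub_le {u v r : (Σ ε : ℝ, FloatArith ε) → ℕ → ℕ → ℝ}
    {r₀ : ℕ → ℕ → ℝ} {M : ℝ}
    (hlim : ∀ k < n, ∀ j < n, Tendsto (fun p => r p k j) highPrecision (𝓝 (r₀ k j)))
    (hM : ∑ k ∈ Finset.range n, ∑ j ∈ Finset.range n, r₀ k j ^ 2 < M)
    (hu : ∀ p k j, j < k → u p k j = 0) (hv : ∀ p k j, j ≤ k → v p k j = 0)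
    (hr : ∀ᶠ p in highPrecision, ∀ k j, 0 ≤ r p k j)
    (hinit : ∀ᶠ p in highPrecision, ∀ j < n,
      |u p 0 0 * u p 0 j - t j| ≤ p.1 * (r p 0 0 * r p 0 j))
    (hinit' : ∀ p j, 0 < j → u p 0 j = v p 0 j)
    (hstep : ∀ᶠ p in highPrecision, ∀ k, k + 1 < n → ∀ i j,
      |u p (k + 1) i * u p (k + 1) j - v p (k + 1) i * v p (k + 1) j -
        shiftDown (u p k) i * shiftDown (u p k) j + v p k i * v p k j| ≤
      p.1 * (r p (k + 1) i * r p (k + 1) j)) :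
    ∀ᶠ p in highPrecision, ‖toeplitz n t - (Matrix.of fun k j : Fin n => u p k j)ᵀ *
        (Matrix.of fun k j : Fin n => u p k j)‖ ≤ p.1 * (n * M) := by
  -- The strict bound `hM` on the exact weights passes to the computed ones for small `ε`.
  have hsum : Tendsto (fun p => ∑ k ∈ Finset.range n, ∑ j ∈ Finset.range n, r p k j ^ 2)
      highPrecision (𝓝 (∑ k ∈ Finset.range n, ∑ j ∈ Finset.range n, r₀ k j ^ 2)) :=
    tendsto_finsetSum _ fun k hk => tendsto_finsetSum _ fun j hj =>
      (hlim k (Finset.mem_range.mp hk) j (Finset.mem_range.mp hj)).pow 2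
  filter_upwards [hsum.eventually_lt_const hM, hr, hinit, hstep, eventually_precision_pos]
    with p h1 h2 h3 h4 h5
  refine (norm_toeplitz_sub_le h5.le (u p) (v p) (r p) (fun k j _ => hu p k j)
    (fun k j _ => hv p k j) h2 h3 (hinit' p) (fun k i j hk _ _ => h4 k hk i j)).trans ?_
  have := h5.le
  gcongr

theorem eventually_regularStep (hT : (toeplitz n t).PosDef) (rule : Downdating) :
    ∀ᶠ p in highPrecision, ∀ k, k + 1 < n →
      RegularStep p.2 k (factorPair p.2 rule t k).1 (factorPair p.2 rule t k).2 ∧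
      50 * p.1 ≤ Downdating.cos p.2 k (factorPair p.2 rule t k).1
        (factorPair p.2 rule t k).2 ^ 2 := by
  have h : ∀ᶠ p in highPrecision, ∀ k ∈ Finset.range (n - 1),
      Downdating.sin p.2 k (factorPair p.2 rule t k).1 (factorPair p.2 rule t k).2 ^ 2 < 1 ∧
      0 < Downdating.cos p.2 k (factorPair p.2 rule t k).1 (factorPair p.2 rule t k).2 ∧
      Downdating.cos p.2 k (factorPair p.2 rule t k).1 (factorPair p.2 rule t k).2 ≤ 3 / 2 ∧
      50 * p.1 ≤ Downdating.cos p.2 k (factorPair p.2 rule t k).1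
        (factorPair p.2 rule t k).2 ^ 2 := by
    rw [eventually_all_finset]
    intro k hk
    have hk : k + 1 < n := by have := Finset.mem_range.mp hk; omega
    obtain ⟨hu, hv⟩ := tendsto_factorPair rule hT k (by omega)
    have hs := tendsto_sin hT (by omega) hu hv
    have hc := tendsto_cos hT hk hu hv
    have hc0 := schurCos_pos hT hk
    have hc1 : schurCos t k < 3 / 2 := by
      have h1 := schurCos_sq hT hk
      nlinarith [sq_nonneg (schurSin t k)]
    have hε : Tendsto (fun p : Σ ε : ℝ, FloatArith ε => 50 * p.1) highPrecision (𝓝 0) := by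
      simpa using tendsto_precision_zero.const_mul 50
    filter_upwards [(hs.pow 2).eventually_lt_const (schurSin_sq_lt hT hk),
      hc.eventually_const_lt hc0, hc.eventually_lt_const hc1,
      hε.eventually_lt (hc.pow 2) (by positivity)] with p a b c d
    exact ⟨a, b, c.le, d.le⟩
  filter_upwards [h, eventually_factorRuns rule hT, eventually_precision_pos,
    eventually_precision_lt (δ := 1 / 100) (by norm_num)] with p h1 h2 h3 h4 k hk
  obtain ⟨a, b, c, d⟩ := h1 k (Finset.mem_range.mpr (by omega))
  exact ⟨⟨h3.le, h4.le, fun j hj => factorPair_fst_eq_zero _ _ _ hj,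
    fun j hj => factorPair_snd_eq_zero _ _ _ hj, (h2.2 k hk).1, a, b, c⟩, d⟩

theorem eventually_factor_diag_pos (hT : (toeplitz n t).PosDef) (rule : Downdating) :
    ∀ᶠ p in highPrecision, ∀ k, 0 < factor p.2 rule n t k k := by
  rw [eventually_all]
  intro k
  exact ((tendsto_factorPair rule hT k k.2).1 k).eventually_const_lt (schurU_diag_pos hT k.2)

theorem eventually_factor_norm_le (hT : (toeplitz n t).PosDef) (hn : 0 < n) (rule : Downdating)
    {M : ℝ} {w : ℝ → ℝ → ℝ → ℝ → ℝ → ℝ} (hw : ∀ c x y u v, 0 < c → 0 ≤ w c x y u v)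
    (hlim : ∀ k, k + 1 < n → ∀ j, Tendsto (fun p => w
        (Downdating.cos p.2 k (factorPair p.2 rule t k).1 (factorPair p.2 rule t k).2)
        (shiftDown (factorPair p.2 rule t k).1 j) ((factorPair p.2 rule t k).2 j)
        ((factorPair p.2 rule t (k + 1)).1 j) ((factorPair p.2 rule t (k + 1)).2 j))
      highPrecision (𝓝 (w (schurCos t k) (shiftDown (schurU t k) j) (schurV t k j)
        (schurU t (k + 1) j) (schurV t (k + 1) j))))
    (hM : ∑ k ∈ Finset.range n, ∑ j ∈ Finset.range n, weightCons (3 * √(t 0))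
      (fun k j => w (schurCos t k) (shiftDown (schurU t k) j) (schurV t k j)
        (schurU t (k + 1) j) (schurV t (k + 1) j)) k j ^ 2 < M)
    (hstep : ∀ {ε : ℝ} (F : FloatArith ε) (k : ℕ) (u v : ℕ → ℝ), RegularStep F k u v →
      50 * ε ≤ Downdating.cos F k u v ^ 2 → ∀ {u' v' : ℕ → ℝ}, u' = (step F rule k (u, v)).1 →
      v' = (step F rule k (u, v)).2 → ∀ i j,
      |u' i * u' j - v' i * v' j - shiftDown u i * shiftDown u j + v i * v j| ≤
      ε * (w (Downdating.cos F k u v) (shiftDown u i) (v i) (u' i) (v' i) *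
        w (Downdating.cos F k u v) (shiftDown u j) (v j) (u' j) (v' j))) :
    ∀ᶠ p in highPrecision,
      ‖toeplitz n t - (factor p.2 rule n t)ᵀ * factor p.2 rule n t‖ ≤ p.1 * (n * M) := by
  have ht := toeplitz_zero_pos hT hn
  refine eventually_norm_toeplitz_sub_le
    (u := fun p k j => (factorPair p.2 rule t k).1 j)
    (v := fun p k j => (factorPair p.2 rule t k).2 j)
    -- Weights must be nonnegative for all `k`, also beyond the dimension, where the computed cosine
    -- has no known sign; in the steps that matter the absolute value has no effect.
    (r := fun p => weightCons (3 * √(t 0)) fun k j => |w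
        (Downdating.cos p.2 k (factorPair p.2 rule t k).1 (factorPair p.2 rule t k).2)
        (shiftDown (factorPair p.2 rule t k).1 j) ((factorPair p.2 rule t k).2 j)
        ((factorPair p.2 rule t (k + 1)).1 j) ((factorPair p.2 rule t (k + 1)).2 j)|)
    (r₀ := weightCons (3 * √(t 0)) fun k j => |w (schurCos t k) (shiftDown (schurU t k) j)
      (schurV t k j) (schurU t (k + 1) j) (schurV t (k + 1) j)|)
    ?_ ?_ (fun p k j => factorPair_fst_eq_zero _ _ _) (fun p k j => factorPair_snd_eq_zero _ _ _)
    ?_ ?_ ?_ ?_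
  · intro k hk j hj
    cases k with
    | zero => exact tendsto_const_nhds
    | succ k => exact (hlim k hk j).abs
  · refine lt_of_eq_of_lt (Finset.sum_congr rfl fun k _ => Finset.sum_congr rfl fun j _ => ?_) hM
    cases k with
    | zero => rfl
    | succ k => exact sq_abs _
  · refine Eventually.of_forall fun p k j => ?_
    cases k with
    | zero => simp only [weightCons]; positivity
    | succ k => exact abs_nonneg _
  · filter_upwards [eventually_precision_pos,
      eventually_precision_lt (δ := 1 / 100) (by norm_num)] with p h1 h2 j hj
    exact factorPair_init_err p.2 t h1.le h2.le ht (abs_toeplitz_le hT hj)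
  · intro p j hj
    simp [factorPair, hj.ne']
  · filter_upwards [eventually_regularStep hT rule] with p hp k hk i j
    obtain ⟨hreg, hε⟩ := hp k hk
    simp only [weightCons]
    rw [abs_of_nonneg (hw _ _ _ _ _ hreg.cos_pos), abs_of_nonneg (hw _ _ _ _ _ hreg.cos_pos)]
    exact hstep p.2 k _ _ hreg hε rfl rfl i j

theorem eventually_mixed_norm_le (hT : (toeplitz n t).PosDef) (rule : Downdating)
    (hrule : rule = .mixedV ∨ rule = .mixedU) :
    ∀ᶠ p in highPrecision, ‖toeplitz n t - (factor p.2 rule n t)ᵀ * factor p.2 rule n t‖ ≤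
      5000 * (p.1 * t 0 * (n : ℝ) ^ 2) := by
  rcases Nat.eq_zero_or_pos n with rfl | hn
  · refine Eventually.of_forall fun p => ?_
    rw [Subsingleton.elim (toeplitz 0 t - _) 0, norm_zero]
    simp
  have ht := toeplitz_zero_pos hT hn
  have hn' : (0 : ℝ) < n := by exact_mod_cast hn
  -- The weights sum to at most `(9 + 2 · 2048) n t₀`, strictly below this.
  have key := eventually_factor_norm_le hT hn rule (M := 5000 * (n * t 0))
    (w := fun _ => mixedWeight) (fun c x y u v _ => by unfold mixedWeight; positivity) ?_ ?_ ?_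
  · filter_upwards [key] with p hp
    exact hp.trans_eq (by ring)
  · intro k hk j
    obtain ⟨hu, hv⟩ := tendsto_factorPair rule hT k (by omega)
    obtain ⟨hu', hv'⟩ := tendsto_factorPair rule hT (k + 1) hk
    exact ((((tendsto_shiftDown hu j).abs.add (hv j).abs).add (hu' j).abs).add
      (hv' j).abs).const_mul 16
  · refine (sum_weightCons_sq_le hT hn (B := 2048) (by norm_num)
      fun k hk => sum_mixedWeight_le hT hk).trans_lt ?_
    gcongr
    norm_num
  · intro ε F k u v hreg _ u' v' hu' hv' i j
    exact hreg.mixed_displacement hrule hu' hv' i j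

theorem eventually_hyperbolic_norm_le (hT : (toeplitz n t).PosDef) :
    ∀ᶠ p in highPrecision,
      ‖toeplitz n t - (factor p.2 .hyperbolic n t)ᵀ * factor p.2 .hyperbolic n t‖ ≤
        5000 * (p.1 * t 0 * (n : ℝ) ^ 3) := by
  rcases Nat.eq_zero_or_pos n with rfl | hn
  · refine Eventually.of_forall fun p => ?_
    rw [Subsingleton.elim (toeplitz 0 t - _) 0, norm_zero]
    simp
  have ht := toeplitz_zero_pos hT hn
  have hn' : (1 : ℝ) ≤ n := by exact_mod_cast hn
  have hl : 1 ≤ √(n : ℝ) := Real.one_le_sqrt.mpr hn'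
  -- With `l = √n` the constant is `9 + 2 · 1800 n < 5000 n`.
  have key := eventually_factor_norm_le hT hn .hyperbolic (M := 5000 * n * (n * t 0))
    (w := hyperbolicWeight √n)
    (fun c x y u v hc => by unfold hyperbolicWeight; positivity) ?_ ?_ ?_
  · filter_upwards [key] with p hp
    exact hp.trans_eq (by ring)
  · intro k hk j
    obtain ⟨hu, hv⟩ := tendsto_factorPair .hyperbolic hT k (by omega)
    obtain ⟨hu', hv'⟩ := tendsto_factorPair .hyperbolic hT (k + 1) hk
    have hc := schurCos_pos hT hk
    exact (((hu' j).abs.add (hv' j).abs).const_mul 5).add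
      (((((tendsto_shiftDown hu j).abs.add (hv j).abs).const_mul √n).add
        (((hu' j).abs.add (hv' j).abs).div ((tendsto_cos hT hk hu hv).const_mul √n)
          (by positivity))).const_mul 5)
  · refine (sum_weightCons_sq_le hT hn (B := 1800 * n) (by positivity)
      fun k hk => (sum_hyperbolicWeight_le hT hk (Or.inr rfl)).trans_eq ?_).trans_lt ?_
    · rw [Real.sq_sqrt (by linarith)]
      field_simp
    · gcongr
      linarith
  · intro ε F k u v hreg hε u' v' hu' hv' i j
    exact hreg.hyperbolic_displacement hl hε hu' hv' i j

end FactorError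

/-! ### Displacement errors of the normalized Bareiss rows. -/

section BareissError

open Downdating

variable {ε : ℝ} (F : FloatArith ε) (t : ℕ → ℝ)

theorem shiftDown_div (u : ℕ → ℝ) (a : ℝ) (j : ℕ) :
    shiftDown (fun i => u i / a) j = shiftDown u j / a := by
  cases j with
  | zero => simp [shiftDown]
  | succ j => rfl

/-- The rows of `D^{-1/2} W`. -/
noncomputable def bareissU (k j : ℕ) : ℝ := (bareissGen F t k).1 j / √((bareissGen F t k).1 k)

/-- The companions of the rows of `D^{-1/2} W`. -/
noncomputable def bareissV (k j : ℕ) : ℝ := (bareissGen F t k).2 j / √((bareissGen F t k).1 k)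

/-- The implicit cosine in step `k` of the Bareiss algorithm. -/
noncomputable def bareissCos (k : ℕ) : ℝ :=
  √((bareissGen F t (k + 1)).1 (k + 1) / (bareissGen F t k).1 k)

/-- The implicit sine in step `k` of the Bareiss algorithm. -/
noncomputable def bareissSin (k : ℕ) : ℝ :=
  F.div ((bareissGen F t k).2 (k + 1)) ((bareissGen F t k).1 k)

theorem shiftDown_bareissGen_eq_zero {k j : ℕ} (hj : j ≤ k) :
    shiftDown (bareissGen F t k).1 j = 0 := by
  cases j with
  | zero => rfl
  | succ j => exact bareissGen_fst_eq_zero F t hj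

theorem bareissGen_err (k : ℕ) (h0 : 0 ≤ ε) (h1 : ε ≤ 1 / 100)
    (hd : 0 < (bareissGen F t k).1 k) (hs : |bareissSin F t k| ≤ 1) (j : ℕ) :
    |(bareissGen F t (k + 1)).1 j -
        (shiftDown (bareissGen F t k).1 j - bareissSin F t k * (bareissGen F t k).2 j)| ≤
      3 * ε * (|shiftDown (bareissGen F t k).1 j| + |(bareissGen F t k).2 j|) ∧
    |(bareissGen F t (k + 1)).2 j -
        ((bareissGen F t k).2 j - bareissSin F t k * shiftDown (bareissGen F t k).1 j)| ≤
      3 * ε * (|shiftDown (bareissGen F t k).1 j| + |(bareissGen F t k).2 j|) := by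
  by_cases hj : j ≤ k
  · simp [bareissGen_fst_eq_zero F t (show j < k + 1 by omega),
      bareissGen_snd_eq_zero F t (show j ≤ k + 1 by omega), bareissGen_snd_eq_zero F t hj,
      shiftDown_bareissGen_eq_zero F t hj]
  constructor
  · have e := abs_sub_mul_err F (x := shiftDown (bareissGen F t k).1 j)
      (y := (bareissGen F t k).2 j) h0 h1 hs
    simpa [bareissGen, hj, bareissSin] using e
  · by_cases hp : j = k + 1
    · subst hp
      have e := abs_pivot_err F (y := (bareissGen F t k).2 (k + 1)) hd.ne'
      rw [bareissGen_snd_eq_zero F t le_rfl, zero_sub, abs_neg]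
      refine e.trans ?_
      have h2 := mul_nonneg h0 (abs_nonneg ((bareissGen F t k).2 (k + 1)))
      have h3 := mul_nonneg h0 (abs_nonneg (shiftDown (bareissGen F t k).1 (k + 1)))
      linarith
    · have e := abs_sub_mul_err F (x := (bareissGen F t k).2 j)
        (y := shiftDown (bareissGen F t k).1 j) h0 h1 hs
      rw [add_comm |shiftDown _ _|]
      simpa [bareissGen, show ¬ j ≤ k + 1 by omega, bareissSin] using e

/-- The cosine is inferred from two successive diagonal entries, the second obtained by a
subtraction that may cancel; unlike in `abs_cos_sq_err` the bound carries no factor `c²`. -/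
theorem bareissCos_sq_err (k : ℕ) (h0 : 0 ≤ ε) (h1 : ε ≤ 1 / 100)
    (hd : 0 < (bareissGen F t k).1 k) (hd' : 0 < (bareissGen F t (k + 1)).1 (k + 1))
    (hs : |bareissSin F t k| ≤ 1) :
    |bareissCos F t k ^ 2 + bareissSin F t k ^ 2 - 1| ≤ 11 * ε := by
  have e1 := (bareissGen_err F t k h0 h1 hd hs (k + 1)).1
  have e2 := abs_pivot_err F (y := (bareissGen F t k).2 (k + 1)) hd.ne'
  rw [bareissCos, Real.sq_sqrt (by positivity)]
  change |(bareissGen F t k).2 (k + 1) - bareissSin F t k * (bareissGen F t k).1 k| ≤ _ at e2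
  simp only [shiftDown] at e1
  set s := bareissSin F t k
  set d := (bareissGen F t k).1 k
  set d' := (bareissGen F t (k + 1)).1 (k + 1)
  set y := (bareissGen F t k).2 (k + 1)
  have hy : |y| ≤ 2 * d := by
    have h2 : |y| ≤ |s * d| + |y - s * d| := by
      calc |y| = |s * d + (y - s * d)| := by ring_nf
        _ ≤ _ := abs_add_le _ _
    have h3 : |s * d| ≤ 1 * d := by
      rw [abs_mul, abs_of_pos hd]
      gcongr
    have h4 : ε * |y| ≤ 1 / 100 * |y| := by gcongr
    linarith
  have e3 : |s * (y - s * d)| ≤ 1 * (ε * |y|) := abs_mul_le_of_abs_le hs e2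
  have hεy : ε * |y| ≤ ε * (2 * d) := by gcongr
  rw [abs_of_pos hd] at e1
  have e4 : |d' - d * (1 - s ^ 2)| ≤ 11 * ε * d := by
    have : d' - d * (1 - s ^ 2) = (d' - (d - s * y)) - s * (y - s * d) := by ring
    rw [this]
    refine (abs_sub _ _).trans ?_
    linarith
  have e5 : d' / d + s ^ 2 - 1 = (d' - d * (1 - s ^ 2)) / d := by
    field_simp
    ring
  rw [e5, abs_div, abs_of_pos hd, div_le_iff₀ hd]
  exact e4

theorem bareiss_displacement (k : ℕ) (h0 : 0 ≤ ε) (h1 : ε ≤ 1 / 100)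
    (hd : 0 < (bareissGen F t k).1 k) (hd' : 0 < (bareissGen F t (k + 1)).1 (k + 1))
    (hs : |bareissSin F t k| ≤ 1) (hε : 50 * ε ≤ bareissCos F t k ^ 2) (i j : ℕ) :
    |bareissU F t (k + 1) i * bareissU F t (k + 1) j -
        bareissV F t (k + 1) i * bareissV F t (k + 1) j -
        shiftDown (bareissU F t k) i * shiftDown (bareissU F t k) j +
        bareissV F t k i * bareissV F t k j| ≤
      ε * (hyperbolicWeight 1 (bareissCos F t k) (shiftDown (bareissU F t k) i)
          (bareissV F t k i) (bareissU F t (k + 1) i) (bareissV F t (k + 1) i) *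
        hyperbolicWeight 1 (bareissCos F t k) (shiftDown (bareissU F t k) j)
          (bareissV F t k j) (bareissU F t (k + 1) j) (bareissV F t (k + 1) j)) := by
  have hc : 0 < bareissCos F t k := Real.sqrt_pos.mpr (by positivity)
  have hcs := bareissCos_sq_err F t k h0 h1 hd hd' hs
  -- The implicit cosine is exactly the ratio of consecutive normalizations, so normalizing adds no
  -- error.
  have hscale : ∀ a : ℝ, bareissCos F t k * (a / √((bareissGen F t (k + 1)).1 (k + 1))) =
      a / √((bareissGen F t k).1 k) := by
    intro a
    rw [bareissCos, Real.sqrt_div' _ hd.le]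
    field_simp
  have hw : 0 < √((bareissGen F t k).1 k) := Real.sqrt_pos.mpr hd
  have herr : ∀ a x y s : ℝ, |a - (x - s * y)| ≤ 3 * ε * (|x| + |y|) →
      |a / √((bareissGen F t k).1 k) - (x / √((bareissGen F t k).1 k) -
        s * (y / √((bareissGen F t k).1 k)))| ≤
      5 * ε * (|x / √((bareissGen F t k).1 k)| + |y / √((bareissGen F t k).1 k)|) := by
    intro a x y s h
    set w := √((bareissGen F t k).1 k)
    have e : a / w - (x / w - s * (y / w)) = (a - (x - s * y)) / w := by ring
    rw [e, abs_div, abs_div, abs_div, abs_of_pos hw, ← add_div, ← mul_div_assoc]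
    gcongr
    refine h.trans ?_
    gcongr
    norm_num
  have hrel : ∀ j, |bareissCos F t k * bareissU F t (k + 1) j -
        (shiftDown (bareissU F t k) j - bareissSin F t k * bareissV F t k j)| ≤
        5 * ε * (|shiftDown (bareissU F t k) j| + |bareissV F t k j|) ∧
      |bareissCos F t k * bareissV F t (k + 1) j -
        (bareissV F t k j - bareissSin F t k * shiftDown (bareissU F t k) j)| ≤
        5 * ε * (|shiftDown (bareissU F t k) j| + |bareissV F t k j|) := by
    intro j
    obtain ⟨e1, e2⟩ := bareissGen_err F t k h0 h1 hd hs j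
    have hsh : shiftDown (bareissU F t k) j =
        shiftDown (bareissGen F t k).1 j / √((bareissGen F t k).1 k) := shiftDown_div _ _ j
    rw [add_comm |shiftDown _ _|] at e2
    rw [hsh]
    simp only [bareissU, bareissV, hscale]
    refine ⟨herr _ _ _ _ e1, ?_⟩
    rw [add_comm |shiftDown _ _ / _|]
    exact herr _ _ _ _ e2
  -- Relative to `c²` the orthogonality defect is `11 ε / c²`. It produces a term `q q' / c²`, which
  -- the weight with `l = 1` absorbs in `(q / c)(q' / c)`.
  have hη : 11 * ε / bareissCos F t k ^ 2 ≤ 1 / 2 := by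
    rw [div_le_iff₀ (by positivity)]
    linarith
  have hcs' : |bareissCos F t k ^ 2 + bareissSin F t k ^ 2 - 1| ≤
      11 * ε / bareissCos F t k ^ 2 * bareissCos F t k ^ 2 := by
    rwa [div_mul_cancel₀ _ (by positivity)]
  refine (abs_displacement_hyperbolic hc h0 hcs' hη hε (hrel i).1 (hrel i).2 (hrel j).1
    (hrel j).2).trans ?_
  unfold hyperbolicWeight
  set c := bareissCos F t k
  set p := |shiftDown (bareissU F t k) i| + |bareissV F t k i|
  set p' := |shiftDown (bareissU F t k) j| + |bareissV F t k j|
  set q := |bareissU F t (k + 1) i| + |bareissV F t (k + 1) i|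
  set q' := |bareissU F t (k + 1) j| + |bareissV F t (k + 1) j|
  have hp : 0 ≤ p := by positivity
  have hp' : 0 ≤ p' := by positivity
  have hq : 0 ≤ q := by positivity
  have hq' : 0 ≤ q' := by positivity
  have hqc : 0 ≤ q / c := by positivity
  have hqc' : 0 ≤ q' / c := by positivity
  have h2 : 2 * (11 * ε / c ^ 2) * (q * q') = 22 * ε * (q / c * (q' / c)) := by
    field_simp
    ring
  rw [h2, one_mul, one_mul, one_mul]
  calc 22 * ε * (q / c * (q' / c)) + 10 * ε * (q / c * p' + p * (q' / c)) + 2 * ε * (p * p')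
      = ε * (22 * (q / c * (q' / c)) + 10 * (q / c * p' + p * (q' / c)) + 2 * (p * p')) := by
        ring
    _ ≤ ε * (5 * (p + q / c) * (5 * (p' + q' / c))) := by
      gcongr ε * ?_
      linarith [mul_nonneg hqc hqc', mul_nonneg hqc hp', mul_nonneg hp hqc', mul_nonneg hp hp']
    _ ≤ _ := by
      gcongr
      · linarith
      · linarith

theorem bareiss_apply {n : ℕ} (r c : Fin n) : bareiss F n t r c = (bareissGen F t r).1 c :=
  bareissRows_eq F t r.2 c.2

theorem bareiss_blockTriangular (n : ℕ) : (bareiss F n t).BlockTriangular id := by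
  intro i j hij
  rw [bareiss_apply]
  exact bareissGen_fst_eq_zero F t hij

theorem bareiss_transpose_mul {n : ℕ} (hd : ∀ k, k < n → 0 < (bareissGen F t k).1 k) :
    (bareiss F n t)ᵀ * (Matrix.diagonal fun k => (bareiss F n t k k)⁻¹) * bareiss F n t =
      (Matrix.of fun k j : Fin n => bareissU F t k j)ᵀ *
        (Matrix.of fun k j : Fin n => bareissU F t k j) := by
  ext i j
  rw [Matrix.mul_apply, Matrix.mul_apply]
  simp only [Matrix.mul_diagonal, Matrix.transpose_apply, Matrix.of_apply,
    bareiss_apply, bareissU]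
  refine Finset.sum_congr rfl fun k _ => ?_
  have h := hd k k.2
  have h2 := Real.mul_self_sqrt h.le
  have h3 : 0 < √((bareissGen F t k).1 k) := Real.sqrt_pos.mpr h
  rw [← h2]
  simp only [Real.sqrt_mul_self h3.le]
  field_simp

end BareissError

/-! ### Backward error of the Bareiss factorization. -/

section BareissBound

open Filter Topology Downdating

variable {n : ℕ} {t : ℕ → ℝ}

theorem tendsto_bareissGen_diag_sqrt (hT : (toeplitz n t).PosDef) {k : ℕ} (hk : k < n) :
    Tendsto (fun p => √((bareissGen p.2 t k).1 k)) highPrecision (𝓝 (schurU t k k)) := by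
  have h := ((tendsto_bareissGen hT k hk).1 k).sqrt
  rwa [Real.sqrt_mul_self (schurU_diag_pos hT hk).le] at h

theorem tendsto_bareissU (hT : (toeplitz n t).PosDef) {k : ℕ} (hk : k < n) (j : ℕ) :
    Tendsto (fun p => bareissU p.2 t k j) highPrecision (𝓝 (schurU t k j)) := by
  have hσ := (schurU_diag_pos hT hk).ne'
  have h := ((tendsto_bareissGen hT k hk).1 j).div (tendsto_bareissGen_diag_sqrt hT hk) hσ
  rwa [mul_div_cancel_left₀ _ hσ] at h

theorem tendsto_bareissV (hT : (toeplitz n t).PosDef) {k : ℕ} (hk : k < n) (j : ℕ) :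
    Tendsto (fun p => bareissV p.2 t k j) highPrecision (𝓝 (schurV t k j)) := by
  have hσ := (schurU_diag_pos hT hk).ne'
  have h := ((tendsto_bareissGen hT k hk).2 j).div (tendsto_bareissGen_diag_sqrt hT hk) hσ
  rwa [mul_div_cancel_left₀ _ hσ] at h

theorem tendsto_bareissSin (hT : (toeplitz n t).PosDef) {k : ℕ} (hk : k < n) :
    Tendsto (fun p => bareissSin p.2 t k) highPrecision (𝓝 (schurSin t k)) := by
  have hσ := schurU_diag_pos hT hk
  obtain ⟨hu, hv⟩ := tendsto_bareissGen hT k hk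
  have h := tendsto_floatDiv (hv (k + 1)) (hu k) (by positivity)
  rwa [mul_div_mul_left _ _ hσ.ne', schurV_pivot hT hk, mul_div_assoc, div_self hσ.ne',
    mul_one] at h

theorem schurU_succ_diag (hT : (toeplitz n t).PosDef) {k : ℕ} (hk : k + 1 < n) :
    schurU t (k + 1) (k + 1) = schurCos t k * schurU t k k := by
  have hc := schurCos_pos hT hk
  rw [schurU_succ, schurV_pivot hT (by omega), Downdating.shiftDown]
  field_simp
  rw [schurCos_sq hT hk]
  ring

theorem tendsto_bareissCos (hT : (toeplitz n t).PosDef) {k : ℕ} (hk : k + 1 < n) :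
    Tendsto (fun p => bareissCos p.2 t k) highPrecision (𝓝 (schurCos t k)) := by
  have hσ := schurU_diag_pos hT (k := k) (by omega)
  have h := (((tendsto_bareissGen hT (k + 1) hk).1 (k + 1)).div
    ((tendsto_bareissGen hT k (by omega)).1 k) (by positivity)).sqrt
  have e : schurU t (k + 1) (k + 1) * schurU t (k + 1) (k + 1) / (schurU t k k * schurU t k k) =
      schurCos t k * schurCos t k := by
    rw [schurU_succ_diag hT hk]
    field_simp
  rwa [e, Real.sqrt_mul_self (schurCos_pos hT hk).le] at h

theorem eventually_bareissGen_diag_pos (hT : (toeplitz n t).PosDef) :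
    ∀ᶠ p in highPrecision, ∀ k, k < n → 0 < (bareissGen p.2 t k).1 k := by
  have h : ∀ᶠ p in highPrecision, ∀ k ∈ Finset.range n, 0 < (bareissGen p.2 t k).1 k := by
    rw [eventually_all_finset]
    intro k hk
    have hk := Finset.mem_range.mp hk
    have hσ := schurU_diag_pos hT hk
    exact ((tendsto_bareissGen hT k hk).1 k).eventually_const_lt (by positivity)
  filter_upwards [h] with p hp k hk using hp k (Finset.mem_range.mpr hk)

theorem eventually_bareiss_norm_le (hT : (toeplitz n t).PosDef) :
    ∀ᶠ p in highPrecision,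
      ‖toeplitz n t - (Matrix.of fun k j : Fin n => bareissU p.2 t k j)ᵀ *
        (Matrix.of fun k j : Fin n => bareissU p.2 t k j)‖ ≤
        5000 * (p.1 * t 0 * (n : ℝ) ^ 4) := by
  rcases Nat.eq_zero_or_pos n with rfl | hn
  · refine Eventually.of_forall fun p => ?_
    rw [Subsingleton.elim (toeplitz 0 t - _) 0, norm_zero]
    simp
  have ht := toeplitz_zero_pos hT hn
  have hn' : (1 : ℝ) ≤ n := by exact_mod_cast hn
  -- The scale `l = 1` leaves a factor `n²` in the weights, and `9 + 3600 n² < 5000 n²`.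
  have key := eventually_norm_toeplitz_sub_le (n := n) (t := t)
    (u := fun p => bareissU p.2 t) (v := fun p => bareissV p.2 t)
    (r := fun p => weightCons (3 * √(t 0)) fun k j => hyperbolicWeight 1 (bareissCos p.2 t k)
      (shiftDown (bareissU p.2 t k) j) (bareissV p.2 t k j) (bareissU p.2 t (k + 1) j)
      (bareissV p.2 t (k + 1) j))
    (r₀ := weightCons (3 * √(t 0)) fun k j => hyperbolicWeight 1 (schurCos t k)
      (shiftDown (schurU t k) j) (schurV t k j) (schurU t (k + 1) j) (schurV t (k + 1) j))
    (M := 5000 * n ^ 2 * (n * t 0)) ?_ ?_ ?_ ?_ ?_ ?_ ?_ ?_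
  · filter_upwards [key] with p hp
    exact hp.trans_eq (by ring)
  · intro k hk j _
    cases k with
    | zero => exact tendsto_const_nhds
    | succ k =>
      have hx := tendsto_shiftDown (fun j => tendsto_bareissU hT (k := k) (by omega) j) j
      have hy := tendsto_bareissV hT (k := k) (by omega) j
      have hu' := tendsto_bareissU hT hk j
      have hv' := tendsto_bareissV hT hk j
      have hc := schurCos_pos hT hk
      exact ((hu'.abs.add hv'.abs).const_mul 5).add
        ((((hx.abs.add hy.abs).const_mul 1).add
        ((hu'.abs.add hv'.abs).div ((tendsto_bareissCos hT hk).const_mul 1)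
          (by positivity))).const_mul 5)
  · refine (sum_weightCons_sq_le hT hn (B := 1800 * n ^ 2) (by positivity)
      fun k hk => (sum_hyperbolicWeight_le hT hk (Or.inl rfl)).trans_eq ?_).trans_lt ?_
    · ring
    · gcongr
      have := one_le_pow₀ hn' (n := 2)
      linarith
  · intro p k j hj
    simp [bareissU, bareissGen_fst_eq_zero p.2 t hj]
  · intro p k j hj
    simp [bareissV, bareissGen_snd_eq_zero p.2 t hj]
  · refine Eventually.of_forall fun p k j => ?_
    cases k with
    | zero => simp only [weightCons]; positivity
    | succ k =>
      simp only [weightCons, hyperbolicWeight, bareissCos]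
      positivity
  · filter_upwards [eventually_precision_pos] with p hp j _
    have e : bareissU p.2 t 0 0 * bareissU p.2 t 0 j - t j = 0 := by
      simp only [bareissU, bareissGen]
      have := Real.mul_self_sqrt ht.le
      rw [div_mul_div_comm, this, mul_div_cancel_left₀ _ ht.ne', sub_self]
    rw [e, abs_zero]
    simp only [weightCons]
    positivity
  · intro p j hj
    simp [bareissU, bareissV, bareissGen, hj.ne']
  · have h : ∀ᶠ p in highPrecision, ∀ k ∈ Finset.range (n - 1),
        |bareissSin p.2 t k| ≤ 1 ∧ 50 * p.1 ≤ bareissCos p.2 t k ^ 2 := by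
      rw [eventually_all_finset]
      intro k hk
      have hk : k + 1 < n := by have := Finset.mem_range.mp hk; omega
      have hc0 := schurCos_pos hT hk
      have hε : Tendsto (fun p : Σ ε : ℝ, FloatArith ε => 50 * p.1) highPrecision (𝓝 0) := by
        simpa using tendsto_precision_zero.const_mul 50
      filter_upwards [((tendsto_bareissSin hT (k := k) (by omega)).abs).eventually_lt_const
          ((sq_lt_one_iff_abs_lt_one _).mp (schurSin_sq_lt hT hk)),
        hε.eventually_lt ((tendsto_bareissCos hT hk).pow 2) (by positivity)] with p a b
      exact ⟨a.le, b.le⟩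
    filter_upwards [h, eventually_bareissGen_diag_pos hT, eventually_precision_pos,
      eventually_precision_lt (δ := 1 / 100) (by norm_num)] with p h1 h2 h3 h4 k hk i j
    obtain ⟨a, b⟩ := h1 k (Finset.mem_range.mpr (by omega))
    exact bareiss_displacement p.2 t k h3.le h4.le (h2 k (by omega)) (h2 (k + 1) hk) a b i j

theorem toeplitz_zero_le_norm (hn : 0 < n) : t 0 ≤ ‖toeplitz n t‖ := by
  set i : Fin n := ⟨0, hn⟩
  have h := Matrix.l2_opNorm_mulVec (toeplitz n t) (EuclideanSpace.single i 1)
  rw [PiLp.norm_single, norm_one, mul_one] at h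
  refine le_trans ?_ ((PiLp.norm_apply_le _ i).trans h)
  have e : toeplitz n t i i = t 0 := by simp [toeplitz, Nat.dist_self]
  simp [Matrix.mulVec_single, e, le_abs_self]

end BareissBound

/-! ### Componentwise residuals of triangular substitution. -/

section Substitution

variable {ε : ℝ} (F : FloatArith ε)

theorem subDot_congr {b : ℝ} {a y y' : ℕ → ℝ} {m : ℕ} (h : ∀ j < m, y j = y' j) :
    subDot F b a y m = subDot F b a y' m := by
  induction m with
  | zero => rfl
  | succ m ih =>
    simp only [subDot]
    rw [ih fun j hj => h j (by omega), h m (by omega)]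

/-- The error is measured against the products and the final value, not `b`, because the final value
is what the subsequent division turns into the diagonal term. The recursion closes since the
previous partial value is the new one plus the product, up to `O(ε)`. -/
theorem subDot_err (h0 : 0 ≤ ε) (h1 : ε ≤ 1 / 100) (b : ℝ) (a y : ℕ → ℝ) (m : ℕ)
    (hm : 6 * m * ε ≤ 1) :
    |b - subDot F b a y m - ∑ j ∈ Finset.range m, a j * y j| ≤
      3 * m * ε * (∑ j ∈ Finset.range m, |a j * y j| + |subDot F b a y m|) := by
  induction m with
  | zero => simp [subDot]
  | succ m ih =>
    push_cast at hm ⊢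
    have ih := ih (by linarith)
    have hd : subDot F b a y (m + 1) = F.sub (subDot F b a y m) (F.mul (a m) (y m)) := rfl
    have e1 := F.mul_err (a m) (y m)
    have e2 := F.sub_err (subDot F b a y m) (F.mul (a m) (y m))
    rw [← hd] at e2
    rw [Finset.sum_range_succ, Finset.sum_range_succ]
    set S := subDot F b a y m
    set S' := subDot F b a y (m + 1)
    set P := F.mul (a m) (y m)
    set z := a m * y m
    set A := ∑ j ∈ Finset.range m, |a j * y j|
    set R := ∑ j ∈ Finset.range m, a j * y j
    have hA : 0 ≤ A := Finset.sum_nonneg fun _ _ => abs_nonneg _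
    have e3 : |S - P| ≤ 2 * |S'| := by
      have h2 : |S - P| ≤ |S'| + |S' - (S - P)| := by
        calc |S - P| = |S' - (S' - (S - P))| := by ring_nf
          _ ≤ _ := abs_sub _ _
      have h3 : ε * |S - P| ≤ 1 / 100 * |S - P| := by gcongr
      linarith [abs_nonneg S']
    have e4 : |S - S' - z| ≤ 2 * ε * |S'| + ε * |z| := by
      have h2 : S - S' - z = (P - z) - (S' - (S - P)) := by ring
      have h3 : ε * |S - P| ≤ ε * (2 * |S'|) := by gcongr
      rw [h2]
      refine (abs_sub _ _).trans ?_
      linarith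
    have e5 : |S| ≤ |S'| + |z| + |S - S' - z| := by
      calc |S| = |S' + z + (S - S' - z)| := by ring_nf
        _ ≤ |S' + z| + |S - S' - z| := abs_add_le _ _
        _ ≤ _ := by gcongr; exact abs_add_le _ _
    have e6 : |b - S' - (R + z)| ≤ 3 * m * ε * (A + |S|) + (2 * ε * |S'| + ε * |z|) := by
      have : b - S' - (R + z) = (b - S - R) + (S - S' - z) := by ring
      rw [this]
      exact (abs_add_le _ _).trans (add_le_add ih e4)
    have e7 : |S| ≤ (1 + 2 * ε) * (|S'| + |z|) := by
      linarith [mul_nonneg h0 (abs_nonneg z)]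
    have hmε : 0 ≤ 3 * m * ε := by positivity
    have e8 : 3 * m * ε * |S| ≤ 3 * m * ε * ((1 + 2 * ε) * (|S'| + |z|)) := by gcongr
    have e9 : 6 * m * ε * (ε * (|S'| + |z|)) ≤ 1 * (ε * (|S'| + |z|)) := by
      gcongr
      linarith
    have e10 : 0 ≤ ε * A := mul_nonneg h0 hA
    linarith [mul_nonneg h0 (abs_nonneg z), mul_nonneg h0 (abs_nonneg S')]

theorem forwardSub_stable (L : ℕ → ℕ → ℝ) (b : ℕ → ℝ) {i m : ℕ} (hi : i < m) :
    forwardSub F L b m i = forwardSub F L b (i + 1) i := by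
  induction m with
  | zero => omega
  | succ m ih =>
    rcases Nat.lt_succ_iff_lt_or_eq.mp hi with h | rfl
    · rw [← ih h]
      simp only [forwardSub]
      rw [Function.update_of_ne (by omega)]
    · rfl

/-- Later steps leave earlier components alone, so the recursion may be read off from the final
vector. -/
theorem forwardSub_apply (L : ℕ → ℕ → ℝ) (b : ℕ → ℝ) {m n : ℕ} (hm : m < n) :
    forwardSub F L b n m =
      F.div (subDot F (b m) (L m) (forwardSub F L b n) m) (L m m) := by
  rw [forwardSub_stable F L b hm]
  simp only [forwardSub, Function.update_self]
  rw [subDot_congr F fun j hj => ?_]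
  rw [forwardSub_stable F L b hj, forwardSub_stable F L b (hj.trans hm)]

theorem forwardSub_err (h0 : 0 ≤ ε) (h1 : ε ≤ 1 / 100) {n : ℕ} (hn : 6 * n * ε ≤ 1)
    {L : ℕ → ℕ → ℝ} (b : ℕ → ℝ) (hdiag : ∀ m < n, L m m ≠ 0)
    (htri : ∀ m j, m < j → j < n → L m j = 0) {m : ℕ} (hm : m < n) :
    |b m - ∑ j ∈ Finset.range n, L m j * forwardSub F L b n j| ≤
      (6 * n + 2) * ε * ∑ j ∈ Finset.range n, |L m j * forwardSub F L b n j| := by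
  have hcut : ∀ f : ℕ → ℝ, (∀ j, m < j → j < n → f j = 0) →
      ∑ j ∈ Finset.range n, f j = ∑ j ∈ Finset.range m, f j + f m := by
    intro f hf
    rw [← Finset.sum_range_succ]
    refine (Finset.sum_subset (Finset.range_subset_range.mpr hm) fun j hj hj' => ?_).symm
    simp only [Finset.mem_range] at hj hj'
    exact hf j (by omega) hj
  rw [hcut _ fun j h h' => by rw [htri m j h h', zero_mul],
    hcut _ fun j h h' => by rw [htri m j h h', zero_mul, abs_zero]]
  have hmn : (m : ℝ) ≤ n := by exact_mod_cast hm.le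
  have hx := forwardSub_apply F L b hm
  set y := forwardSub F L b n
  have hmε : 6 * (m : ℝ) * ε ≤ 6 * n * ε := by gcongr
  have e1 := subDot_err F h0 h1 (b m) (L m) y m (hmε.trans hn)
  set S := subDot F (b m) (L m) y m
  set A := ∑ j ∈ Finset.range m, |L m j * y j|
  have hA : 0 ≤ A := Finset.sum_nonneg fun _ _ => abs_nonneg _
  have e2 := abs_pivot_err F (y := S) (hdiag m hm)
  rw [← hx, mul_comm (y m)] at e2
  set z := L m m * y m
  have e3 : |S| ≤ 2 * |z| := by
    have h2 : |S| ≤ |z| + |S - z| := by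
      calc |S| = |z + (S - z)| := by ring_nf
        _ ≤ _ := abs_add_le _ _
    have h3 : ε * |S| ≤ 1 / 100 * |S| := by gcongr
    linarith [abs_nonneg z]
  have e4 : b m - (∑ j ∈ Finset.range m, L m j * y j + z) =
      (b m - S - ∑ j ∈ Finset.range m, L m j * y j) + (S - z) := by ring
  have e5 : ε * |S| ≤ ε * (2 * |z|) := by gcongr
  rw [e4]
  calc |(b m - S - ∑ j ∈ Finset.range m, L m j * y j) + (S - z)|
      ≤ 3 * m * ε * (A + |S|) + ε * |S| := (abs_add_le _ _).trans (add_le_add e1 e2)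
    _ ≤ 3 * n * ε * (A + 2 * |z|) + ε * (2 * |z|) := by gcongr
    _ ≤ (6 * n + 2) * ε * (A + |z|) := by
      have h2 : 0 ≤ n * ε * A := by positivity
      have h3 : 0 ≤ ε * A := by positivity
      linarith

theorem backSub_err (h0 : 0 ≤ ε) (h1 : ε ≤ 1 / 100) {n : ℕ} (hn : 6 * n * ε ≤ 1)
    {U : ℕ → ℕ → ℝ} (b : ℕ → ℝ) (hdiag : ∀ m < n, U m m ≠ 0)
    (htri : ∀ m j, j < m → m < n → U m j = 0) {i : ℕ} (hi : i < n) :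
    |b i - ∑ j ∈ Finset.range n, U i j * backSub F n U b j| ≤
      (6 * n + 2) * ε * ∑ j ∈ Finset.range n, |U i j * backSub F n U b j| := by
  have h := forwardSub_err F h0 h1 hn (L := fun r c => U (n - 1 - r) (n - 1 - c))
    (fun r => b (n - 1 - r)) (fun m hm => hdiag _ (by omega))
    (fun m j hmj hj => htri _ _ (by omega) (by omega)) (m := n - 1 - i) (by omega)
  have hi' : n - 1 - (n - 1 - i) = i := by omega
  simp only [hi'] at h
  rw [← Finset.sum_range_reflect (fun j => U i j * backSub F n U b j),
    ← Finset.sum_range_reflect (fun j => |U i j * backSub F n U b j|)]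
  have e : ∀ j ∈ Finset.range n, backSub F n U b (n - 1 - j) =
      forwardSub F (fun r c => U (n - 1 - r) (n - 1 - c)) (fun r => b (n - 1 - r)) n j := by
    intro j hj
    have hj := Finset.mem_range.mp hj
    rw [backSub, show n - 1 - (n - 1 - j) = j by omega]
  have e' : ∀ j ∈ Finset.range n, U i (n - 1 - j) * backSub F n U b (n - 1 - j) =
      U i (n - 1 - j) *
        forwardSub F (fun r c => U (n - 1 - r) (n - 1 - c)) (fun r => b (n - 1 - r)) n j :=
    fun j hj => by rw [e j hj]
  rw [Finset.sum_congr rfl e', Finset.sum_congr rfl fun j hj => congrArg abs (e' j hj)]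
  exact h

end Substitution

/-! ### The residual of two consecutive triangular solves. -/

section Residual

variable {n : ℕ}

/-- Cauchy–Schwarz row by row: taking absolute values of the entries does not change the Frobenius
norm. -/
theorem norm_le_of_abs_le_mul_sum {A : Matrix (Fin n) (Fin n) ℝ} {M κ : ℝ} (hκ : 0 ≤ κ)
    (hA : ∑ i, ∑ j, A i j ^ 2 ≤ M) {w x : EuclideanSpace ℝ (Fin n)}
    (h : ∀ i, |w i| ≤ κ * ∑ j, |A i j * x j|) : ‖w‖ ≤ κ * (√M * ‖x‖) := by
  have hM : 0 ≤ M := le_trans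
    (Finset.sum_nonneg fun i _ => Finset.sum_nonneg fun j _ => sq_nonneg _) hA
  refine abs_le_of_sq_le_sq' ?_ (by positivity) |>.2
  rw [mul_pow, mul_pow, Real.sq_sqrt hM, EuclideanSpace.norm_sq_eq w]
  have hi : ∀ i, ‖w i‖ ^ 2 ≤ κ ^ 2 * ((∑ j, A i j ^ 2) * ‖x‖ ^ 2) := by
    intro i
    have h1 : ‖w i‖ ^ 2 ≤ (κ * ∑ j, |A i j * x j|) ^ 2 :=
      pow_le_pow_left₀ (norm_nonneg _) (h i) 2
    have h2 := Finset.sum_mul_sq_le_sq_mul_sq Finset.univ (fun j => |A i j|) (fun j => |x j|)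
    simp only [← abs_mul, sq_abs] at h2
    rw [EuclideanSpace.norm_sq_eq x]
    simp only [Real.norm_eq_abs, sq_abs] at h1 ⊢
    refine h1.trans ?_
    rw [mul_pow]
    gcongr
  refine (Finset.sum_le_sum fun i _ => hi i).trans ?_
  rw [← Finset.mul_sum, ← Finset.sum_mul]
  gcongr

/-- Residual of two triangular solves with small componentwise residuals. -/
theorem norm_residual_le {A T : Matrix (Fin n) (Fin n) ℝ} {M κ ρ : ℝ} (hκ : 0 ≤ κ)
    (hκ1 : κ ≤ 1) (hA : ∑ i, ∑ j, A i j ^ 2 ≤ M) (hT : ‖T - Aᵀ * A‖ ≤ ρ)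
    {b y x : EuclideanSpace ℝ (Fin n)}
    (hy : ∀ i, |b i - ∑ j, A j i * y j| ≤ κ * ∑ j, |A j i * y j|)
    (hx : ∀ i, |y i - ∑ j, A i j * x j| ≤ κ * ∑ j, |A i j * x j|) :
    ‖WithLp.toLp 2 (T *ᵥ x.ofLp) - b‖ ≤ (ρ + 3 * κ * M) * ‖x‖ := by
  have hM : 0 ≤ M := le_trans
    (Finset.sum_nonneg fun i _ => Finset.sum_nonneg fun j _ => sq_nonneg _) hA
  have hA' : ∑ i, ∑ j, Aᵀ i j ^ 2 ≤ M := by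
    rw [Finset.sum_comm]
    exact hA
  set z : EuclideanSpace ℝ (Fin n) := WithLp.toLp 2 (A *ᵥ x.ofLp) with hz
  have h1 : ‖z‖ ≤ 1 * (√M * ‖x‖) := by
    refine norm_le_of_abs_le_mul_sum zero_le_one hA fun i => ?_
    rw [one_mul]
    exact Finset.abs_sum_le_sum_abs (fun j => A i j * x j) Finset.univ
  have h2 : ‖y - z‖ ≤ κ * (√M * ‖x‖) := norm_le_of_abs_le_mul_sum hκ hA hx
  -- The intermediate vector is bounded through `A x`, not through `b`, so no inverse of a factor
  -- appears.
  have h3 : ‖y‖ ≤ 2 * (√M * ‖x‖) := by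
    have e : y = z + (y - z) := by abel
    have h : κ * (√M * ‖x‖) ≤ 1 * (√M * ‖x‖) := by gcongr
    rw [e]
    refine (norm_add_le _ _).trans ?_
    linarith
  have h4 : ‖b - WithLp.toLp 2 (Aᵀ *ᵥ y.ofLp)‖ ≤ κ * (√M * ‖y‖) :=
    norm_le_of_abs_le_mul_sum hκ hA' hy
  have h5 : ‖(WithLp.toLp 2 (Aᵀ *ᵥ (y - z).ofLp) : EuclideanSpace ℝ (Fin n))‖ ≤
      1 * (√M * ‖y - z‖) := by
    refine norm_le_of_abs_le_mul_sum zero_le_one hA' fun i => ?_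
    rw [one_mul]
    exact Finset.abs_sum_le_sum_abs (fun j => Aᵀ i j * (y - z) j) Finset.univ
  have h6 : ‖(WithLp.toLp 2 ((T - Aᵀ * A) *ᵥ x.ofLp) : EuclideanSpace ℝ (Fin n))‖ ≤ ρ * ‖x‖ :=
    (Matrix.l2_opNorm_mulVec (T - Aᵀ * A) x).trans
      (mul_le_mul_of_nonneg_right hT (norm_nonneg _))
  -- The residual splits into the errors of the factorization, the forward solve and the back solve.
  have e : WithLp.toLp 2 (T *ᵥ x.ofLp) - b = WithLp.toLp 2 ((T - Aᵀ * A) *ᵥ x.ofLp) -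
      (b - WithLp.toLp 2 (Aᵀ *ᵥ y.ofLp)) - WithLp.toLp 2 (Aᵀ *ᵥ (y - z).ofLp) := by
    ext i
    simp only [hz, PiLp.sub_apply, Matrix.sub_mulVec, WithLp.ofLp_sub, Matrix.mulVec_sub,
      Matrix.mulVec_mulVec, Pi.sub_apply]
    ring
  have hMs : √M * √M = M := Real.mul_self_sqrt hM
  have h7 : κ * (√M * ‖y‖) ≤ κ * (√M * (2 * (√M * ‖x‖))) := by gcongr
  have h8 : 1 * (√M * ‖y - z‖) ≤ √M * (κ * (√M * ‖x‖)) := by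
    rw [one_mul]
    gcongr
  rw [e]
  refine (norm_sub_le _ _).trans ((add_le_add (norm_sub_le _ _) h5).trans ?_)
  have e1 : κ * (√M * (2 * (√M * ‖x‖))) + √M * (κ * (√M * ‖x‖)) = 3 * κ * M * ‖x‖ := by
    linear_combination (3 * κ * ‖x‖) * hMs
  linarith

end Residual

/-! ### Backward stability of the solvers. -/

section Solvers

open Filter Topology

variable {n : ℕ} {t : ℕ → ℝ}

/-- The squared Frobenius norm tends to the trace `n t₀`; the factor 2 is slack. -/
theorem eventually_sum_sq_le (hT : (toeplitz n t).PosDef) (hn : 0 < n)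
    {u : (Σ ε : ℝ, FloatArith ε) → ℕ → ℕ → ℝ}
    (hu : ∀ k < n, ∀ j, Tendsto (fun p => u p k j) highPrecision (𝓝 (schurU t k j))) :
    ∀ᶠ p in highPrecision, ∑ k : Fin n, ∑ j : Fin n, u p k j ^ 2 ≤ 2 * (n * t 0) := by
  have ht := toeplitz_zero_pos hT hn
  have h : Tendsto (fun p => ∑ k ∈ Finset.range n, ∑ j ∈ Finset.range n, u p k j ^ 2)
      highPrecision (𝓝 (n * t 0)) := by
    rw [← sum_sum_schurU_sq hT]
    exact tendsto_finsetSum _ fun k hk => tendsto_finsetSum _ fun j _ =>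
      (hu k (Finset.mem_range.mp hk) j).pow 2
  have hnt : 0 < (n : ℝ) * t 0 := by positivity
  filter_upwards [h.eventually_lt_const (show (n : ℝ) * t 0 < 2 * (n * t 0) by linarith)]
    with p hp
  simp only [Finset.sum_range] at hp
  exact hp.le

theorem eventually_mul_precision_le (a : ℝ) : ∀ᶠ p in highPrecision, a * p.1 ≤ 1 := by
  have h : Tendsto (fun p : Σ ε : ℝ, FloatArith ε => a * p.1) highPrecision (𝓝 0) := by
    simpa using tendsto_precision_zero.const_mul a
  filter_upwards [h.eventually_lt_const one_pos] with p hp using hp.le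

theorem backwardStable_of_eventually
    {solve : ∀ {ε : ℝ}, FloatArith ε → (n : ℕ) → (ℕ → ℝ) →
      EuclideanSpace ℝ (Fin n) → EuclideanSpace ℝ (Fin n)} (c : Polynomial ℝ)
    (hc : ∀ n : ℕ, 0 ≤ c.eval (n : ℝ))
    (h : ∀ (n : ℕ) (t : ℕ → ℝ), (toeplitz n t).PosDef → 0 < n → ∀ᶠ p in highPrecision,
      ∀ b : EuclideanSpace ℝ (Fin n),
        ‖WithLp.toLp 2 (toeplitz n t *ᵥ (solve p.2 n t b).ofLp) - b‖ ≤
          c.eval (n : ℝ) * p.1 * t 0 * ‖solve p.2 n t b‖) :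
    BackwardStable solve := by
  refine ⟨c, fun n t hT => ?_⟩
  refine exists_precision_of_eventually (P := fun ε F => ∀ b : EuclideanSpace ℝ (Fin n),
    ‖WithLp.toLp 2 (toeplitz n t *ᵥ (solve F n t b).ofLp) - b‖ ≤
      c.eval (n : ℝ) * ε * ‖toeplitz n t‖ * ‖solve F n t b‖) ?_
  rcases Nat.eq_zero_or_pos n with rfl | hn
  · refine Eventually.of_forall fun p b => ?_
    rw [Subsingleton.elim (WithLp.toLp 2 _ - b) 0, Subsingleton.elim (solve _ _ _ _) 0]
    simp
  · filter_upwards [h n t hT hn, eventually_precision_pos] with p hp h0 b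
    refine (hp b).trans ?_
    have h1 := toeplitz_zero_le_norm (t := t) hn
    have h2 := mul_nonneg (hc n) h0.le
    gcongr

theorem factorSolve_backwardStable (rule : Downdating) :
    BackwardStable (fun {_} F => factorSolve rule F) := by
  -- The cubic term bounds the factorization error for every rule. The rest is `3 κ M` with `κ = (6n
  -- + 2) ε` and `M = 2 n t₀`.
  refine backwardStable_of_eventually
    (5000 * Polynomial.X ^ 3 + 6 * Polynomial.X * (6 * Polynomial.X + 2))
    (fun n => by simp; positivity) ?_
  intro n t hT hn
  have ht := toeplitz_zero_pos hT hn
  have hn' : (1 : ℝ) ≤ n := by exact_mod_cast hn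
  have hnorm : ∀ᶠ p in highPrecision,
      ‖toeplitz n t - (factor p.2 rule n t)ᵀ * factor p.2 rule n t‖ ≤
        5000 * (p.1 * t 0 * (n : ℝ) ^ 3) := by
    have hmixed : rule = .mixedV ∨ rule = .mixedU → ∀ᶠ p in highPrecision,
        ‖toeplitz n t - (factor p.2 rule n t)ᵀ * factor p.2 rule n t‖ ≤
          5000 * (p.1 * t 0 * (n : ℝ) ^ 3) := by
      intro hrule
      filter_upwards [eventually_mixed_norm_le hT rule hrule, eventually_precision_pos]
        with p hp h0
      refine hp.trans ?_
      have hpow : (n : ℝ) ^ 2 ≤ (n : ℝ) ^ 3 := pow_le_pow_right₀ hn' (by norm_num)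
      gcongr
    cases rule with
    | hyperbolic => exact eventually_hyperbolic_norm_le hT
    | mixedV => exact hmixed (Or.inl rfl)
    | mixedU => exact hmixed (Or.inr rfl)
  filter_upwards [hnorm, eventually_precision_pos,
    eventually_precision_lt (δ := 1 / 100) (by norm_num),
    eventually_mul_precision_le (6 * n), eventually_mul_precision_le (6 * n + 2),
    eventually_factor_diag_pos hT rule,
    eventually_sum_sq_le hT hn (u := fun p => factorRows p.2 rule t)
      fun k hk j => (tendsto_factorPair rule hT k hk).1 j] with p h1 h2 h3 h4 h5 h6 h7 b
  have hdiag : ∀ m < n, factorRows p.2 rule t m m ≠ 0 := fun m hm => (h6 ⟨m, hm⟩).ne'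
  have htri : ∀ m j, j < m → factorRows p.2 rule t m j = 0 := fun m j h =>
    factorPair_fst_eq_zero p.2 rule t h
  have key := norm_residual_le (κ := (6 * n + 2) * p.1) (by positivity) h5 h7 h1 (b := b)
    (y := WithLp.toLp 2 fun i : Fin n =>
      forwardSub p.2 (fun i j => factorRows p.2 rule t j i) (extendZero b) n i)
    (x := factorSolve rule p.2 n t b) (fun i => by
      have h := forwardSub_err p.2 h2.le h3.le h4 (L := fun i j => factorRows p.2 rule t j i)
        (extendZero b) hdiag (fun m j hmj _ => htri j m hmj) i.2
      simp only [Finset.sum_range, extendZero, i.2, dite_true] at h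
      exact h) (fun i => by
      have h := backSub_err p.2 h2.le h3.le h4 (U := factorRows p.2 rule t)
        (forwardSub p.2 (fun i j => factorRows p.2 rule t j i) (extendZero b) n) hdiag
        (fun m j hmj _ => htri m j hmj) i.2
      simp only [Finset.sum_range] at h
      exact h)
  refine key.trans_eq ?_
  simp
  left
  ring

/-- The componentwise residual bounds are invariant under diagonal scaling, so the two solves are
analysed as solves with `D^{-1/2} W` and intermediate vector `D^{1/2} y`. The rounding of `D y`
raises `6n + 2` to `6n + 6`. -/
theorem bareissSolve_backwardStable : BackwardStable (fun {_} F => bareissSolve F) := by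
  refine backwardStable_of_eventually
    (5000 * Polynomial.X ^ 4 + 6 * Polynomial.X * (6 * Polynomial.X + 6))
    (fun n => by simp; positivity) ?_
  intro n t hT hn
  have ht := toeplitz_zero_pos hT hn
  filter_upwards [eventually_bareiss_norm_le hT, eventually_precision_pos,
    eventually_precision_lt (δ := 1 / 100) (by norm_num),
    eventually_mul_precision_le (6 * n), eventually_mul_precision_le (6 * n + 6),
    eventually_bareissGen_diag_pos hT,
    eventually_sum_sq_le hT hn (u := fun p => bareissU p.2 t)
      fun k hk j => tendsto_bareissU hT hk j] with p h1 h2 h3 h4 h5 h6 h7 b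
  have hrow : ∀ r c, r < n → c < n →
      bareissRows p.2 n t r c = √((bareissGen p.2 t r).1 r) * bareissU p.2 t r c := by
    intro r c hr hc
    have := Real.sqrt_pos.mpr (h6 r hr)
    rw [bareissRows_eq p.2 t hr hc, bareissU]
    field_simp
  have hdiag : ∀ m < n, bareissRows p.2 n t m m ≠ 0 := by
    intro m hm
    rw [bareissRows_eq p.2 t hm hm]
    exact (h6 m hm).ne'
  have htri : ∀ m j, j < m → m < n → bareissRows p.2 n t m j = 0 := by
    intro m j hj hm
    rw [bareissRows_eq p.2 t hm (hj.trans hm)]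
    exact bareissGen_fst_eq_zero p.2 t hj
  set y := forwardSub p.2 (fun i j => bareissRows p.2 n t j i) (extendZero b) n with hy
  have key := norm_residual_le (κ := (6 * n + 6) * p.1) (by positivity) h5 h7 h1 (b := b)
    (y := WithLp.toLp 2 fun i : Fin n => √((bareissGen p.2 t i).1 i) * y i)
    (x := bareissSolve p.2 n t b) (fun i => by
      have h := forwardSub_err p.2 h2.le h3.le h4 (L := fun i j => bareissRows p.2 n t j i)
        (extendZero b) hdiag (fun m j hmj hj => htri j m hmj hj) i.2
      rw [← hy] at h
      have e : ∀ j ∈ Finset.range n, bareissRows p.2 n t j i * y j =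
          bareissU p.2 t j i * (√((bareissGen p.2 t j).1 j) * y j) := by
        intro j hj
        rw [hrow j i (Finset.mem_range.mp hj) i.2]
        ring
      rw [Finset.sum_congr rfl e, Finset.sum_congr rfl fun j hj => congrArg abs (e j hj)] at h
      simp only [Finset.sum_range, extendZero, i.2, dite_true] at h
      refine h.trans ?_
      have := h2.le
      gcongr
      norm_num) (fun i => by
      have h := backSub_err p.2 h2.le h3.le h4 (U := bareissRows p.2 n t)
        (fun k => p.2.mul (bareissRows p.2 n t k k) (y k)) hdiag htri i.2
      set x := bareissSolve p.2 n t b with hx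
      have hxj : ∀ j : Fin n, backSub p.2 n (bareissRows p.2 n t)
          (fun k => p.2.mul (bareissRows p.2 n t k k) (y k)) j = x j := fun j => rfl
      simp only [Finset.sum_range, hxj, hrow i _ i.2 (Fin.is_lt _)] at h
      have hw := Real.sqrt_pos.mpr (h6 i i.2)
      have hww := Real.mul_self_sqrt (h6 i i.2).le
      have hmul := p.2.mul_err (bareissRows p.2 n t i i) (y i)
      rw [bareissRows_eq p.2 t i.2 i.2] at hmul
      have hd : bareissU p.2 t i i = √((bareissGen p.2 t i).1 i) := by
        rw [bareissU, Real.div_sqrt]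
      rw [hd, hww] at h
      simp only [mul_assoc, abs_mul (√((bareissGen p.2 t i).1 i)), abs_of_pos hw,
        ← Finset.mul_sum] at h
      change |√((bareissGen p.2 t i).1 i) * y i - ∑ j : Fin n, bareissU p.2 t i j * x j| ≤
        (6 * n + 6) * p.1 * ∑ j : Fin n, |bareissU p.2 t i j * x j|
      set w := √((bareissGen p.2 t i).1 i)
      set z := p.2.mul ((bareissGen p.2 t i).1 i) (y i)
      set R := ∑ j : Fin n, bareissU p.2 t i j * x j with hR
      set B := ∑ j : Fin n, |bareissU p.2 t i j * x j|
      have hRB : |R| ≤ B := Finset.abs_sum_le_sum_abs _ _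
      have hB : 0 ≤ B := (abs_nonneg _).trans hRB
      -- Row `i` of `W` is `w` times that of `D^{-1/2} W`, so dividing the residual by `w` compares
      -- `R` with `z / w`, where `z` is the computed entry of `D y`.
      have e1 : |z / w - R| ≤ (6 * n + 2) * p.1 * B := by
        have e : z / w - R = (z - w * R) / w := by field_simp
        rw [e, abs_div, abs_of_pos hw, div_le_iff₀ hw]
        refine h.trans_eq ?_
        ring
      have e2 : |z / w - w * y i| ≤ p.1 * |w * y i| := by
        have e : z / w - w * y i = (z - (bareissGen p.2 t i).1 i * y i) / w := by
          rw [← hww]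
          field_simp
        rw [e, abs_div, abs_of_pos hw, div_le_iff₀ hw]
        refine hmul.trans_eq ?_
        rw [← hww, abs_mul, abs_mul, abs_mul, abs_of_pos hw]
        ring
      set Y := w * y i
      have hκ : (6 * n + 2) * p.1 * B ≤ 1 * B := by
        gcongr
        linarith
      have e3 : |z / w| ≤ 2 * B := by
        have : |z / w| ≤ |R| + |z / w - R| := by
          calc |z / w| = |R + (z / w - R)| := by ring_nf
            _ ≤ _ := abs_add_le _ _
        linarith
      have e4 : |Y| ≤ 4 * B := by
        have h8 : |Y| ≤ |z / w| + |z / w - Y| := by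
          calc |Y| = |z / w - (z / w - Y)| := by ring_nf
            _ ≤ _ := abs_sub _ _
        have h9 : p.1 * |Y| ≤ 1 / 100 * |Y| := by gcongr
        linarith
      have e5 : p.1 * |Y| ≤ p.1 * (4 * B) := by
        have := h2.le
        gcongr
      calc |Y - R| = |(z / w - R) - (z / w - Y)| := by ring_nf
        _ ≤ (6 * n + 2) * p.1 * B + p.1 * |Y| := (abs_sub _ _).trans (add_le_add e1 e2)
        _ ≤ (6 * n + 6) * p.1 * B := by linarith)
  refine key.trans_eq ?_
  simp
  left
  ring

end Solvers

/-! ### Assembly of the factorization statements. -/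

section Factorization

open Filter

theorem factor_accuracy {n : ℕ} {t : ℕ → ℝ} (hT : (toeplitz n t).PosDef) (rule : Downdating)
    {K : ℝ → ℝ} (hK : ∀ᶠ p in highPrecision,
      ‖toeplitz n t - (factor p.2 rule n t)ᵀ * factor p.2 rule n t‖ ≤ K p.1) :
    ∃ ε₀ : ℝ, 0 < ε₀ ∧ ∀ ε : ℝ, 0 < ε → ε < ε₀ → ∀ F : FloatArith ε,
      FactorRuns F rule n t ∧
      (factor F rule n t).BlockTriangular id ∧ (∀ k, 0 < factor F rule n t k k) ∧
      ∃ ΔT : Matrix (Fin n) (Fin n) ℝ,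
        toeplitz n t = (factor F rule n t)ᵀ * factor F rule n t + ΔT ∧ ‖ΔT‖ ≤ K ε := by
  refine exists_precision_of_eventually (P := fun ε F => FactorRuns F rule n t ∧
    (factor F rule n t).BlockTriangular id ∧ (∀ k, 0 < factor F rule n t k k) ∧
    ∃ ΔT : Matrix (Fin n) (Fin n) ℝ,
      toeplitz n t = (factor F rule n t)ᵀ * factor F rule n t + ΔT ∧ ‖ΔT‖ ≤ K ε) ?_
  filter_upwards [hK, eventually_factorRuns rule hT, eventually_factor_diag_pos hT rule]
    with p h1 h2 h3
  exact ⟨h2, factor_blockTriangular p.2 rule t n, h3, _, (add_sub_cancel _ _).symm, h1⟩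

theorem bareiss_accuracy {n : ℕ} {t : ℕ → ℝ} (hT : (toeplitz n t).PosDef) :
    ∃ ε₀ : ℝ, 0 < ε₀ ∧ ∀ ε : ℝ, 0 < ε → ε < ε₀ → ∀ F : FloatArith ε,
      BareissRuns F n t ∧
      (bareiss F n t).BlockTriangular id ∧ (∀ k, 0 < bareiss F n t k k) ∧
      ∃ ΔT : Matrix (Fin n) (Fin n) ℝ,
        toeplitz n t = (bareiss F n t)ᵀ *
          (Matrix.diagonal fun k => (bareiss F n t k k)⁻¹) * bareiss F n t + ΔT ∧
        ‖ΔT‖ ≤ 5000 * (ε * t 0 * (n : ℝ) ^ 4) := by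
  refine exists_precision_of_eventually (P := fun ε F => BareissRuns F n t ∧
      (bareiss F n t).BlockTriangular id ∧ (∀ k, 0 < bareiss F n t k k) ∧
      ∃ ΔT : Matrix (Fin n) (Fin n) ℝ,
        toeplitz n t = (bareiss F n t)ᵀ *
          (Matrix.diagonal fun k => (bareiss F n t k k)⁻¹) * bareiss F n t + ΔT ∧
        ‖ΔT‖ ≤ 5000 * (ε * t 0 * (n : ℝ) ^ 4)) ?_
  filter_upwards [eventually_bareiss_norm_le hT, eventually_bareissGen_diag_pos hT] with p h1 h2
  refine ⟨bareissRuns_of_diag_ne_zero p.2 t fun i hi => (h2 i hi).ne',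
    bareiss_blockTriangular p.2 t n, fun k => ?_, _, (add_sub_cancel _ _).symm, ?_⟩
  · rw [bareiss_apply]
    exact h2 k k.2
  · rwa [bareiss_transpose_mul p.2 t h2]

end Factorization

theorem corollary5p1 :
    -- mixed downdating, in both variants
    (∃ C : ℝ, ∀ rule : Downdating, rule = .mixedV ∨ rule = .mixedU →
      ∀ (n : ℕ) (t : ℕ → ℝ), (toeplitz n t).PosDef →
        ∃ ε₀ : ℝ, 0 < ε₀ ∧ ∀ ε : ℝ, 0 < ε → ε < ε₀ → ∀ F : FloatArith ε,
          FactorRuns F rule n t ∧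
          (factor F rule n t).BlockTriangular id ∧ (∀ k, 0 < factor F rule n t k k) ∧
          ∃ ΔT : Matrix (Fin n) (Fin n) ℝ,
            toeplitz n t = (factor F rule n t)ᵀ * factor F rule n t + ΔT ∧
            ‖ΔT‖ ≤ C * (ε * t 0 * (n : ℝ) ^ 2)) ∧
    -- hyperbolic downdating
    (∃ C : ℝ, ∀ (n : ℕ) (t : ℕ → ℝ), (toeplitz n t).PosDef →
        ∃ ε₀ : ℝ, 0 < ε₀ ∧ ∀ ε : ℝ, 0 < ε → ε < ε₀ → ∀ F : FloatArith ε,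
          FactorRuns F .hyperbolic n t ∧
          (factor F .hyperbolic n t).BlockTriangular id ∧
          (∀ k, 0 < factor F .hyperbolic n t k k) ∧
          ∃ ΔT : Matrix (Fin n) (Fin n) ℝ,
            toeplitz n t = (factor F .hyperbolic n t)ᵀ * factor F .hyperbolic n t + ΔT ∧
            ‖ΔT‖ ≤ C * (ε * t 0 * (n : ℝ) ^ 3)) ∧
    -- the Bareiss algorithm: small backward error of the factorization
    (∃ c : Polynomial ℝ, ∀ (n : ℕ) (t : ℕ → ℝ), (toeplitz n t).PosDef →
        ∃ ε₀ : ℝ, 0 < ε₀ ∧ ∀ ε : ℝ, 0 < ε → ε < ε₀ → ∀ F : FloatArith ε,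
          BareissRuns F n t ∧
          (bareiss F n t).BlockTriangular id ∧ (∀ k, 0 < bareiss F n t k k) ∧
          ∃ ΔT : Matrix (Fin n) (Fin n) ℝ,
            toeplitz n t = (bareiss F n t)ᵀ *
              (Matrix.diagonal fun k => (bareiss F n t k k)⁻¹) * bareiss F n t + ΔT ∧
            ‖ΔT‖ ≤ c.eval (n : ℝ) * ε * ‖toeplitz n t‖) ∧
    -- backward stability of the solvers
    (∀ rule : Downdating, BackwardStable (fun {_} F => factorSolve rule F)) ∧
    BackwardStable (fun {_} F => bareissSolve F) := by
  refine ⟨⟨5000, fun rule hrule n t hT =>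
      factor_accuracy hT rule (K := fun ε => 5000 * (ε * t 0 * (n : ℝ) ^ 2))
        (eventually_mixed_norm_le hT rule hrule)⟩,
    ⟨5000, fun n t hT =>
      factor_accuracy hT .hyperbolic (K := fun ε => 5000 * (ε * t 0 * (n : ℝ) ^ 3))
        (eventually_hyperbolic_norm_le hT)⟩,
    ⟨5000 * Polynomial.X ^ 4, fun n t hT => ?_⟩,
    factorSolve_backwardStable, bareissSolve_backwardStable⟩
  obtain ⟨ε₀, h0, h⟩ := bareiss_accuracy hT
  refine ⟨ε₀, h0, fun ε hε hε' F => ?_⟩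
  obtain ⟨h1, h2, h3, ΔT, h4, h5⟩ := h ε hε hε' F
  refine ⟨h1, h2, h3, ΔT, h4, h5.trans ?_⟩
  have heval : Polynomial.eval (n : ℝ) (5000 * Polynomial.X ^ 4) = 5000 * (n : ℝ) ^ 4 := by
    simp
  rw [heval]
  rcases Nat.eq_zero_or_pos n with rfl | hn
  · simp
  · have h6 := toeplitz_zero_le_norm (t := t) hn
    calc 5000 * (ε * t 0 * (n : ℝ) ^ 4) = 5000 * (n : ℝ) ^ 4 * ε * t 0 := by ring
      _ ≤ _ := by gcongr
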